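/- **Notions.** Let $w$ be a nonempty word of length $N$. An *LZ77 factorisation* of $w$ of size $\ell$ is a representation $w=f_1f_2\cdots f_\ell$ with nonempty $f_i$ in which each $f_i$ is either a single letter (a *free letter*) or a *factor*, i.e. $f_i=w[j\,..\,j+|f_i|-1]$ for a recorded position $1\le j\le |f_1\cdots f_{i-1}|$ (this *definition* of $f_i$ may overlap $f_i$). A *straight-line program* (SLP) has nonterminals $X_1,\dots,X_s$, with one rule for each, of the form $X_i\to a$ ($a$ a letter) or $X_i\to X_jX_k$ with $j,k<i$; it generates the word derived from $X_s$, and its size is $s$. Let $\ell_{\min}(w)$ and $g(w)$ be the sizes of a smallest LZ77 factorisation and of a smallest SLP of $w$. **The algorithm.** The main algorithm first computes an LZ77 factorisation of $w$, by some subroutine, and identifies letters with nonterminals generating them (one nonterminal for each free letter; the letters of a factor are copied from its definition). Then, while the current word has more than one letter, it applies *Pairing* and *Replacement*. *Pairing* marks letters as unpaired, first or second in a pair, from left to right. The first letter of the word starts as unpaired; then $i=2$, and the following is repeated while $i$ is within the word. If a factor begins at $i$, with definition beginning at $j$: * if the factor has length $1$, it becomes a free letter; * otherwise, if $j=i-1$,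 the letter at $i$ becomes free and the rest of the factor is given the definition beginning at $i-1$; * otherwise, if position $j$ is not marked as first in a pair, the letter at $i$ becomes free and the rest of the factor is given the definition beginning at $j+1$; * otherwise the pairing of the definition is copied letter by letter onto the factor and $i$ moves behind the factor; then, as long as the last letter of the factor is not marked as second in a pair, it is cut off, becomes a free unpaired letter, and $i$ moves back to it. After this, if $i$ is within the word and holds a free letter, this letter is paired with the one at $i-1$ if that one is unpaired, and is left unpaired otherwise, and $i$ increases by $1$. *Replacement* reads the word from left to right. A pair $ab$ of free letters is replaced by a fresh nonterminal $c$ (a free letter of the new word) with the rule $c\to ab$; unpaired free letters are copied; a factor is replaced by a copy of the part of the new word that corresponds to its definition, and this copy is a factor of the new word defined by that part. The output is the set of all rules introduced, the last nonterminal being the start symbol. The algorithm is run on a unit-cost word RAM with operations $+,-,\cdot,\div,\bmod,<,=$ and with memory initially $0$. *Linear time* means: for every constant $c$ there is $K$ such that on every nonempty word $w$ of length $N$ over the alphabet $\{1,\dots,N^c\}$ the program halts within $KN$ steps, on a machine whose words hold the numbers $0,\dots,KN^K$. **Theorem.** There is an absolute constant $C$ such that the following hold ($\log$ is the natural logarithm).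 1. There is a program that computes a smallest LZ77 factorisation of the input word in linear time. 2. With any such program as the subroutine, the main algorithm runs in linear time and outputs an SLP generating the input word $w$, whose size is at most $C\bigl(\ell+\ell\log(N/\ell)\bigr)$ with $\ell=\ell_{\min}(w)$, and also at most $C\bigl(1+\log(N/g)\bigr)\,g$ with $g=g(w)$; that is, its approximation ratio for the smallest grammar is $O(1+\log(N/g))$. 3. More generally, let $w$ be any nonempty word of natural numbers (of any size), and suppose that the subroutine, on a machine whose words hold $0,\dots,B$, where $B\ge CN$ and all letters of $w$ are at most $B$, computes within $T$ steps an arbitrary LZ77 factorisation of $w$, of size $\ell$. Then on this machine the main algorithm halts within $T+CN$ steps and outputs an SLP generating $w$ of size at most $C\bigl(\ell+\ell\log(N/\ell)\bigr)$. 4. $\ell_{\min}(w)\le g(w)$ for every nonempty word $w$. -/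

import Mathlib

/-! ## Words, LZ77 factorisations, straight-line programs -/

/-- A phrase of an LZ77 factorisation: a free letter `a`, or a factor of length `n` whose
definition begins at position `j` of the word (positions are counted from `1`). -/
inductive Phrase (α : Type) where
  | free (a : α)
  | copy (j n : ℕ)

/-- `IsLZ77 F w`: the sequence of phrases `F` is an LZ77 factorisation of `w`. Phrases are appended
one by one; a factor is a nonempty word `v` occurring in the word read so far, `u ++ v`, at some
position `j ≤ |u|` (the occurrence may overlap the factor itself). -/
inductive IsLZ77 {α : Type} : List (Phrase α) → List α → Prop where
  | nil : IsLZ77 [] []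
  | free {F : List (Phrase α)} {u : List α} (a : α) (h : IsLZ77 F u) :
      IsLZ77 (F ++ [Phrase.free a]) (u ++ [a])
  | copy {F : List (Phrase α)} {u : List α} (v : List α) (j : ℕ) (h : IsLZ77 F u)
      (hv : v ≠ []) (hj : 1 ≤ j) (hju : j ≤ u.length)
      (hdef : ((u ++ v).drop (j - 1)).take v.length = v) :
      IsLZ77 (F ++ [Phrase.copy j v.length]) (u ++ v)

/-- The size of the smallest LZ77 factorisation of `w`. -/
noncomputable def lzSize {α : Type} (w : List α) : ℕ :=
  sInf {n | ∃ F : List (Phrase α), IsLZ77 F w ∧ F.length = n}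

/-- A straight-line program with nonterminals `X_0, …, X_{size-1}`; the rule of `X_i` is
`X_i → a` for a letter `a`, or `X_i → X_j X_k` with `j, k < i`. The start symbol is the last
nonterminal. -/
structure SLP (α : Type) where
  size : ℕ
  rule : (i : Fin size) → α ⊕ (Fin i.val × Fin i.val)

/-- The unique word derived from the nonterminal `X_i`. -/
def SLP.word {α : Type} (S : SLP α) (i : Fin S.size) : List α :=
  match S.rule i with
  | Sum.inl a => [a]
  | Sum.inr (j, k) =>
      S.word ⟨j.val, j.isLt.trans i.isLt⟩ ++ S.word ⟨k.val, k.isLt.trans i.isLt⟩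
termination_by i.val
decreasing_by
  · exact j.isLt
  · exact k.isLt

/-- `S` generates `w`. -/
def SLP.Generates {α : Type} (S : SLP α) (w : List α) : Prop :=
  ∃ h : 0 < S.size, S.word ⟨S.size - 1, Nat.sub_lt h Nat.one_pos⟩ = w

/-- The size of the smallest straight-line program generating `w`. -/
noncomputable def slpSize {α : Type} (w : List α) : ℕ :=
  sInf {n | ∃ S : SLP α, S.Generates w ∧ S.size = n}

/-! ## The computational model: a word RAM with a structured programming language -/

namespace RAM

/-- Binary machine operations; tests return `1` (true) or `0` (false). -/
inductive BinOp where
  | add | sub | mul | div | mod | lt | eq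

def BinOp.eval : BinOp → ℕ → ℕ → ℕ
  | .add, x, y => x + y
  | .sub, x, y => x - y
  | .mul, x, y => x * y
  | .div, x, y => x / y
  | .mod, x, y => x % y
  | .lt, x, y => if x < y then 1 else 0
  | .eq, x, y => if x = y then 1 else 0

/-- Expressions: constants, registers, cells of tables, operations. -/
inductive Expr where
  | const (n : ℕ)
  | reg (r : ℕ)
  | cell (a : ℕ) (e : Expr)
  | bin (o : BinOp) (e f : Expr)

/-- A memory state: registers and tables. A given program mentions only finitely many of them. -/
structure State where
  reg : ℕ → ℕ
  arr : ℕ → ℕ → ℕ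

def State.setReg (σ : State) (r x : ℕ) : State :=
  { σ with reg := Function.update σ.reg r x }

def State.setCell (σ : State) (a k x : ℕ) : State :=
  { σ with arr := Function.update σ.arr a (Function.update (σ.arr a) k x) }

def Expr.eval (σ : State) : Expr → ℕ
  | .const n => n
  | .reg r => σ.reg r
  | .cell a e => σ.arr a (e.eval σ)
  | .bin o e f => o.eval (e.eval σ) (f.eval σ)

/-- All values that occur in the evaluation of the expression fit in a machine word,
i.e. are at most `B`. -/
def Expr.Fits (B : ℕ) (σ : State) : Expr → Prop
  | .const n => n ≤ B
  | .reg r => σ.reg r ≤ B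
  | .cell a e => e.Fits B σ ∧ σ.arr a (e.eval σ) ≤ B
  | .bin o e f => e.Fits B σ ∧ f.Fits B σ ∧ o.eval (e.eval σ) (f.eval σ) ≤ B

/-- Every constant, memory access and operation takes one unit of time. -/
def Expr.cost : Expr → ℕ
  | .const _ => 1
  | .reg _ => 1
  | .cell _ e => e.cost + 1
  | .bin _ e f => e.cost + f.cost + 1

/-- Programs. -/
inductive Cmd where
  | skip
  | assign (r : ℕ) (e : Expr)
  | store (a : ℕ) (k e : Expr)
  | seq (c d : Cmd)
  | ite (e : Expr) (c d : Cmd)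
  | loop (e : Expr) (c : Cmd)

/-- `Exec B c σ t τ`: on a machine whose words hold the numbers `0, …, B`, the program `c` started
in the state `σ` halts after `t` units of time in the state `τ`. There is no execution in which
a number larger than `B` occurs. `loop e c` repeats `c` while `e` is nonzero. -/
inductive Exec (B : ℕ) : Cmd → State → ℕ → State → Prop where
  | skip (σ : State) : Exec B .skip σ 0 σ
  | assign (σ : State) (r : ℕ) (e : Expr) (he : e.Fits B σ) :
      Exec B (.assign r e) σ (e.cost + 1) (σ.setReg r (e.eval σ))
  | store (σ : State) (a : ℕ) (k e : Expr) (hk : k.Fits B σ) (he : e.Fits B σ) :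
      Exec B (.store a k e) σ (k.cost + e.cost + 1) (σ.setCell a (k.eval σ) (e.eval σ))
  | seq {c d : Cmd} {σ τ υ : State} {s t : ℕ} (hc : Exec B c σ s τ) (hd : Exec B d τ t υ) :
      Exec B (.seq c d) σ (s + t) υ
  | ite_true {e : Expr} {c d : Cmd} {σ τ : State} {t : ℕ} (he : e.Fits B σ) (h : e.eval σ ≠ 0)
      (hc : Exec B c σ t τ) : Exec B (.ite e c d) σ (e.cost + t) τ
  | ite_false {e : Expr} {c d : Cmd} {σ τ : State} {t : ℕ} (he : e.Fits B σ) (h : e.eval σ = 0)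
      (hd : Exec B d σ t τ) : Exec B (.ite e c d) σ (e.cost + t) τ
  | loop_true {e : Expr} {c : Cmd} {σ τ υ : State} {s t : ℕ} (he : e.Fits B σ)
      (h : e.eval σ ≠ 0) (hc : Exec B c σ s τ) (hl : Exec B (.loop e c) τ t υ) :
      Exec B (.loop e c) σ (e.cost + s + t) υ
  | loop_false {e : Expr} {c : Cmd} {σ : State} (he : e.Fits B σ) (h : e.eval σ = 0) :
      Exec B (.loop e c) σ e.cost σ

instance (n : ℕ) : OfNat Expr n := ⟨.const n⟩
instance : Add Expr := ⟨.bin .add⟩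
instance : Sub Expr := ⟨.bin .sub⟩

/-- The tests `e = f`, `e ≠ f`, `e < f`, `e ≤ f`, `¬ e`. -/
def Expr.isEq (e f : Expr) : Expr := .bin .eq e f
def Expr.isNe (e f : Expr) : Expr := .bin .eq (.bin .eq e f) (.const 0)
def Expr.isLt (e f : Expr) : Expr := .bin .lt e f
def Expr.isLe (e f : Expr) : Expr := .bin .lt e (.bin .add f (.const 1))
def Expr.neg (e : Expr) : Expr := .bin .eq e (.const 0)

/-- The commands of a list, one after the other. -/
def block : List Cmd → Cmd
  | [] => .skip
  | c :: cs => .seq c (block cs)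

/-- Repeat `c` until `e` holds (`c` is executed at least once). -/
def repeatUntil (c : Cmd) (e : Expr) : Cmd := .seq c (.loop e.neg c)

/-- Conditional without alternative. -/
def when (e : Expr) (c : Cmd) : Cmd := .ite e c .skip

/-! ### Registers and tables with a fixed role -/

/-- Register: length `|w|` of the current word. -/
abbrev rLen : ℕ := 0
/-- Register: the position `i` in the current word. -/
abbrev rI : ℕ := 1
/-- Register: a position `j` in a definition. -/
abbrev rJ : ℕ := 2
/-- Register: the position `i'` in the new word. -/
abbrev rI' : ℕ := 3
/-- Register: a position `j'` in the new word. -/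
abbrev rJ' : ℕ := 4
/-- Register: number of nonterminals introduced so far. -/
abbrev rCnt : ℕ := 5

/-- Table: the letters of the current word, in cells `1, …, |w|`. -/
abbrev tWord : ℕ := 0
/-- Table: cell `i` holds the beginning of the definition of the factor that begins at `i`,
and `0` if no factor begins at `i`. -/
abbrev tBeg : ℕ := 1
/-- Table: cell `i` holds `1` if a factor ends at `i`, and `0` otherwise. -/
abbrev tEnd : ℕ := 2
/-- Table: the pairing; cell `i` holds `pNone`, `pFirst` or `pSecond`. -/
abbrev tPair : ℕ := 3
/-- Table: cell `i` holds the position in the new word that corresponds to `i`. -/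
abbrev tPos : ℕ := 4
/-- Output table: cell `c` is `0` if the rule of nonterminal `c` is `X_c → a`,
and `1` if it is `X_c → X_j X_k`. -/
abbrev tKind : ℕ := 5
/-- Output table: cell `c` holds `a`, respectively `j`. -/
abbrev tLeft : ℕ := 6
/-- Output table: cell `c` holds `k` if the rule is `X_c → X_j X_k`. -/
abbrev tRight : ℕ := 7

/-- The letter is unpaired. -/
abbrev pNone : Expr := .const 0
/-- The letter is the first one of a pair. -/
abbrev pFirst : Expr := .const 1
/-- The letter is the second one of a pair. -/
abbrev pSecond : Expr := .const 2

abbrev xLen : Expr := .reg rLen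
abbrev xI : Expr := .reg rI
abbrev xJ : Expr := .reg rJ
abbrev xI' : Expr := .reg rI'
abbrev xJ' : Expr := .reg rJ'
abbrev xCnt : Expr := .reg rCnt

/-! ### The algorithm -/

/-- Replace every letter by a nonterminal that generates it: every free letter of the initial
factorisation gets a nonterminal of its own, and the letters of a factor are copied from its
definition. -/
def algInit : Cmd := block [
  .assign rCnt 0,
  .assign rI 1,
  .loop (xI.isLe xLen) (
    .ite (.cell tBeg xI)
      (block [
        .assign rJ (.cell tBeg xI),
        repeatUntil (block [
            .store tWord xI (.cell tWord xJ),
            .assign rI (xI + 1),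
            .assign rJ (xJ + 1)])
          (.cell tEnd (xI - 1))])
      (block [
        .store tKind xCnt 0,
        .store tLeft xCnt (.cell tWord xI),
        .store tWord xI xCnt,
        .assign rCnt (xCnt + 1),
        .assign rI (xI + 1)]))]

/-- Computing a pairing by a left-to-right sweep, modifying the factorisation on the way. -/
def algPairing : Cmd := block [
  .store tPair 1 pNone,
  .assign rI 2,
  .loop (xI.isLe xLen) (block [
    -- a factor begins at `i`
    when (.cell tBeg xI) (
      -- a one-letter factor: turn it into a free letter
      .ite (.cell tEnd xI)
        (block [
          .store tBeg xI 0,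
          .store tEnd xI 0]) (
      -- the definition begins one position to the left: split the factor
      .ite ((Expr.cell tBeg xI).isEq (xI - 1))
        (block [
          .store tBeg (xI + 1) (xI - 1),
          .store tBeg xI 0]) (
      -- the definition does not begin with a pair: shorten the factor from the left
      .ite ((Expr.cell tPair (.cell tBeg xI)).isNe pFirst)
        (block [
          .store tBeg (xI + 1) (.cell tBeg xI + 1),
          .store tBeg xI 0])
      -- a good factor: copy the pairing, then shorten the factor from the right
        (block [
          .assign rJ (.cell tBeg xI),
          repeatUntil (block [
              .store tPair xI (.cell tPair xJ),
              .assign rI (xI + 1),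
              .assign rJ (xJ + 1)])
            (.cell tEnd (xI - 1)),
          .loop ((Expr.cell tPair (xI - 1)).isNe pSecond) (block [
            .assign rI (xI - 1),
            .store tEnd (xI - 1) 1,
            .store tEnd xI 0,
            .store tPair xI pNone])])))),
    -- a free letter at `i`
    when (xI.isLe xLen) (when (Expr.cell tBeg xI).neg (block [
      .ite ((Expr.cell tPair (xI - 1)).isEq pNone)
        (block [
          .store tPair (xI - 1) pFirst,
          .store tPair xI pSecond])
        (.store tPair xI pNone),
      .assign rI (xI + 1)]))])]

/-- Replacing the pairs; the fresh letter for a pair `ab` of free letters is the next nonterminal,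
with the rule whose right-hand side is `ab`. -/
def algReplace : Cmd := block [
  .assign rI 1,
  .assign rI' 1,
  .loop (xI.isLe xLen) (block [
    -- a factor begins at `i`
    when (.cell tBeg xI) (block [
      .assign rJ' (.cell tPos (.cell tBeg xI)),
      .store tBeg xI' xJ',
      .store tBeg xI 0,
      repeatUntil (block [
          .store tPos xI xI',
          .store tWord xI' (.cell tWord xJ'),
          .assign rI' (xI' + 1),
          .assign rJ' (xJ' + 1),
          .ite ((Expr.cell tPair xI).isEq pFirst)
            (.assign rI (xI + 2))
            (.assign rI (xI + 1))])
        (.cell tEnd (xI - 1)),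
      .store tEnd (xI' - 1) 1,
      .store tEnd (xI - 1) 0]),
    -- a free letter at `i`
    when (xI.isLe xLen) (when (Expr.cell tBeg xI).neg (block [
      .store tPos xI xI',
      .ite ((Expr.cell tPair xI).isEq pNone)
        (block [
          .store tWord xI' (.cell tWord xI),
          .assign rI (xI + 1),
          .assign rI' (xI' + 1)])
        (block [
          .store tKind xCnt 1,
          .store tLeft xCnt (.cell tWord xI),
          .store tRight xCnt (.cell tWord (xI + 1)),
          .store tWord xI' xCnt,
          .assign rCnt (xCnt + 1),
          .assign rI (xI + 2),
          .assign rI' (xI' + 1)])]))]),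
  .assign rLen (xI' - 1)]

/-- The main algorithm, with the subroutine `lz` for the computation of the LZ77 factorisation. -/
def algMain (lz : Cmd) : Cmd := block [
  lz,
  algInit,
  .loop (Expr.isLt 1 xLen) (block [
    algPairing,
    algReplace])]

/-! ### Input, output, running time -/

/-- The cells `1, …, |l|` of the table `a` hold the entries of `l`. -/
def State.Holds (σ : State) (a : ℕ) (l : List ℕ) : Prop :=
  ∀ (k : ℕ) (h : k < l.length), σ.arr a (k + 1) = l[k]

/-- The initial state for the input `w`: its length and its letters; all other memory is `0`. -/
def inputState (w : List ℕ) : State where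
  reg := fun r => if r = rLen then w.length else 0
  arr := fun a k => if a = tWord ∧ 1 ≤ k then w.getD (k - 1) 0 else 0

/-- The entries of the table `tBeg` for one phrase. -/
def begRow : Phrase ℕ → List ℕ
  | .free _ => [0]
  | .copy j n => j :: List.replicate (n - 1) 0

/-- The entries of the table `tEnd` for one phrase. -/
def endRow : Phrase ℕ → List ℕ
  | .free _ => [0]
  | .copy _ n => List.replicate (n - 1) 0 ++ [1]

/-- The state `σ` stores the word `w` together with its factorisation `F`;
all other registers and cells are arbitrary. -/
def State.Stores (σ : State) (w : List ℕ) (F : List (Phrase ℕ)) : Prop :=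
  σ.reg rLen = w.length ∧ σ.Holds tWord w ∧
    σ.Holds tBeg (F.flatMap begRow) ∧ σ.Holds tEnd (F.flatMap endRow)

/-- The output tables in the state `σ` describe the straight-line program `S`. -/
def State.Outputs (σ : State) (S : SLP ℕ) : Prop :=
  σ.reg rCnt = S.size ∧ ∀ i : Fin S.size,
    match S.rule i with
    | Sum.inl a => σ.arr tKind i = 0 ∧ σ.arr tLeft i = a
    | Sum.inr (j, k) => σ.arr tKind i = 1 ∧ σ.arr tLeft i = j ∧ σ.arr tRight i = k

/-- The program `P` achieves `post` in linear time: for each constant `c` there is `K` such that,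
for every nonempty word `w` of length `N` with letters in `{1, …, N ^ c}`, the program started on
`w` halts after at most `K * N` units of time in a state satisfying `post w`, on a machine with
words of `O(log N)` bits (holding the numbers up to `K * N ^ K`). -/
def AchievesInLinearTime (P : Cmd) (post : List ℕ → State → Prop) : Prop :=
  ∀ c : ℕ, ∃ K : ℕ, ∀ w : List ℕ, w ≠ [] → (∀ a ∈ w, 1 ≤ a ∧ a ≤ w.length ^ c) →
    ∃ (t : ℕ) (τ : State), Exec (K * w.length ^ K) P (inputState w) t τ ∧
      t ≤ K * w.length ∧ post w τ

/-- `lz` computes in linear time a smallest LZ77 factorisation of the input word. -/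
def ComputesLZ77 (lz : Cmd) : Prop :=
  AchievesInLinearTime lz fun w τ =>
    ∃ F : List (Phrase ℕ), IsLZ77 F w ∧ F.length = lzSize w ∧ τ.Stores w F

end RAM

/-! Size of the output. Two numbers are followed through the rounds: the number `k` of factors and
the number `f` of free letters. Replacement trades the two free letters of a pair for one free
letter and one nonterminal, and turns each factor into one factor. So `k` and the sum of `f` and the
number of nonterminals are unchanged (`wp_algReplace`). Pairing never increases `k`, and it frees at
most four letters per factor (`wp_algPairing`): at most two at the front, until the definition
begins with a pair (`PairStage.next`), and at most two at the end (`wp_pairCutLoop`). Both bounds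
rest on the fact that no two consecutive letters stay unpaired. For the same reason a round shortens
the word from `n` to at most `(2 n + 1) / 3` letters, hence to at most `5 n / 6` if `n ≥ 2`.

Since also `f ≤ n` after pairing, a round adds at most `4 min(ℓ, n)` to the sum. As long as `n ≥ ℓ`
this is `4 ℓ` in each of `O(1 + log(N/ℓ))` rounds; below `ℓ` it is a geometric series. Both regimes
are handled at once by the potential `linLog`, which drops by at least `min(ℓ, n) / 6` per round
(`min_le_linLog_sub`), and `MainState` is the resulting invariant. The running times of the rounds
form a geometric series as well.

Correctness. A factor that survives pairing is paired exactly as its definition and consists of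
whole pairs and unpaired letters, so its image in the new word is a copy of the image of its
definition. Hence the new word inherits a factorisation, and the word it derives (`expand`) does not
change.

Comparison with grammars. A traversal of a derivation, in which a nonterminal met again becomes a
single factor, yields an LZ77 factorisation with at most one phrase more than there are binary rules
(`SLP.exists_isLZ77_append`). This gives `ℓ ≤ g`, and the bound in `ℓ` passes to `g` by monotonicity
of `x + x log(N/x)` (`Real.mul_one_add_log_div_le`).

Computing a smallest factorisation. The greedy factorisation is optimal (`GreedyState.opt_succ`). It
needs the longest previous factor at each position, which is a by-product of inserting the suffixes
from left to right into a compact trie with suffix links. Children are found by direct addressing in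
memory that is initially `0`, so neither the alphabet nor an initialisation costs time. The walk is
linear in total by the amortisation of `triePotential`. -/

namespace RAM

/-! ### Values, word-size conditions and costs of expressions. -/

@[simp] theorem Expr.eval_const (σ : State) (n : ℕ) : (Expr.const n).eval σ = n := rfl
@[simp] theorem Expr.eval_reg (σ : State) (r : ℕ) : (Expr.reg r).eval σ = σ.reg r := rfl
@[simp] theorem Expr.eval_cell (σ : State) (a : ℕ) (e : Expr) :
    (Expr.cell a e).eval σ = σ.arr a (e.eval σ) := rfl
@[simp] theorem Expr.zero_eq : (0 : Expr) = .const 0 := rfl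
@[simp] theorem Expr.one_eq : (1 : Expr) = .const 1 := rfl
@[simp] theorem Expr.two_eq : (2 : Expr) = .const 2 := rfl
@[simp] theorem Expr.eval_add (σ : State) (e f : Expr) :
    (e + f).eval σ = e.eval σ + f.eval σ := rfl
@[simp] theorem Expr.eval_sub (σ : State) (e f : Expr) :
    (e - f).eval σ = e.eval σ - f.eval σ := rfl
@[simp] theorem Expr.eval_mul (σ : State) (e f : Expr) :
    (Expr.bin .mul e f).eval σ = e.eval σ * f.eval σ := rfl
-- Tests enter the programs only as conditions, so all that is needed about their values is when
-- they vanish.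
@[simp] theorem Expr.eval_isEq (σ : State) (e f : Expr) :
    (e.isEq f).eval σ = 0 ↔ e.eval σ ≠ f.eval σ := by
  change (if _ then _ else _) = 0 ↔ _
  split_ifs <;> simp_all
@[simp] theorem Expr.eval_isNe (σ : State) (e f : Expr) :
    (e.isNe f).eval σ = 0 ↔ e.eval σ = f.eval σ := by
  change (if (if _ then _ else _) = 0 then _ else _) = 0 ↔ _
  split_ifs <;> simp_all
@[simp] theorem Expr.eval_isLt (σ : State) (e f : Expr) :
    (e.isLt f).eval σ = 0 ↔ f.eval σ ≤ e.eval σ := by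
  change (if _ then _ else _) = 0 ↔ _
  split_ifs <;> simp_all
@[simp] theorem Expr.eval_isLe (σ : State) (e f : Expr) :
    (e.isLe f).eval σ = 0 ↔ f.eval σ < e.eval σ := by
  change (if e.eval σ < f.eval σ + 1 then 1 else 0) = 0 ↔ _
  split_ifs <;> simp_all
@[simp] theorem Expr.eval_neg (σ : State) (e : Expr) :
    e.neg.eval σ = 0 ↔ e.eval σ ≠ 0 := by
  change (if _ then _ else _) = 0 ↔ _
  split_ifs <;> simp_all

@[simp] theorem Expr.fits_const (B : ℕ) (σ : State) (n : ℕ) :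
    (Expr.const n).Fits B σ ↔ n ≤ B := Iff.rfl
@[simp] theorem Expr.fits_reg (B : ℕ) (σ : State) (r : ℕ) :
    (Expr.reg r).Fits B σ ↔ σ.reg r ≤ B := Iff.rfl
@[simp] theorem Expr.fits_cell (B : ℕ) (σ : State) (a : ℕ) (e : Expr) :
    (Expr.cell a e).Fits B σ ↔ e.Fits B σ ∧ σ.arr a (e.eval σ) ≤ B := Iff.rfl
@[simp] theorem Expr.fits_add (B : ℕ) (σ : State) (e f : Expr) :
    (e + f).Fits B σ ↔ e.Fits B σ ∧ f.Fits B σ ∧ e.eval σ + f.eval σ ≤ B := Iff.rfl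
@[simp] theorem Expr.fits_sub (B : ℕ) (σ : State) (e f : Expr) :
    (e - f).Fits B σ ↔ e.Fits B σ ∧ f.Fits B σ ∧ e.eval σ - f.eval σ ≤ B := Iff.rfl
@[simp] theorem Expr.fits_mul (B : ℕ) (σ : State) (e f : Expr) :
    (Expr.bin .mul e f).Fits B σ ↔ e.Fits B σ ∧ f.Fits B σ ∧ e.eval σ * f.eval σ ≤ B := Iff.rfl

theorem BinOp.eval_lt_le {B : ℕ} (hB : 1 ≤ B) (x y : ℕ) : BinOp.lt.eval x y ≤ B := by
  change (if _ then _ else _) ≤ _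
  split_ifs <;> omega
theorem BinOp.eval_eq_le {B : ℕ} (hB : 1 ≤ B) (x y : ℕ) : BinOp.eq.eval x y ≤ B := by
  change (if _ then _ else _) ≤ _
  split_ifs <;> omega

@[simp] theorem Expr.fits_isEq {B : ℕ} (hB : 1 ≤ B) (σ : State) (e f : Expr) :
    (e.isEq f).Fits B σ ↔ e.Fits B σ ∧ f.Fits B σ :=
  ⟨fun h => ⟨h.1, h.2.1⟩, fun h => ⟨h.1, h.2, BinOp.eval_eq_le hB _ _⟩⟩
@[simp] theorem Expr.fits_isNe {B : ℕ} (hB : 1 ≤ B) (σ : State) (e f : Expr) :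
    (e.isNe f).Fits B σ ↔ e.Fits B σ ∧ f.Fits B σ :=
  ⟨fun h => ⟨h.1.1, h.1.2.1⟩, fun h => ⟨⟨h.1, h.2, BinOp.eval_eq_le hB _ _⟩, Nat.zero_le _,
    BinOp.eval_eq_le hB _ _⟩⟩
@[simp] theorem Expr.fits_isLt {B : ℕ} (hB : 1 ≤ B) (σ : State) (e f : Expr) :
    (e.isLt f).Fits B σ ↔ e.Fits B σ ∧ f.Fits B σ :=
  ⟨fun h => ⟨h.1, h.2.1⟩, fun h => ⟨h.1, h.2, BinOp.eval_lt_le hB _ _⟩⟩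
@[simp] theorem Expr.fits_isLe {B : ℕ} (σ : State) (e f : Expr) :
    (e.isLe f).Fits B σ ↔ e.Fits B σ ∧ f.Fits B σ ∧ f.eval σ + 1 ≤ B :=
  ⟨fun h => ⟨h.1, h.2.1.1, h.2.1.2.2⟩, fun h => ⟨h.1, ⟨h.2.1, by
    have := h.2.2
    change 1 ≤ B
    omega, h.2.2⟩, BinOp.eval_lt_le (by omega) _ _⟩⟩
@[simp] theorem Expr.fits_neg {B : ℕ} (hB : 1 ≤ B) (σ : State) (e : Expr) :
    e.neg.Fits B σ ↔ e.Fits B σ :=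
  ⟨fun h => h.1, fun h => ⟨h, Nat.zero_le _, BinOp.eval_eq_le hB _ _⟩⟩

@[simp] theorem Expr.cost_const (n : ℕ) : (Expr.const n).cost = 1 := rfl
@[simp] theorem Expr.cost_reg (r : ℕ) : (Expr.reg r).cost = 1 := rfl
@[simp] theorem Expr.cost_cell (a : ℕ) (e : Expr) : (Expr.cell a e).cost = e.cost + 1 := rfl
@[simp] theorem Expr.cost_add (e f : Expr) : (e + f).cost = e.cost + f.cost + 1 := rfl
@[simp] theorem Expr.cost_sub (e f : Expr) : (e - f).cost = e.cost + f.cost + 1 := rfl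
@[simp] theorem Expr.cost_bin (o : BinOp) (e f : Expr) :
    (Expr.bin o e f).cost = e.cost + f.cost + 1 := rfl
@[simp] theorem Expr.cost_isEq (e f : Expr) : (e.isEq f).cost = e.cost + f.cost + 1 := rfl
@[simp] theorem Expr.cost_isNe (e f : Expr) : (e.isNe f).cost = e.cost + f.cost + 3 := rfl
@[simp] theorem Expr.cost_isLt (e f : Expr) : (e.isLt f).cost = e.cost + f.cost + 1 := rfl
@[simp] theorem Expr.cost_isLe (e f : Expr) : (e.isLe f).cost = e.cost + f.cost + 3 := rfl
@[simp] theorem Expr.cost_neg (e : Expr) : e.neg.cost = e.cost + 2 := rfl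

theorem Expr.one_le_cost (e : Expr) : 1 ≤ e.cost := by
  cases e <;> simp [Expr.cost]

@[simp] theorem State.reg_setReg (σ : State) (r x s : ℕ) :
    (σ.setReg r x).reg s = if s = r then x else σ.reg s := by
  simp [State.setReg, Function.update_apply]
@[simp] theorem State.arr_setReg (σ : State) (r x : ℕ) : (σ.setReg r x).arr = σ.arr := rfl
@[simp] theorem State.reg_setCell (σ : State) (a k x : ℕ) : (σ.setCell a k x).reg = σ.reg := rfl
@[simp] theorem State.arr_setCell (σ : State) (a k x b : ℕ) :
    (σ.setCell a k x).arr b = if b = a then Function.update (σ.arr a) k x else σ.arr b := by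
  simp [State.setCell, Function.update_apply]

/-! ### A calculus for total correctness with running times. -/

/-- The program `c` started in `σ` halts; its running time and final state satisfy `Q`. -/
def Wp (B : ℕ) (c : Cmd) (σ : State) (Q : ℕ → State → Prop) : Prop :=
  ∃ t τ, Exec B c σ t τ ∧ Q t τ

theorem Wp.mono {B : ℕ} {c : Cmd} {σ : State} {Q R : ℕ → State → Prop} (h : Wp B c σ Q)
    (hQ : ∀ t τ, Q t τ → R t τ) : Wp B c σ R := by
  obtain ⟨t, τ, h, h'⟩ := h
  exact ⟨t, τ, h, hQ _ _ h'⟩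

theorem wp_assign {B r : ℕ} {e : Expr} {σ : State} {Q : ℕ → State → Prop} :
    Wp B (.assign r e) σ Q ↔ e.Fits B σ ∧ Q (e.cost + 1) (σ.setReg r (e.eval σ)) := by
  constructor
  · rintro ⟨t, τ, h, h'⟩
    cases h
    exact ⟨‹_›, h'⟩
  · exact fun h => ⟨_, _, .assign _ _ _ h.1, h.2⟩

theorem wp_store {B a : ℕ} {k e : Expr} {σ : State} {Q : ℕ → State → Prop} :
    Wp B (.store a k e) σ Q ↔ k.Fits B σ ∧ e.Fits B σ ∧
      Q (k.cost + e.cost + 1) (σ.setCell a (k.eval σ) (e.eval σ)) := by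
  constructor
  · rintro ⟨t, τ, h, h'⟩
    cases h
    exact ⟨‹_›, ‹_›, h'⟩
  · exact fun h => ⟨_, _, .store _ _ _ _ h.1 h.2.1, h.2.2⟩

theorem wp_skip {B : ℕ} {σ : State} {Q : ℕ → State → Prop} : Wp B .skip σ Q ↔ Q 0 σ := by
  constructor
  · rintro ⟨t, τ, h, h'⟩
    cases h
    exact h'
  · exact fun h => ⟨_, _, .skip _, h⟩

theorem wp_seq {B : ℕ} {c d : Cmd} {σ : State} {Q : ℕ → State → Prop} :
    Wp B (.seq c d) σ Q ↔ Wp B c σ fun s τ => Wp B d τ fun t υ => Q (s + t) υ := by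
  constructor
  · rintro ⟨t, τ, h, h'⟩
    cases h with
    | seq hc hd => exact ⟨_, _, hc, _, _, hd, h'⟩
  · rintro ⟨s, τ, hc, t, υ, hd, h⟩
    exact ⟨_, _, .seq hc hd, h⟩

theorem wp_block_nil {B : ℕ} {σ : State} {Q : ℕ → State → Prop} :
    Wp B (block []) σ Q ↔ Q 0 σ := wp_skip

theorem wp_block_cons {B : ℕ} {c : Cmd} {cs : List Cmd} {σ : State} {Q : ℕ → State → Prop} :
    Wp B (block (c :: cs)) σ Q ↔
      Wp B c σ fun s τ => Wp B (block cs) τ fun t υ => Q (s + t) υ := wp_seq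

theorem wp_ite {B : ℕ} {e : Expr} {c d : Cmd} {σ : State} {Q : ℕ → State → Prop} :
    Wp B (.ite e c d) σ Q ↔ e.Fits B σ ∧
      (e.eval σ ≠ 0 → Wp B c σ fun t τ => Q (e.cost + t) τ) ∧
      (e.eval σ = 0 → Wp B d σ fun t τ => Q (e.cost + t) τ) := by
  constructor
  · rintro ⟨t, τ, h, h'⟩
    cases h with
    | ite_true he h hc => exact ⟨he, fun _ => ⟨_, _, hc, h'⟩, fun h0 => absurd h0 h⟩
    | ite_false he h hc => exact ⟨he, fun h0 => absurd h h0, fun _ => ⟨_, _, hc, h'⟩⟩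
  · rintro ⟨he, h1, h2⟩
    by_cases h : e.eval σ = 0
    · obtain ⟨t, τ, hx, hQ⟩ := h2 h
      exact ⟨_, _, .ite_false he h hx, hQ⟩
    · obtain ⟨t, τ, hx, hQ⟩ := h1 h
      exact ⟨_, _, .ite_true he h hx, hQ⟩

theorem wp_when {B : ℕ} {e : Expr} {c : Cmd} {σ : State} {Q : ℕ → State → Prop} :
    Wp B (when e c) σ Q ↔ e.Fits B σ ∧
      (e.eval σ ≠ 0 → Wp B c σ fun t τ => Q (e.cost + t) τ) ∧
      (e.eval σ = 0 → Q e.cost σ) := by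
  rw [when, wp_ite]
  simp only [wp_skip, Nat.add_zero]

/-- Loop rule: `I m σ` is an invariant, where `m` bounds the time that is left. -/
theorem Wp.loop {B : ℕ} {e : Expr} {c : Cmd} (I : ℕ → State → Prop) (Q : ℕ → State → Prop)
    (step : ∀ m σ, I m σ → e.Fits B σ ∧
      (e.eval σ ≠ 0 → Wp B c σ fun t τ => ∃ m', e.cost + t + m' ≤ m ∧ I m' τ) ∧
      (e.eval σ = 0 → ∃ m', e.cost + m' ≤ m ∧ Q m' σ))
    {m : ℕ} {σ : State} (h : I m σ) :
    Wp B (.loop e c) σ fun t τ => ∃ m', t + m' ≤ m ∧ Q m' τ := by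
  induction m using Nat.strong_induction_on generalizing σ with
  | _ m ih =>
    obtain ⟨he, h1, h2⟩ := step m σ h
    by_cases h0 : e.eval σ = 0
    · exact ⟨_, _, .loop_false he h0, h2 h0⟩
    · obtain ⟨t, τ, hx, m', hm, hI⟩ := h1 h0
      -- Evaluating the test costs at least one unit, so the budget `m` strictly decreases; this is
      -- the proof of termination.
      have := e.one_le_cost
      obtain ⟨t', υ, hx', m'', hm', hQ⟩ := ih m' (by omega) hI
      exact ⟨_, _, .loop_true he h0 hx hx', m'', by omega, hQ⟩

/-- The underlying loop is given the situation right after an execution of `c` as its invariant. The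
amount `e.cost + 2`, the cost of the negated test, is kept aside to pay for the test that comes
next. -/
theorem Wp.repeatUntil {B : ℕ} {e : Expr} {c : Cmd} (hB : 1 ≤ B)
    (I : ℕ → State → Prop) (Q : ℕ → State → Prop)
    (step : ∀ m σ, I m σ → Wp B c σ fun t τ => e.Fits B τ ∧ ∃ m', t + (e.cost + 2) + m' ≤ m ∧
      (e.eval τ = 0 → I m' τ) ∧ (e.eval τ ≠ 0 → Q m' τ))
    {m : ℕ} {σ : State} (h : I m σ) :
    Wp B (repeatUntil c e) σ fun t τ => ∃ m', t + m' ≤ m ∧ Q m' τ := by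
  rw [RAM.repeatUntil, wp_seq]
  refine (step m σ h).mono ?_
  rintro t τ ⟨he, m', hm, h1, h2⟩
  refine (Wp.loop (e := e.neg) (c := c) (m := m' + (e.cost + 2)) (B := B)
    (I := fun m τ => e.Fits B τ ∧ e.cost + 2 ≤ m ∧ (e.eval τ = 0 → I (m - (e.cost + 2)) τ) ∧
      (e.eval τ ≠ 0 → Q (m - (e.cost + 2)) τ)) Q ?_ ⟨he, by omega, by simpa using h1,
      by simpa using h2⟩).mono ?_
  · rintro m τ ⟨he, hm, h1, h2⟩
    refine ⟨(Expr.fits_neg hB _ _).2 he, fun h0 => ?_, fun h0 => ?_⟩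
    · have h0 : e.eval τ = 0 := by simpa using h0
      refine (step _ _ (h1 h0)).mono ?_
      rintro t υ ⟨he, m', hm', h1, h2⟩
      refine ⟨m' + (e.cost + 2), ?_, he, by omega, by simpa using h1, by simpa using h2⟩
      simp only [Expr.cost_neg]
      omega
    · refine ⟨_, ?_, h2 (by simpa using h0)⟩
      simp only [Expr.cost_neg]
      omega
  · rintro s υ ⟨m'', hm, hQ⟩
    exact ⟨m'', by omega, hQ⟩

theorem Expr.Fits.mono {B B' : ℕ} (h : B ≤ B') {σ : State} :
    ∀ {e : Expr}, e.Fits B σ → e.Fits B' σ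
  | .const _, he => le_trans he h
  | .reg _, he => le_trans he h
  | .cell _ _, he => ⟨he.1.mono h, he.2.trans h⟩
  | .bin _ _ _, he => ⟨he.1.mono h, he.2.1.mono h, he.2.2.trans h⟩

/-- The word size occurs only in upper bounds on values. This allows a subroutine with its own bound
to run inside the main algorithm on a machine with longer words. -/
theorem Exec.mono {B B' : ℕ} (h : B ≤ B') {c : Cmd} {σ τ : State} {t : ℕ}
    (hx : Exec B c σ t τ) : Exec B' c σ t τ := by
  induction hx with
  | skip σ => exact .skip σ
  | assign σ r e he => exact .assign σ r e (he.mono h)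
  | store σ a k e hk he => exact .store σ a k e (hk.mono h) (he.mono h)
  | seq _ _ h1 h2 => exact .seq h1 h2
  | ite_true he h0 _ ih => exact .ite_true (he.mono h) h0 ih
  | ite_false he h0 _ ih => exact .ite_false (he.mono h) h0 ih
  | loop_true he h0 _ _ ih ih' => exact .loop_true (he.mono h) h0 ih ih'
  | loop_false he h0 => exact .loop_false (he.mono h) h0

end RAM

/-! ### From straight-line programs to LZ77 factorisations. -/

theorem SLP.word_ne_nil {α : Type} (S : SLP α) (i : Fin S.size) : S.word i ≠ [] := by
  obtain ⟨i, hi⟩ := i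
  induction i using Nat.strong_induction_on with
  | _ i ih =>
    rw [SLP.word]
    split
    · simp
    · next j k _ => simp [ih j.val j.isLt]

theorem IsLZ77.copy_infix {α : Type} {F : List (Phrase α)} {u v : List α} (h : IsLZ77 F u)
    (hv : v ≠ []) (hu : v <:+: u) : ∃ p, IsLZ77 (F ++ [p]) (u ++ v) := by
  obtain ⟨s, t, rfl⟩ := hu
  refine ⟨_, h.copy v (s.length + 1) hv (by omega) ?_ (by simp)⟩
  have := List.length_pos_iff.2 hv
  simp only [List.length_append]
  omega

/-- Appending the word of a nonterminal to a factorised word, when the words of the nonterminals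
in `D` already occur. -/
theorem SLP.exists_isLZ77_append {α : Type} (S : SLP α) (i : Fin S.size)
    (D : Finset (Fin S.size)) (F : List (Phrase α)) (u : List α) (hF : IsLZ77 F u)
    (hD : ∀ j ∈ D, S.word j <:+: u) :
    ∃ F' D', IsLZ77 (F ++ F') (u ++ S.word i) ∧ D ⊆ D' ∧ i ∈ D' ∧
      (∀ j ∈ D', S.word j <:+: u ++ S.word i) ∧ (∀ j ∈ D', j ∈ D ∨ j ≤ i) ∧
      F'.length + (D.filter fun j => (S.rule j).isRight).card ≤
        1 + (D'.filter fun j => (S.rule j).isRight).card := by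
  obtain ⟨i, hi⟩ := i
  induction i using Nat.strong_induction_on generalizing D F u with
  | _ i ih =>
    -- A nonterminal whose word already occurs contributes a single factor and no new visits.
    by_cases hiD : (⟨i, hi⟩ : Fin S.size) ∈ D
    · obtain ⟨p, hp⟩ := hF.copy_infix (S.word_ne_nil _) (hD _ hiD)
      exact ⟨[p], D, hp, subset_rfl, hiD, fun j hj => (hD j hj).trans (List.prefix_append _ _).isInfix,
        fun j hj => .inl hj, by simp⟩
    rw [SLP.word]
    split
    · next a ha =>
      refine ⟨[.free a], insert ⟨i, hi⟩ D, hF.free a, Finset.subset_insert _ _,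
        Finset.mem_insert_self _ _, ?_, ?_, ?_⟩
      · intro j hj
        rcases Finset.mem_insert.1 hj with rfl | hj
        · rw [SLP.word, ha]
          exact (List.suffix_append _ _).isInfix
        · exact (hD j hj).trans (List.prefix_append _ _).isInfix
      · intro j hj
        rcases Finset.mem_insert.1 hj with rfl | hj
        · exact .inr le_rfl
        · exact .inl hj
      · rw [List.length_singleton]
        gcongr
        exact Finset.subset_insert _ _
    · next j k hjk =>
      obtain ⟨F₁, D₁, h₁, hDD₁, hj, hD₁, hle₁, hc₁⟩ := ih j.val j.isLt D F u hF hD (j.isLt.trans hi)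
      obtain ⟨F₂, D₂, h₂, hDD₂, hk, hD₂, hle₂, hc₂⟩ := ih k.val k.isLt D₁ (F ++ F₁) _ h₁ hD₁ (k.isLt.trans hi)
      -- The recursive calls add only nonterminals below `i`, so `i` is new in `D₂`. Each call may
      -- use one phrase beyond its newly visited binary rules, and the rule of `i` itself pays for
      -- the second of these two.
      have hiD₂ : (⟨i, hi⟩ : Fin S.size) ∉ D₂ := by
        intro h
        have hk := k.isLt
        have hj := j.isLt
        rcases hle₂ _ h with h | h
        · rcases hle₁ _ h with h | h
          · exact hiD h
          · exact absurd (Fin.mk_le_mk.1 h) (not_le.2 hj)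
        · exact absurd (Fin.mk_le_mk.1 h) (not_le.2 hk)
      refine ⟨F₁ ++ F₂, insert ⟨i, hi⟩ D₂, by simpa using h₂,
        (hDD₁.trans hDD₂).trans (Finset.subset_insert _ _), Finset.mem_insert_self _ _, ?_, ?_, ?_⟩
      · intro l hl
        rcases Finset.mem_insert.1 hl with rfl | hl
        · rw [SLP.word, hjk]
          exact (List.suffix_append _ _).isInfix
        · simpa using hD₂ l hl
      · intro l hl
        rcases Finset.mem_insert.1 hl with rfl | hl
        · exact .inr le_rfl
        · rcases hle₂ _ hl with h | h
          · rcases hle₁ _ h with h | h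
            · exact .inl h
            · exact .inr (h.trans (by rw [Fin.mk_le_mk]; exact j.isLt.le))
          · exact .inr (h.trans (by rw [Fin.mk_le_mk]; exact k.isLt.le))
      · rw [Finset.filter_insert, if_pos (by simp [hjk]), Finset.card_insert_of_notMem (by simp [hiD₂]),
          List.length_append]
        omega

/-- The traversal starting with nothing visited produces at most one phrase more than there are
binary rules. The first nonterminal has no binary rule, because there is nothing below it, and this
absorbs the extra phrase. -/
theorem SLP.Generates.lzSize_le {α : Type} {S : SLP α} {w : List α} (h : S.Generates w) :
    lzSize w ≤ S.size := by
  obtain ⟨h0, rfl⟩ := h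
  obtain ⟨F, D, hF, -, -, -, -, hc⟩ := S.exists_isLZ77_append ⟨S.size - 1, by omega⟩ ∅ [] []
    .nil (by simp)
  have hle : lzSize (S.word ⟨S.size - 1, by omega⟩) ≤ F.length :=
    Nat.sInf_le ⟨F, by simpa using hF, rfl⟩
  have hlt : (D.filter fun j => (S.rule j).isRight).card < S.size := by
    conv_rhs => rw [← Fintype.card_fin S.size, ← Finset.card_univ]
    refine Finset.card_lt_card (Finset.ssubset_univ_iff.2 fun h => ?_)
    have := h ▸ Finset.mem_univ (⟨0, h0⟩ : Fin S.size)
    rw [Finset.mem_filter] at this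
    cases hr : S.rule ⟨0, h0⟩ with
    | inl a => simp [hr] at this
    | inr p => exact p.1.elim0
  simp only [Finset.filter_empty, Finset.card_empty] at hc
  omega

/-! ### Elementary bounds for the two minimal sizes. -/

theorem lzSize_le_length_of_isLZ77 {α : Type} {F : List (Phrase α)} {w : List α}
    (h : IsLZ77 F w) : lzSize w ≤ F.length := Nat.sInf_le ⟨F, h, rfl⟩

theorem IsLZ77.length_le {α : Type} {F : List (Phrase α)} {w : List α}
    (h : IsLZ77 F w) : F.length ≤ w.length := by
  induction h with
  | nil => simp
  | free a h ih => simpa using ih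
  | copy v j h hv hj hju hdef ih =>
    have := List.length_pos_iff.2 hv
    simp only [List.length_append, List.length_singleton]
    omega

theorem isLZ77_map_free {α : Type} (w : List α) : IsLZ77 (w.map .free) w := by
  induction w using List.reverseRecOn with
  | nil => exact .nil
  | append_singleton w a ih => simpa using ih.free a

theorem IsLZ77.ne_nil {α : Type} {F : List (Phrase α)} {w : List α}
    (h : IsLZ77 F w) (hw : w ≠ []) : 0 < F.length := by
  rcases h with _ | _ | _ <;> simp at *

theorem exists_isLZ77_length_eq {α : Type} (w : List α) :
    ∃ F : List (Phrase α), IsLZ77 F w ∧ F.length = lzSize w :=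
  Nat.sInf_mem (s := {n | ∃ F : List (Phrase α), IsLZ77 F w ∧ F.length = n})
    ⟨_, _, isLZ77_map_free w, rfl⟩

theorem lzSize_pos {α : Type} {w : List α} (hw : w ≠ []) : 0 < lzSize w := by
  obtain ⟨F, hF, h⟩ := exists_isLZ77_length_eq w
  exact h ▸ hF.ne_nil hw

theorem lzSize_le_length {α : Type} (w : List α) : lzSize w ≤ w.length := by
  obtain ⟨F, hF, h⟩ := exists_isLZ77_length_eq w
  exact h ▸ hF.length_le

namespace SLP
variable {α : Type}

/-- The straight-line program `X_0 → a_0, X_{2i+1} → a_{i+1}, X_{2i+2} → X_{2i} X_{2i+1}`. -/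
def ofFun (w : ℕ → α) (n : ℕ) : SLP α where
  size := 2 * n + 1
  rule i :=
    if h : i.val = 0 then .inl (w 0)
    else if h' : i.val % 2 = 1 then .inl (w (i.val / 2 + 1))
    else .inr (⟨i.val - 2, by omega⟩, ⟨i.val - 1, by omega⟩)

theorem word_ofFun (w : ℕ → α) (n i : ℕ) (hi : 2 * i < 2 * n + 1) :
    (ofFun w n).word ⟨2 * i, hi⟩ = List.ofFn fun k : Fin (i + 1) => w k := by
  induction i with
  | zero =>
    rw [SLP.word]
    simp [ofFun]
  | succ i ih =>
    have h1 : (ofFun w n).rule ⟨2 * (i + 1), hi⟩ =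
        .inr (⟨2 * i, by simp⟩, ⟨2 * i + 1, by simp; omega⟩) := by
      simp [ofFun]
      omega
    have h2 : (ofFun w n).word ⟨2 * i + 1, by simp [ofFun]; omega⟩ = [w (i + 1)] := by
      rw [SLP.word]
      have : (2 * i + 1) / 2 = i := by omega
      simp [ofFun, Nat.add_mod, this]
    rw [SLP.word, h1]
    simp only
    rw [ih (by omega), h2, List.ofFn_succ' (n := i + 1)]
    simp

end SLP

theorem exists_slp_size_lt {α : Type} {w : List α} (hw : w ≠ []) :
    ∃ S : SLP α, S.Generates w ∧ S.size < 2 * w.length := by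
  have h0 := List.length_pos_iff.2 hw
  have : Nonempty α := ⟨w.head hw⟩
  refine ⟨SLP.ofFun (fun k => w.getD k (w.head hw)) (w.length - 1), ⟨by simp [SLP.ofFun], ?_⟩,
    by simp [SLP.ofFun]; omega⟩
  have := SLP.word_ofFun (fun k => w.getD k (w.head hw)) (w.length - 1) (w.length - 1) (by omega)
  refine Eq.trans ?_ (this.trans ?_)
  · congr 1
  · apply List.ext_getElem
    · simp
      omega
    · intro k h1 h2
      rw [List.getElem_ofFn, List.getD_eq_getElem _ _ h2]

theorem exists_slp_size_eq {α : Type} {w : List α} (hw : w ≠ []) :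
    ∃ S : SLP α, S.Generates w ∧ S.size = slpSize w := by
  obtain ⟨S, h, -⟩ := exists_slp_size_lt hw
  exact Nat.sInf_mem (s := {n | ∃ S : SLP α, S.Generates w ∧ S.size = n}) ⟨_, S, h, rfl⟩

/-- The smallest grammar may be larger than the word, which makes `log (N / g)` negative. The factor
`2` still keeps `1 + log (N / g)` above `1 - log 2 > 0`. -/
theorem slpSize_lt {α : Type} {w : List α} (hw : w ≠ []) : slpSize w < 2 * w.length := by
  obtain ⟨S, h, hS⟩ := exists_slp_size_lt hw
  exact (Nat.sInf_le ⟨S, h, rfl⟩ : slpSize w ≤ _).trans_lt hS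

theorem lzSize_le_slpSize {α : Type} {w : List α} (hw : w ≠ []) : lzSize w ≤ slpSize w := by
  obtain ⟨S, h, hS⟩ := exists_slp_size_eq hw
  exact hS ▸ h.lzSize_le

/-- For `y ≤ N`, split `log (N / x)` at `y` and use `x log (y / x) ≤ y - x`. For `N ≤ y ≤ 2 N` the
left side is at most `N`, while `1 + log (N / y) ≥ 1 - log 2 ≥ 1 / 4`; this is where the factor `4`
comes from. -/
theorem Real.mul_one_add_log_div_le {x y N : ℝ} (hx : 0 < x) (hxy : x ≤ y) (hxN : x ≤ N)
    (hyN : y ≤ 2 * N) :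
    x + x * Real.log (N / x) ≤ 4 * ((1 + Real.log (N / y)) * y) := by
  have hN : 0 < N := hx.trans_le hxN
  have hy : 0 < y := hx.trans_le hxy
  have hxl : x * Real.log (N / x) ≤ N - x := by
    have := mul_le_mul_of_nonneg_left (Real.log_le_sub_one_of_pos (div_pos hN hx)) hx.le
    rwa [mul_sub, mul_div_cancel₀ _ hx.ne', mul_one] at this
  rcases le_total y N with h | h
  · have h0 : 0 ≤ Real.log (N / y) := Real.log_nonneg ((one_le_div hy).2 h)
    have h1 : Real.log (N / x) = Real.log (N / y) + Real.log (y / x) := by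
      rw [← Real.log_mul (by positivity) (by positivity)]
      congr 1
      field_simp
    have h2 : x * Real.log (y / x) ≤ y - x := by
      have := mul_le_mul_of_nonneg_left (Real.log_le_sub_one_of_pos (div_pos hy hx)) hx.le
      rwa [mul_sub, mul_div_cancel₀ _ hx.ne', mul_one] at this
    have h3 := mul_le_mul_of_nonneg_right hxy h0
    rw [h1]
    nlinarith [mul_nonneg hy.le h0]
  · have h1 : -Real.log 2 ≤ Real.log (N / y) := by
      rw [← Real.log_inv]
      refine Real.log_le_log (by norm_num) ?_
      rw [le_div_iff₀ hy]
      linarith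
    have := Real.log_two_lt_d9
    have h3 : (1 / 4 : ℝ) ≤ 1 + Real.log (N / y) := by linarith
    nlinarith

/-! ### Compact tries of suffixes, independently of the machine. -/

/-- The words of length `L` at the positions `a` and `b` of `s` are equal. -/
def EqLen (s : ℕ → ℕ) (a b L : ℕ) : Prop := ∀ k < L, s (a + k) = s (b + k)

namespace EqLen
variable {s : ℕ → ℕ} {a b c L L' : ℕ}

theorem refl (s : ℕ → ℕ) (a L : ℕ) : EqLen s a a L := fun _ _ => rfl
theorem symm (h : EqLen s a b L) : EqLen s b a L := fun k hk => (h k hk).symm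
theorem trans (h : EqLen s a b L) (h' : EqLen s b c L) : EqLen s a c L :=
  fun k hk => (h k hk).trans (h' k hk)
theorem mono (h : EqLen s a b L) (hL : L' ≤ L) : EqLen s a b L' :=
  fun k hk => h k (hk.trans_le hL)
theorem zero (s : ℕ → ℕ) (a b : ℕ) : EqLen s a b 0 := fun _ hk => absurd hk (Nat.not_lt_zero _)
theorem succ (h : EqLen s a b L) (h' : s (a + L) = s (b + L)) : EqLen s a b (L + 1) := by
  intro k hk
  rcases Nat.lt_succ_iff_lt_or_eq.1 hk with hk | rfl
  · exact h k hk
  · exact h'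
theorem tail (h : EqLen s a b (L + 1)) : EqLen s (a + 1) (b + 1) L := by
  intro k hk
  have := h (k + 1) (by omega)
  rwa [add_comm k 1, ← add_assoc, ← add_assoc] at this
end EqLen

/-- The cells `1, …, N` of `s` hold positive letters, followed by the letter `0`. -/
structure Terminated (s : ℕ → ℕ) (N : ℕ) : Prop where
  pos : ∀ k, 1 ≤ k → k ≤ N → 1 ≤ s k
  zero : s (N + 1) = 0

/-- A match running beyond position `N + 1` would compare the terminator with a letter at an earlier
position, and that letter is positive. -/
theorem Terminated.add_le {s : ℕ → ℕ} {N a i L : ℕ} (hs : Terminated s N) (ha : 1 ≤ a)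
    (hai : a < i) (hi : i ≤ N) (h : EqLen s a i L) : i + L ≤ N + 1 := by
  by_contra hL
  have h1 := h (N + 1 - i) (by omega)
  rw [show i + (N + 1 - i) = N + 1 by omega, hs.zero] at h1
  have := hs.pos (a + (N + 1 - i)) (by omega) (by omega)
  omega

/-- A compact trie of the suffixes of `s 1, …, s (N + 1)` that begin at `1, …, i - 1`. The root
is `0`, the leaves are `1, …, i - 1`, and `V` consists of the root and the inner nodes; the node
`v` represents the word of length `dep v` at position `pos v`, and `ch v c` is the child of `v`
for the letter `c`, or `0`. -/
structure STree (s : ℕ → ℕ) (N i : ℕ) (V : Set ℕ) (ch : ℕ → ℕ → ℕ) (dep pos : ℕ → ℕ) : Prop where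
  zero_mem : 0 ∈ V
  dep_zero : dep 0 = 0
  mem_cases : ∀ v ∈ V, v = 0 ∨ N < v ∧ v < N + i
  pos_mem : ∀ v ∈ V, v ≠ 0 → 1 ≤ pos v ∧ pos v < i
  dep_le : ∀ v ∈ V, dep v ≤ N + 1
  leaf : ∀ a, 1 ≤ a → a < i → pos a = a ∧ dep a = N + 2 - a
  ch_zero : ∀ v ∉ V, v ≤ 2 * N → ∀ c, ch v c = 0
  ch_node : ∀ v ∈ V, ∀ c, ch v c ≠ 0 → (ch v c ∈ V ∨ 1 ≤ ch v c ∧ ch v c < i) ∧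
    dep v < dep (ch v c) ∧ EqLen s (pos (ch v c)) (pos v) (dep v) ∧ s (pos (ch v c) + dep v) = c
  ch_suffix : ∀ v ∈ V, ∀ a, 1 ≤ a → a < i → EqLen s a (pos v) (dep v) →
    ch v (s (a + dep v)) ≠ 0 ∧
      EqLen s (pos (ch v (s (a + dep v)))) a (dep (ch v (s (a + dep v))))
  unique : ∀ v' ∈ V, ∀ v ∈ V, EqLen s (pos v) (pos v') (dep v') → dep v' ≤ dep v →
    v = v' ∨ dep v' < dep v ∧ dep (ch v' (s (pos v + dep v'))) ≤ dep v

namespace STree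
variable {s : ℕ → ℕ} {N i : ℕ} {V : Set ℕ} {ch ch' : ℕ → ℕ → ℕ} {dep pos dep' pos' : ℕ → ℕ}
  {v u L : ℕ}

theorem ne_zero_of_dep_pos (h : STree s N i V ch dep pos) (hv : 0 < dep v) : v ≠ 0 := by
  rintro rfl
  rw [h.dep_zero] at hv
  omega

theorem pos_child (h : STree s N i V ch dep pos) (hv : v ∈ V) {c : ℕ} (hc : ch v c ≠ 0) :
    1 ≤ pos (ch v c) ∧ pos (ch v c) < i := by
  rcases (h.ch_node v hv c hc).1 with h1 | h1
  · exact h.pos_mem _ h1 hc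
  · rw [(h.leaf _ h1.1 h1.2).1]
    exact h1

/-- Nodes on the path of the word at position `i`, deeper than `v`, lie below the child of `v`. -/
theorem dep_child_le (h : STree s N i V ch dep pos) (hv : v ∈ V)
    (hiv : EqLen s i (pos v) (dep v)) {x : ℕ} (hx : x ∈ V) (hvx : dep v < dep x) {l : ℕ}
    (hl : dep v < l) (hix : EqLen s i (pos x) l) :
    ch v (s (i + dep v)) ≠ 0 ∧ dep (ch v (s (i + dep v))) ≤ dep x ∧
      EqLen s (pos (ch v (s (i + dep v)))) (pos x) (dep (ch v (s (i + dep v)))) := by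
  have hx0 := h.ne_zero_of_dep_pos (Nat.zero_lt_of_lt hvx)
  have hp := h.pos_mem x hx hx0
  have he : EqLen s (pos x) (pos v) (dep v) := (hix.mono hl.le).symm.trans hiv
  have hc := h.ch_suffix v hv _ hp.1 hp.2 he
  rw [← hix _ hl] at hc
  refine ⟨hc.1, ?_, hc.2⟩
  rcases h.unique v hv x hx he hvx.le with h1 | h1
  · rw [h1] at hvx
    omega
  · rw [hix _ hl]
    exact h1.2

/-- Nodes on the path of the word at position `i`, strictly above the node `v`. -/
theorem child_of_dep_le (h : STree s N i V ch dep pos) (hv : v ∈ V)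
    (hiv : EqLen s i (pos v) (dep v)) {x : ℕ} (hx : x ∈ V) (hxv : dep x ≤ dep v) (hne : x ≠ v)
    (hix : EqLen s i (pos x) (dep x)) :
    dep x < dep v ∧ ch x (s (i + dep x)) ≠ 0 ∧ dep (ch x (s (i + dep x))) ≤ dep v ∧
      EqLen s (pos (ch x (s (i + dep x)))) i (dep (ch x (s (i + dep x)))) := by
  have he : EqLen s (pos v) (pos x) (dep x) := (hiv.mono hxv).symm.trans hix
  rcases h.unique x hx v hv he hxv with h1 | h1
  · exact absurd h1.symm hne
  have hp := h.pos_mem v hv (h.ne_zero_of_dep_pos (Nat.zero_lt_of_lt h1.1))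
  have hc := h.ch_suffix x hx _ hp.1 hp.2 he
  rw [← hiv _ h1.1] at hc h1
  exact ⟨h1.1, hc.1, h1.2, hc.2.trans (hiv.mono h1.2).symm⟩

/-- The numbers `i` and `N + i`, reserved for the leaf and the possible inner node created with the
suffix at `i`, are not yet in use. Hence old nodes keep their entries in the tables. -/
theorem ne_new (h : STree s N i V ch dep pos) (hi : 1 ≤ i) (hiN : i ≤ N)
    (hu : u ∈ V ∨ 1 ≤ u ∧ u < i) : u ≠ i ∧ u ≠ N + i := by
  rcases hu with hu | hu
  · have := h.mem_cases u hu
    omega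
  · omega

/-- The word at `i` gets stuck at `v` because the required child is missing, so only this pointer
has to be set. The new content is `ch_suffix` for the suffix at `i`: above `v` its path is that of
`v`, at `v` it is the new leaf, and no node below `v` can lie on it, since such a node would give
`v` the missing child. -/
theorem insert_leaf (h : STree s N i V ch dep pos) (hs : Terminated s N) (hi : 1 ≤ i)
    (hiN : i ≤ N) (hv : v ∈ V) (hiv : EqLen s i (pos v) (dep v)) (h0 : ch v (s (i + dep v)) = 0)
    (hd : ∀ x, x ≠ i → dep' x = dep x) (hdi : dep' i = N + 2 - i)
    (hp : ∀ x, x ≠ i → pos' x = pos x) (hpi : pos' i = i)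
    (hc : ∀ x ≤ 2 * N, ∀ c, ¬ (x = v ∧ c = s (i + dep v)) → ch' x c = ch x c)
    (hcv : ch' v (s (i + dep v)) = i) : STree s N (i + 1) V ch' dep' pos' := by
  have hV : ∀ x ∈ V, x ≤ 2 * N ∧ x ≠ i := fun x hx => by
    have := h.mem_cases x hx
    omega
  have hdV : ∀ x ∈ V, dep' x = dep x := fun x hx => hd x (hV x hx).2
  have hpV : ∀ x ∈ V, pos' x = pos x := fun x hx => hp x (hV x hx).2
  refine ⟨h.zero_mem, by rw [hdV 0 h.zero_mem, h.dep_zero], fun x hx => ?_, fun x hx hx0 => ?_,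
    fun x hx => hdV x hx ▸ h.dep_le x hx, fun a ha hai => ?_, fun x hx hxN c => ?_, fun x hx c hxc => ?_, fun x hx a ha hai he => ?_,
    fun x' hx' x hx he hle => ?_⟩
  · have := h.mem_cases x hx
    omega
  · have := h.pos_mem x hx hx0
    rw [hpV x hx]
    omega
  · rcases Nat.lt_succ_iff_lt_or_eq.1 hai with hai | rfl
    · rw [hd a hai.ne, hp a hai.ne]
      exact h.leaf a ha hai
    · exact ⟨hpi, hdi⟩
  · rw [hc x hxN c (by rintro ⟨rfl, -⟩; exact hx hv)]
    exact h.ch_zero x hx hxN c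
  · rw [hdV x hx, hpV x hx]
    by_cases hxv : x = v ∧ c = s (i + dep v)
    · obtain ⟨rfl, rfl⟩ := hxv
      rw [hcv, hdi, hpi]
      refine ⟨.inr (by omega), ?_, hiv, rfl⟩
      by_cases hx0 : x = 0
      · rw [hx0, h.dep_zero]
        omega
      · have hq := h.pos_mem x hx hx0
        have := hs.add_le hq.1 hq.2 hiN hiv.symm
        omega
    · rw [hc x (hV x hx).1 c hxv] at hxc ⊢
      have hn := h.ch_node x hx c hxc
      have hne := h.ne_new hi hiN hn.1
      rw [hd _ hne.1, hp _ hne.1]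
      exact ⟨hn.1.imp_right fun h => ⟨h.1, h.2.trans (Nat.lt_succ_self i)⟩, hn.2⟩
  · rw [hdV x hx] at he ⊢
    rw [hpV x hx] at he
    rcases Nat.lt_succ_iff_lt_or_eq.1 hai with hai | rfl
    · have hn := h.ch_suffix x hx a ha hai he
      -- The trie guarantees a child for every earlier suffix that reaches `x`, so none of them uses
      -- the pointer that was zero.
      have hxv : ¬ (x = v ∧ s (a + dep x) = s (i + dep v)) := by
        rintro ⟨rfl, h1⟩
        rw [h1] at hn
        exact hn.1 h0
      rw [hc x (hV x hx).1 _ hxv]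
      have hne := h.ne_new hi hiN (h.ch_node x hx _ hn.1).1
      rwa [hd _ hne.1, hp _ hne.1]
    · by_cases hxv : x = v
      · subst hxv
        rw [hcv, hpi]
        exact ⟨by omega, EqLen.refl _ _ _⟩
      · rw [hc x (hV x hx).1 _ (by simp [hxv])]
        rcases le_or_gt (dep x) (dep v) with hle | hlt
        · obtain ⟨-, h2, h3, h4⟩ := h.child_of_dep_le hv hiv hx hle hxv he
          have hne := h.ne_new hi hiN (h.ch_node x hx _ h2).1
          rw [hd _ hne.1, hp _ hne.1]
          exact ⟨h2, h4⟩
        · exact absurd h0 (h.dep_child_le hv hiv hx hlt hlt he).1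
  · rw [hdV x hx, hdV x' hx'] at *
    rw [hpV x hx] at he ⊢
    rw [hpV x' hx'] at he
    rcases h.unique x' hx' x hx he hle with h1 | h1
    · exact .inl h1
    · refine .inr ⟨h1.1, ?_⟩
      have hq := h.pos_mem x hx (h.ne_zero_of_dep_pos (Nat.zero_lt_of_lt h1.1))
      have hn := h.ch_suffix x' hx' _ hq.1 hq.2 he
      have hxv : ¬ (x' = v ∧ s (pos x + dep x') = s (i + dep v)) := by
        rintro ⟨rfl, h1⟩
        rw [h1] at hn
        exact hn.1 h0
      rw [hc x' (hV x' hx').1 _ hxv]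
      have hne := h.ne_new hi hiN (h.ch_node x' hx' _ hn.1).1
      rw [hd _ hne.1]
      exact h1.2

/-- The word at `i` leaves the edge from `v` to `u` in its interior, at depth `L`. The new node `N +
i` sits at that place, and its children are `u` and the new leaf, for the two letters that differ.
Everything said about the old edge then holds for its two halves. -/
theorem insert_split (h : STree s N i V ch dep pos) (hs : Terminated s N) (hi : 1 ≤ i)
    (hiN : i ≤ N) (hv : v ∈ V) (hiv : EqLen s i (pos v) (dep v))
    (hu : ch v (s (i + dep v)) = u) (hu0 : u ≠ 0) (hvL : dep v < L) (hLu : L < dep u)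
    (hui : EqLen s (pos u) i L) (hmis : s (pos u + L) ≠ s (i + L))
    (hd : ∀ x, x ≠ i → x ≠ N + i → dep' x = dep x) (hdi : dep' i = N + 2 - i)
    (hdd : dep' (N + i) = L)
    (hp : ∀ x, x ≠ i → x ≠ N + i → pos' x = pos x) (hpi : pos' i = i) (hpd : pos' (N + i) = i)
    (hc : ∀ x ≤ 2 * N, x ≠ N + i → ∀ c, ¬ (x = v ∧ c = s (i + dep v)) → ch' x c = ch x c)
    (hcv : ch' v (s (i + dep v)) = N + i) (hcd : ch' (N + i) (s (i + L)) = i)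
    (hcd' : ch' (N + i) (s (pos u + L)) = u)
    (hcd0 : ∀ c, c ≠ s (i + L) → c ≠ s (pos u + L) → ch' (N + i) c = 0) :
    STree s N (i + 1) (insert (N + i) V) ch' dep' pos' := by
  have hV : ∀ x ∈ V, x ≤ 2 * N ∧ x ≠ i ∧ x ≠ N + i := fun x hx => by
    have := h.mem_cases x hx
    omega
  have hdV : ∀ x ∈ V, dep' x = dep x := fun x hx => hd x (hV x hx).2.1 (hV x hx).2.2
  have hpV : ∀ x ∈ V, pos' x = pos x := fun x hx => hp x (hV x hx).2.1 (hV x hx).2.2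
  have hpu := h.pos_child hv (hu.symm ▸ hu0)
  have hun := h.ch_node v hv _ (hu.symm ▸ hu0)
  rw [hu] at hpu hun
  have hune := h.ne_new hi hiN hun.1
  -- Earlier suffixes that follow the word at `i` beyond `v` run along the whole edge to `u`.
  have hA : ∀ a, 1 ≤ a → a < i → EqLen s a i (dep v + 1) → EqLen s (pos u) a (dep u) := by
    intro a ha hai he
    have := (h.ch_suffix v hv a ha hai ((he.mono (Nat.le_succ _)).trans hiv)).2
    rwa [he (dep v) (Nat.lt_succ_self _), hu] at this
  have hbelow : ∀ x ∈ V, dep v < dep x → ∀ l, dep v < l → EqLen s i (pos x) l →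
      dep u ≤ dep x ∧ EqLen s (pos u) (pos x) (dep u) := by
    intro x hx hlt l hl he
    have := h.dep_child_le hv hiv hx hlt hl he
    rw [hu] at this
    exact this.2
  refine ⟨.inr h.zero_mem, by rw [hdV 0 h.zero_mem, h.dep_zero], ?_, ?_, ?_,
    fun a ha hai => ?_, fun x hx hxN c => ?_, ?_, ?_, ?_⟩
  · rintro x (rfl | hx)
    · omega
    · have := h.mem_cases x hx
      omega
  · rintro x (rfl | hx) hx0
    · omega
    · have := h.pos_mem x hx hx0
      rw [hpV x hx]
      omega
  · rintro x (rfl | hx)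
    · have := hs.add_le hpu.1 hpu.2 hiN hui
      omega
    · exact hdV x hx ▸ h.dep_le x hx
  · rcases Nat.lt_succ_iff_lt_or_eq.1 hai with hai | rfl
    · rw [hd a hai.ne (by omega), hp a hai.ne (by omega)]
      exact h.leaf a ha hai
    · exact ⟨hpi, hdi⟩
  · have h1 : x ≠ N + i := fun h => hx (.inl h)
    have h2 : x ∉ V := fun h => hx (.inr h)
    rw [hc x hxN h1 c (by rintro ⟨rfl, -⟩; exact h2 hv)]
    exact h.ch_zero x h2 hxN c
  · rintro x (rfl | hx) c hxc
    · rw [hdd, hpd]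
      by_cases h1 : c = s (i + L)
      · subst h1
        rw [hcd, hdi, hpi]
        have := hs.add_le hpu.1 hpu.2 hiN hui
        exact ⟨.inr (by omega), by omega, EqLen.refl _ _ _, rfl⟩
      · by_cases h2 : c = s (pos u + L)
        · subst h2
          rw [hcd', hd _ hune.1 hune.2, hp _ hune.1 hune.2]
          exact ⟨hun.1.imp .inr fun h => ⟨h.1, by omega⟩, hLu, hui, rfl⟩
        · exact absurd (hcd0 c h1 h2) hxc
    · rw [hdV x hx, hpV x hx]
      by_cases hxv : x = v ∧ c = s (i + dep v)
      · obtain ⟨rfl, rfl⟩ := hxv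
        rw [hcv, hdd, hpd]
        exact ⟨.inl (.inl rfl), hvL, hiv, rfl⟩
      · rw [hc x (hV x hx).1 (hV x hx).2.2 c hxv] at hxc ⊢
        have hn := h.ch_node x hx c hxc
        have hne := h.ne_new hi hiN hn.1
        rw [hd _ hne.1 hne.2, hp _ hne.1 hne.2]
        exact ⟨hn.1.imp .inr fun h => ⟨h.1, h.2.trans (Nat.lt_succ_self i)⟩, hn.2⟩
  · rintro x (rfl | hx) a ha hai he
    · rw [hdd] at he ⊢
      rw [hpd] at he
      rcases Nat.lt_succ_iff_lt_or_eq.1 hai with hai | rfl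
      · have h1 := hA a ha hai (he.mono hvL)
        rw [← h1 L hLu, hcd', hd _ hune.1 hune.2, hp _ hune.1 hune.2]
        exact ⟨hu0, h1⟩
      · rw [hcd, hpi]
        exact ⟨by omega, EqLen.refl _ _ _⟩
    · rw [hdV x hx] at he ⊢
      rw [hpV x hx] at he
      by_cases hxv : x = v ∧ s (a + dep x) = s (i + dep v)
      · obtain ⟨rfl, h1⟩ := hxv
        rw [h1, hcv, hdd, hpd]
        refine ⟨by omega, ?_⟩
        rcases Nat.lt_succ_iff_lt_or_eq.1 hai with hai | rfl
        · have h1 := hA a ha hai ((he.trans hiv.symm).succ h1)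
          exact hui.symm.trans (h1.mono hLu.le)
        · exact EqLen.refl _ _ _
      · rw [hc x (hV x hx).1 (hV x hx).2.2 _ hxv]
        rcases Nat.lt_succ_iff_lt_or_eq.1 hai with hai | rfl
        · have hn := h.ch_suffix x hx a ha hai he
          have hne := h.ne_new hi hiN (h.ch_node x hx _ hn.1).1
          rwa [hd _ hne.1 hne.2, hp _ hne.1 hne.2]
        · have hxv : x ≠ v := by
            rintro rfl
            exact hxv ⟨rfl, rfl⟩
          rcases le_or_gt (dep x) (dep v) with hle | hlt
          · obtain ⟨-, h2, h3, h4⟩ := h.child_of_dep_le hv hiv hx hle hxv he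
            have hne := h.ne_new hi hiN (h.ch_node x hx _ h2).1
            rw [hd _ hne.1 hne.2, hp _ hne.1 hne.2]
            exact ⟨h2, h4⟩
          -- A node below `v` whose whole word is read at `i` would lie at or below `u`, thus beyond
          -- the mismatch at depth `L`.
          · obtain ⟨h1, h2⟩ := hbelow x hx hlt _ hlt he
            exact absurd ((h2 L hLu).trans (he L (by omega)).symm) hmis
  · rintro x' (rfl | hx') x (rfl | hx) he hle
    · exact .inl rfl
    · rw [hdd, hpd, hpV x hx] at he
      rw [hdd, hdV x hx] at hle ⊢
      rw [hpV x hx]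
      obtain ⟨h1, h2⟩ := hbelow x hx (by omega) L hvL he.symm
      rw [← h2 L hLu, hcd', hd _ hune.1 hune.2]
      exact .inr ⟨by omega, h1⟩
    · rw [hdV x' hx', hpV x' hx', hpd] at he
      rw [hdd, hdV x' hx'] at hle ⊢
      rw [hpd]
      by_cases hxv : x' = v
      · subst hxv
        rw [hcv, hdd]
        exact .inr ⟨hvL, le_rfl⟩
      · rw [hc x' (hV x' hx').1 (hV x' hx').2.2 _ (by simp [hxv])]
        rcases le_or_gt (dep x') (dep v) with hle' | hlt
        · obtain ⟨h1, h2, h3, h4⟩ := h.child_of_dep_le hv hiv hx' hle' hxv he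
          have hne := h.ne_new hi hiN (h.ch_node x' hx' _ h2).1
          rw [hd _ hne.1 hne.2]
          exact .inr ⟨by omega, by omega⟩
        · have := (hbelow x' hx' hlt _ hlt he).1
          omega
    · rw [hdV x' hx', hpV x' hx', hpV x hx] at he
      rw [hdV x hx, hdV x' hx'] at hle ⊢
      rw [hpV x hx]
      rcases h.unique x' hx' x hx he hle with h1 | h1
      · exact .inl h1
      · refine .inr ⟨h1.1, ?_⟩
        by_cases hxv : x' = v ∧ s (pos x + dep x') = s (i + dep v)
        · obtain ⟨rfl, h2⟩ := hxv
          rw [h2, hu] at h1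
          rw [h2, hcv, hdd]
          omega
        · rw [hc x' (hV x' hx').1 (hV x' hx').2.2 _ hxv]
          have hq := h.pos_mem x hx (h.ne_zero_of_dep_pos (Nat.zero_lt_of_lt h1.1))
          have hn := h.ch_suffix x' hx' _ hq.1 hq.2 he
          have hne := h.ne_new hi hiN (h.ch_node x' hx' _ hn.1).1
          rw [hd _ hne.1 hne.2]
          exact h1.2

end STree

namespace STree
variable {s : ℕ → ℕ} {N i : ℕ} {V : Set ℕ} {ch : ℕ → ℕ → ℕ} {dep pos : ℕ → ℕ} {v L : ℕ}

/-- If the matched length exceeded the depth of `v`, the earlier occurrence would itself run through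
the child that is missing. -/
theorem eq_dep_of_child_eq_zero (h : STree s N i V ch dep pos)
    (hv : v ∈ V) (hiv : EqLen s i (pos v) (dep v)) (hvL : dep v ≤ L)
    (hL : L = 0 ∨ ∃ a, 1 ≤ a ∧ a < i ∧ EqLen s a i L) (h0 : ch v (s (i + dep v)) = 0) :
    L = dep v := by
  by_contra hne
  obtain rfl | ⟨a, ha, hai, he⟩ := hL
  · omega
  have := (h.ch_suffix v hv a ha hai ((he.mono hvL).trans hiv)).1
  rw [he (dep v) (by omega)] at this
  exact this h0

/-- This is what permits skipping: up to the length `L` that is known to occur earlier, the edge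
need not be compared letter by letter, because the earlier occurrence runs along the same edge. -/
theorem eqLen_child (h : STree s N i V ch dep pos)
    (hv : v ∈ V) (hiv : EqLen s i (pos v) (dep v)) (hvL : dep v ≤ L)
    (hL : L = 0 ∨ ∃ a, 1 ≤ a ∧ a < i ∧ EqLen s a i L) (h0 : ch v (s (i + dep v)) ≠ 0) {l : ℕ}
    (hlL : l ≤ L) (hl : l ≤ dep (ch v (s (i + dep v)))) :
    EqLen s (pos (ch v (s (i + dep v)))) i l := by
  rcases le_or_gt l (dep v) with hle | hlt
  · exact ((h.ch_node v hv _ h0).2.2.1.trans hiv.symm).mono hle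
  obtain rfl | ⟨a, ha, hai, he⟩ := hL
  · omega
  have := (h.ch_suffix v hv a ha hai ((he.mono hvL).trans hiv)).2
  rw [he (dep v) (by omega)] at this
  exact (this.mono hl).trans (he.mono hlL)

/-- The word of a leaf includes the terminator, so it is too long to be part of a match at `i`. -/
theorem child_mem (h : STree s N i V ch dep pos) (hs : Terminated s N) (hiN : i ≤ N)
    (hv : v ∈ V) (hiv : EqLen s i (pos v) (dep v)) (hvL : dep v ≤ L)
    (hL : L = 0 ∨ ∃ a, 1 ≤ a ∧ a < i ∧ EqLen s a i L) (h0 : ch v (s (i + dep v)) ≠ 0)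
    (hle : dep (ch v (s (i + dep v))) ≤ L) : ch v (s (i + dep v)) ∈ V := by
  refine (h.ch_node v hv _ h0).1.resolve_right fun hu => ?_
  have he := h.eqLen_child hv hiv hvL hL h0 hle le_rfl
  rw [(h.leaf _ hu.1 hu.2).1, (h.leaf _ hu.1 hu.2).2] at he
  have := hs.add_le hu.1 hu.2 hiN he
  omega

/-- The edge was chosen by its first letter, so the mismatch cannot be there; the new node is
therefore strictly below `v`. -/
theorem lt_of_mismatch (h : STree s N i V ch dep pos)
    (hv : v ∈ V) (hvL : dep v ≤ L) (h0 : ch v (s (i + dep v)) ≠ 0)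
    (hmis : s (pos (ch v (s (i + dep v))) + L) ≠ s (i + L)) : dep v < L := by
  refine lt_of_le_of_ne hvL ?_
  rintro rfl
  exact hmis (h.ch_node v hv _ h0).2.2.2

theorem not_eqLen_of_child_eq_zero (h : STree s N i V ch dep pos)
    (hv : v ∈ V) (hiv : EqLen s i (pos v) (dep v)) (h0 : ch v (s (i + dep v)) = 0)
    {a : ℕ} (ha : 1 ≤ a) (hai : a < i) : ¬ EqLen s a i (dep v + 1) := by
  intro he
  have := (h.ch_suffix v hv a ha hai ((he.mono (Nat.le_succ _)).trans hiv)).1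
  rw [he (dep v) (Nat.lt_succ_self _)] at this
  exact this h0

/-- Earlier occurrences of the word from `i` that is longer than `dep v` agree with the child
of `v`. -/
theorem eqLen_child_of_eqLen (h : STree s N i V ch dep pos)
    (hv : v ∈ V) (hiv : EqLen s i (pos v) (dep v)) (hvL : dep v < L)
    {a : ℕ} (ha : 1 ≤ a) (hai : a < i) (he : EqLen s a i L) :
    EqLen s (pos (ch v (s (i + dep v)))) a (dep (ch v (s (i + dep v)))) := by
  have := (h.ch_suffix v hv a ha hai ((he.mono hvL.le).trans hiv)).2
  rwa [he (dep v) hvL] at this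

end STree

/-- `L` is the greatest length of a word at position `i` that occurs at an earlier position,
and `p` is such a position if `L` is positive. -/
structure LongestPrev (s : ℕ → ℕ) (i L p : ℕ) : Prop where
  occ : L = 0 ∨ 1 ≤ p ∧ p < i ∧ EqLen s p i L
  max : ∀ a, 1 ≤ a → a < i → ¬ EqLen s a i (L + 1)

/-! ### Longest previous factors by a trie with suffix links. -/

namespace RAM

/-- Registers and tables of the program that inserts the suffixes into the trie. -/
abbrev rNode : ℕ := 2
abbrev rChild : ℕ := 3
abbrev rMatch : ℕ := 4
abbrev rStart : ℕ := 5
abbrev rGo : ℕ := 6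
abbrev tChild : ℕ := 8
abbrev tDep : ℕ := 9
abbrev tOcc : ℕ := 10
abbrev tLink : ℕ := 11
abbrev tLpf : ℕ := 12
abbrev tPrev : ℕ := 13

abbrev xNode : Expr := .reg rNode
abbrev xChild : Expr := .reg rChild
abbrev xMatch : Expr := .reg rMatch
abbrev xStart : Expr := .reg rStart

/-- The address of the child of the node `v` for the letter `c`. -/
def xAddr (c v : Expr) : Expr := .bin .mul (xLen + xLen + 1) c + v

/-- Find the longest word at position `i` that occurs at an earlier position. -/
def lzDescend : Cmd := .loop (.reg rGo) (block [
  when ((Expr.cell tDep xNode).isEq xStart) (.store tLink (xLen + xI - 1) xNode),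
  .assign rChild (.cell tChild (xAddr (.cell tWord (xI + .cell tDep xNode)) xNode)),
  .ite xChild
    (.ite ((Expr.cell tDep xChild).isLe xMatch)
      (.assign rNode xChild)
      (.ite ((Expr.cell tWord (.cell tOcc xChild + xMatch)).isEq (.cell tWord (xI + xMatch)))
        (.assign rMatch (xMatch + 1))
        (.assign rGo 0)))
    (.assign rGo 0)])

/-- Insert the suffix that begins at position `i`. -/
def lzInsert : Cmd := block [
  .store tLpf xI xMatch,
  .store tDep xI (xLen + 2 - xI),
  .store tOcc xI xI,
  .ite xChild
    (block [
      .store tPrev xI (.cell tOcc xChild),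
      .store tDep (xLen + xI) xMatch,
      .store tOcc (xLen + xI) xI,
      .store tChild (xAddr (.cell tWord (xI + .cell tDep xNode)) xNode) (xLen + xI),
      .store tChild (xAddr (.cell tWord (.cell tOcc xChild + xMatch)) (xLen + xI)) xChild,
      .store tChild (xAddr (.cell tWord (xI + xMatch)) (xLen + xI)) xI,
      when (xMatch.isEq xStart) (.store tLink (xLen + xI - 1) (xLen + xI))])
    (block [
      .store tPrev xI (.cell tOcc xNode),
      .store tChild (xAddr (.cell tWord (xI + .cell tDep xNode)) xNode) xI]),
  .assign rNode (.cell tLink xNode),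
  .assign rMatch (xMatch - 1),
  .assign rI (xI + 1)]

/-- The node and the match length are not reset between suffixes: `lzInsert` passes them on through
the suffix link, with one letter less. For the first suffix the zero memory provides the root and
the empty match. -/
def lzLongestPrev : Cmd := block [
  .assign rI 1,
  .loop (xI.isLe xLen) (block [
    .assign rStart xMatch,
    .assign rGo 1,
    lzDescend,
    lzInsert])]

/-- The greedy factorisation. -/
def lzGreedy : Cmd := block [
  .assign rI 1,
  .loop (xI.isLe xLen) (
    .ite (.cell tLpf xI)
      (block [
        .store tBeg xI (.cell tPrev xI),
        .assign rI (xI + .cell tLpf xI),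
        .store tEnd (xI - 1) 1])
      (.assign rI (xI + 1)))]

/-- The child function stored in a table. -/
def childOf (N : ℕ) (f : ℕ → ℕ) (v c : ℕ) : ℕ := f ((2 * N + 1) * c + v)

/-- Node numbers are at most `2 * N`, so division by `2 * N + 1` recovers the letter and the node
from the address. -/
theorem addr_inj {N v v' c c' : ℕ} (hv : v ≤ 2 * N) (hv' : v' ≤ 2 * N) :
    (2 * N + 1) * c + v = (2 * N + 1) * c' + v' ↔ v = v' ∧ c = c' := by
  constructor
  · intro h
    have h1 := congrArg (· % (2 * N + 1)) h
    have h2 := congrArg (· / (2 * N + 1)) h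
    simp only [Nat.mul_add_mod, Nat.mod_eq_of_lt (Nat.lt_succ_of_le hv),
      Nat.mod_eq_of_lt (Nat.lt_succ_of_le hv')] at h1
    simp only [Nat.mul_add_div (Nat.succ_pos (2 * N)), Nat.div_eq_of_lt (Nat.lt_succ_of_le hv),
      Nat.div_eq_of_lt (Nat.lt_succ_of_le hv')] at h2
    exact ⟨h1, h2⟩
  · rintro ⟨rfl, rfl⟩
    rfl

theorem childOf_update {N : ℕ} {f : ℕ → ℕ} {v c x v' c' : ℕ} (hv : v ≤ 2 * N)
    (hv' : v' ≤ 2 * N) :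
    childOf N (Function.update f ((2 * N + 1) * c + v) x) v' c' =
      if v' = v ∧ c' = c then x else childOf N f v' c' := by
  simp only [childOf, Function.update_apply, addr_inj hv' hv]

/-- The suffix link of the node `x` is correct. -/
def LinkOK (s : ℕ → ℕ) (V : Set ℕ) (dep pos link : ℕ → ℕ) (x : ℕ) : Prop :=
  link x ∈ V ∧ dep (link x) + 1 = dep x ∧ EqLen s (pos (link x)) (pos x + 1) (dep (link x))

/-- The state before and while the suffix at `i` is inserted. The suffix link of the inner node
that was created last, if any, need not be set; it has to lead to the node for the word of length
`T` at position `i`. -/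
structure TrieState (s : ℕ → ℕ) (N i : ℕ) (V : Set ℕ) (T : ℕ) (σ : State) : Prop where
  len : σ.reg rLen = N
  idx : σ.reg rI = i
  word : σ.arr tWord = s
  tree : STree s N i V (childOf N (σ.arr tChild)) (σ.arr tDep) (σ.arr tOcc)
  link_zero : σ.arr tLink 0 = 0
  occ_zero : σ.arr tOcc 0 = 0
  link : ∀ x ∈ V, x ≠ 0 → x ≠ N + i - 1 →
    LinkOK s V (σ.arr tDep) (σ.arr tOcc) (σ.arr tLink) x
  last : N + i - 1 ∈ V → σ.arr tDep (N + i - 1) = T + 1 ∧ σ.arr tOcc (N + i - 1) + 1 = i ∧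
    ∃ b, 1 ≤ b ∧ b < i ∧ EqLen s b i T ∧ s (b + T) ≠ s (i + T)
  best : ∀ k, 1 ≤ k → k < i → LongestPrev s k (σ.arr tLpf k) (σ.arr tPrev k)
  beg : ∀ k, σ.arr tBeg k = 0
  fin : ∀ k, σ.arr tEnd k = 0
  node_mem : σ.reg rNode ∈ V
  node_eq : EqLen s i (σ.arr tOcc (σ.reg rNode)) (σ.arr tDep (σ.reg rNode))
  node_le : σ.arr tDep (σ.reg rNode) ≤ σ.reg rMatch
  match_eq : σ.reg rMatch = 0 ∨ ∃ a, 1 ≤ a ∧ a < i ∧ EqLen s a i (σ.reg rMatch)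

namespace TrieState
variable {s : ℕ → ℕ} {N i T B M : ℕ} {V : Set ℕ} {σ : State}

theorem add_match_le (h : TrieState s N i V T σ) (hs : Terminated s N) (hi : i ≤ N) :
    i + σ.reg rMatch ≤ N + 1 := by
  obtain h0 | ⟨a, ha, hai, he⟩ := h.match_eq
  · omega
  · exact hs.add_le ha hai hi he

theorem node_le_two_mul (h : TrieState s N i V T σ) (hi : i ≤ N) : σ.reg rNode ≤ 2 * N := by
  have := h.tree.mem_cases _ h.node_mem
  omega

theorem child_le (h : TrieState s N i V T σ) (hi : i ≤ N) (c : ℕ) :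
    childOf N (σ.arr tChild) (σ.reg rNode) c ≤ 2 * N := by
  by_cases h0 : childOf N (σ.arr tChild) (σ.reg rNode) c = 0
  · omega
  rcases (h.tree.ch_node _ h.node_mem c h0).1 with h1 | h1
  · have := h.tree.mem_cases _ h1
    omega
  · omega

theorem dep_node_le (h : TrieState s N i V T σ) {x : ℕ} (hx : x ∈ V ∨ 1 ≤ x ∧ x < i) :
    σ.arr tDep x ≤ N + 1 := by
  rcases hx with hx | hx
  · exact h.tree.dep_le x hx
  · rw [(h.tree.leaf x hx.1 hx.2).2]
    omega

theorem occ_node_lt (h : TrieState s N i V T σ) (hi : 1 ≤ i) {x : ℕ}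
    (hx : x ∈ V ∨ 1 ≤ x ∧ x < i) : σ.arr tOcc x < i := by
  rcases hx with hx | hx
  · by_cases h0 : x = 0
    · rw [h0, h.occ_zero]
      omega
    · exact (h.tree.pos_mem x hx h0).2
  · rw [(h.tree.leaf x hx.1 hx.2).1]
    exact hx.2

theorem congr {τ : State} (h : TrieState s N i V T σ) (h0 : τ.reg rLen = σ.reg rLen)
    (h1 : τ.reg rI = σ.reg rI) (ha : τ.arr = σ.arr) (hm : τ.reg rNode ∈ V)
    (he : EqLen s i (σ.arr tOcc (τ.reg rNode)) (σ.arr tDep (τ.reg rNode)))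
    (hle : σ.arr tDep (τ.reg rNode) ≤ τ.reg rMatch)
    (hL : τ.reg rMatch = 0 ∨ ∃ a, 1 ≤ a ∧ a < i ∧ EqLen s a i (τ.reg rMatch)) :
    TrieState s N i V T τ := by
  obtain ⟨a1, a2, a3, a4, a5, a6, a7, a8, a9, a10, a11, -, -, -, -⟩ := h
  rw [← ha] at *
  exact ⟨h0.trans a1, h1.trans a2, a3, a4, a5, a6, a7, a8, a9, a10, a11, hm, he, hle, hL⟩

/-- The link at `N + i - 1`, the only inner node that can be new since the last round, is the one
not covered by the invariant, so it may be overwritten. That cell is not the one of the root. -/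
theorem setLink (h : TrieState s N i V T σ) (hN : 1 ≤ N) (hi : 1 ≤ i) (x : ℕ) :
    TrieState s N i V T (σ.setCell tLink (N + i - 1) x) := by
  obtain ⟨a1, a2, a3, a4, a5, a6, a7, a8, a9, a10, a11, a12, a13, a14, a15⟩ := h
  refine ⟨a1, a2, a3, a4, ?_, a6, fun y hy hy0 hne => ?_, a8, a9, a10, a11, a12, a13, a14, a15⟩
  · simp only [State.arr_setCell, if_true]
    rwa [Function.update_of_ne (by omega)]
  · have := a7 y hy hy0 hne
    simp only [LinkOK, State.arr_setCell, if_true, Function.update_of_ne hne] at this ⊢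
    exact this

end TrieState

/-- The cell address of a child fits into a machine word. -/
theorem xAddr_fits {B N M : ℕ} {σ : State} {c v : Expr} (hN : σ.reg rLen = N)
    (hB : (2 * N + 1) * M + 4 * N + 10 ≤ B) (hc : c.Fits B σ) (hv : v.Fits B σ)
    (hcM : c.eval σ ≤ M) (hvN : v.eval σ ≤ 2 * N) :
    (xAddr c v).Fits B σ := by
  have := Nat.mul_le_mul_left (2 * N + 1) hcM
  simp only [xAddr, Expr.fits_add, Expr.fits_mul, Expr.fits_reg, Expr.one_eq, Expr.fits_const,
    Expr.eval_add, Expr.eval_reg, Expr.eval_const, Expr.eval_mul, hN, ← two_mul]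
  refine ⟨⟨⟨⟨?_, ?_, ?_⟩, ?_, ?_⟩, hc, ?_⟩, hv, ?_⟩ <;> omega

@[simp] theorem xAddr_eval (σ : State) (c v : Expr) :
    (xAddr c v).eval σ = (2 * σ.reg rLen + 1) * c.eval σ + v.eval σ := by
  simp [xAddr, two_mul]

@[simp] theorem xAddr_cost (c v : Expr) : (xAddr c v).cost = c.cost + v.cost + 7 := by
  simp only [xAddr, Expr.cost_add, Expr.cost_bin, Expr.cost_reg, Expr.one_eq, Expr.cost_const]
  omega

/-- A bound for the number of steps that remain on the way through the trie. -/
def triePotential (N i : ℕ) (σ : State) : ℕ :=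
  2 * N + 2 - 2 * i - σ.arr tDep (σ.reg rNode) - σ.reg rMatch

section
variable {s : ℕ → ℕ} {N i T B M : ℕ} {V : Set ℕ} {σ : State}

/-- The situation in which the search for the longest previous factor stops. -/
structure DescendEnd (s : ℕ → ℕ) (N i : ℕ) (V : Set ℕ) (T : ℕ) (σ : State) : Prop where
  state : TrieState s N i V T σ
  start : σ.reg rStart = T
  child : σ.reg rChild = childOf N (σ.arr tChild) (σ.reg rNode)
    (s (i + σ.arr tDep (σ.reg rNode)))
  mismatch : σ.reg rChild ≠ 0 → σ.reg rMatch < σ.arr tDep (σ.reg rChild) ∧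
    s (σ.arr tOcc (σ.reg rChild) + σ.reg rMatch) ≠ s (i + σ.reg rMatch)
  last : N + i - 1 ∈ V → LinkOK s V (σ.arr tDep) (σ.arr tOcc) (σ.arr tLink) (N + i - 1) ∨
    σ.arr tDep (σ.reg rNode) < T ∧ σ.reg rMatch = T ∧ σ.reg rChild ≠ 0

/-- Every pass that does not stop moves to a deeper node or lengthens the match by a letter, and
either lowers `triePotential` by one. The pending suffix link is set when a node of depth `T` is
met. Otherwise the walk ends on an edge across depth `T` with match length exactly `T`, and the
insertion will create the missing node. -/
theorem wp_lzDescend (hs : Terminated s N) (hi : 1 ≤ i) (hiN : i ≤ N) (hsM : ∀ k, s k ≤ M)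
    (hB : (2 * N + 1) * M + 4 * N + 10 ≤ B) (hMB : M ≤ B) (h : TrieState s N i V T σ)
    (hT : σ.reg rStart = T) (hL : σ.reg rMatch = T) (hgo : σ.reg rGo = 1) :
    Wp B lzDescend σ fun t τ => ∃ m, t + m ≤ 100 * triePotential N i σ + 101 ∧
      100 * triePotential N i τ ≤ m ∧ DescendEnd s N i V T τ := by
  have hB1 : 1 ≤ B := by omega
  refine (Wp.loop (m := 100 * triePotential N i σ + 101)
    (I := fun m τ => TrieState s N i V T τ ∧ τ.reg rStart = T ∧
      (N + i - 1 ∈ V → LinkOK s V (τ.arr tDep) (τ.arr tOcc) (τ.arr tLink) (N + i - 1) ∨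
        τ.arr tDep (τ.reg rNode) ≤ T ∧ τ.reg rMatch = T) ∧ τ.reg rGo ≤ 1 ∧
      100 * (triePotential N i τ + τ.reg rGo) + 1 ≤ m ∧
      (τ.reg rGo = 0 → DescendEnd s N i V T τ))
    (Q := fun m τ => 100 * triePotential N i τ ≤ m ∧ DescendEnd s N i V T τ) ?_
    ⟨h, hT, fun _ => .inr ⟨hL ▸ h.node_le, hL⟩, by omega, by omega, by omega⟩).mono ?_
  swap
  · rintro t τ ⟨m, hm, h1, h2⟩
    exact ⟨m, hm, h1, h2⟩
  have hTN : T ≤ N + 1 := by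
    have := h.add_match_le hs hiN
    omega
  clear h hT hL hgo
  rintro m σ ⟨h, hT, hl, hgo, hm, hend⟩
  simp only [Expr.fits_reg, Expr.eval_reg, Expr.cost_reg]
  refine ⟨by omega, fun h1 => ?_, fun h0 => ⟨m - 1, by omega, by omega, hend h0⟩⟩
  have hgo : σ.reg rGo = 1 := by omega
  clear hend h1
  rw [wp_block_cons]
  have hiL := h.add_match_le hs hiN
  have hle := h.node_le
  have hnode := h.node_le_two_mul hiN
  have hstep : Wp B (when ((Expr.cell tDep xNode).isEq xStart)
      (.store tLink (xLen + xI - 1) xNode)) σ fun t τ => t ≤ 20 ∧ TrieState s N i V T τ ∧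
        τ.reg = σ.reg ∧ triePotential N i τ = triePotential N i σ ∧ 
      (N + i - 1 ∈ V → LinkOK s V (τ.arr tDep) (τ.arr tOcc) (τ.arr tLink) (N + i - 1) ∨
        τ.arr tDep (τ.reg rNode) < T ∧ τ.reg rMatch = T) := by
    rw [wp_when]
    refine ⟨?_, fun h0 => ?_, fun h0 => ?_⟩
    · simp [hB1, hT]
      omega
    · rw [wp_store]
      refine ⟨?_, ?_, ?_⟩
      · simp [h.len, h.idx]
        omega
      · simp
        omega
      · have h0 : σ.arr tDep (σ.reg rNode) = T := by simpa [hT] using h0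
        have := h.setLink (by omega) hi (σ.reg rNode)
        simp only [Expr.eval_sub, Expr.eval_add, Expr.eval_reg, h.len, h.idx, Expr.eval_const, Expr.one_eq]
        refine ⟨by simp, this, rfl, rfl, fun hV => .inl ?_⟩
        have h2 := h.last hV
        simp only [LinkOK, State.arr_setCell, if_true, Function.update_self]
        refine ⟨h.node_mem, ?_, ?_⟩
        · simp [h0, h2.1]
        · have := h.node_eq.symm
          simpa [h2.2.1] using this
    · have h0 : σ.arr tDep (σ.reg rNode) ≠ T := by simpa [hT] using h0
      exact ⟨by simp, h, rfl, rfl, fun hV => (hl hV).imp_right fun h => ⟨by omega, h.2⟩⟩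
  refine hstep.mono fun t₀ σ₁ ⟨ht₀, h₁, hreg, hpot, hl₁⟩ => ?_
  rw [hgo, ← hpot] at hm
  rw [← hreg] at hT hgo
  have hpos : 2 * N + 2 - 2 * i - σ₁.arr tDep (σ₁.reg rNode) - σ₁.reg rMatch =
    triePotential N i σ₁ := rfl
  have hle := h₁.node_le
  have hnode := h₁.node_le_two_mul hiN
  have hiL := h₁.add_match_le hs hiN
  clear hstep hl h
  rw [wp_block_cons, wp_assign]
  have hw := h₁.word
  have hic := fun c => h₁.child_le hiN c
  have hsM' := hsM
  refine ⟨?_, ?_⟩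
  · rw [Expr.fits_cell]
    refine ⟨xAddr_fits h₁.len hB ?_ ?_ ?_ ?_, ?_⟩
    · simp [h₁.idx, hw]
      have := hsM (i + σ₁.arr tDep (σ₁.reg rNode))
      omega
    · simp
      omega
    · simpa [hw] using hsM _
    · simpa using hnode
    · simp only [xAddr_eval, h₁.len]
      exact (hic _).trans (by omega)
  simp only [Expr.eval_cell, xAddr_eval, Expr.eval_add, Expr.eval_reg, h₁.len, h₁.idx, hw,
    Expr.cost_cell, xAddr_cost, Expr.cost_add, Expr.cost_reg]
  obtain ⟨u, hu⟩ : ∃ u, u = childOf N (σ₁.arr tChild) (σ₁.reg rNode)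
    (s (i + σ₁.arr tDep (σ₁.reg rNode))) := ⟨_, rfl⟩
  have hu' : σ₁.arr tChild ((2 * N + 1) * s (i + σ₁.arr tDep (σ₁.reg rNode)) +
    σ₁.reg rNode) = u := hu.symm
  rw [hu']
  have h₂ : TrieState s N i V T (σ₁.setReg rChild u) :=
    h₁.congr rfl rfl rfl h₁.node_mem h₁.node_eq h₁.node_le h₁.match_eq
  have huN := hic (s (i + σ₁.arr tDep (σ₁.reg rNode)))
  rw [← hu] at huN
  have hcn := h₁.tree.ch_node _ h₁.node_mem (s (i + σ₁.arr tDep (σ₁.reg rNode)))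
  have heq := fun h0 l => h₁.tree.eqLen_child h₁.node_mem h₁.node_eq h₁.node_le h₁.match_eq h0 (l := l)
  have hcm := fun h0 => h₁.tree.child_mem hs hiN h₁.node_mem h₁.node_eq h₁.node_le h₁.match_eq h0
  have hpc := h₁.tree.pos_child h₁.node_mem (c := s (i + σ₁.arr tDep (σ₁.reg rNode)))
  rw [← hu] at hcn heq hcm hpc
  rw [wp_block_cons, wp_ite]
  refine ⟨by simp; omega, fun h0 => ?_, fun h0 => ?_⟩
  swap
  · have h0 : u = 0 := by simpa using h0
    rw [wp_assign]
    refine ⟨by simp, wp_block_nil.2 ?_⟩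
    have hd := h₁.tree.eq_dep_of_child_eq_zero h₁.node_mem h₁.node_eq h₁.node_le h₁.match_eq
      (hu.symm.trans h0)
    have h₃ : TrieState s N i V T ((σ₁.setReg rChild u).setReg rGo 0) :=
      h₂.congr rfl rfl rfl h₂.node_mem h₂.node_eq h₂.node_le h₂.match_eq
    -- Without a child the match ends exactly at the node, so the node cannot be strictly above
    -- depth `T` while the match has length `T`.
    have hlast : N + i - 1 ∈ V →
        LinkOK s V (σ₁.arr tDep) (σ₁.arr tOcc) (σ₁.arr tLink) (N + i - 1) :=
      fun hV => (hl₁ hV).resolve_right fun h => by omega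
    refine ⟨100 * triePotential N i σ₁ + 1, ?_, by simpa using h₃, by simpa using hT,
      by simpa using fun hV => .inl (hlast hV), by simp, ?_, fun _ => ⟨by simpa using h₃,
        by simpa using hT, by simpa using hu, fun h1 => absurd h0 (by simpa using h1),
        by simpa using fun hV => .inl (hlast hV)⟩⟩
    · simp
      omega
    · simp [triePotential]
  have h0 : u ≠ 0 := by simpa using h0
  have hmem := (hcn h0).1
  have hdu := h₁.dep_node_le hmem
  have hou := h₁.occ_node_lt hi hmem
  rw [wp_ite]
  refine ⟨by simp; omega, fun h1 => ?_, fun h1 => ?_⟩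
  · have h1 : σ₁.arr tDep u ≤ σ₁.reg rMatch := by simpa using h1
    rw [wp_assign]
    refine ⟨by simp; omega, wp_block_nil.2 ?_⟩
    have h₃ : TrieState s N i V T ((σ₁.setReg rChild u).setReg rNode u) :=
      h₂.congr rfl rfl rfl (by simpa using hcm h0 h1)
        (by simpa using (heq h0 _ h1 le_rfl).symm) (by simpa using h1)
        (by simpa using h₁.match_eq)
    refine ⟨100 * (triePotential N i ((σ₁.setReg rChild u).setReg rNode u) + 1) + 1, ?_,
      by simpa using h₃, by simpa using hT, fun hV => ?_, by simp [hgo], ?_, by simp [hgo]⟩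
    · have := (hcn h0).2.1
      simp [triePotential]
      omega
    · refine (hl₁ hV).imp ?_ ?_
      · simp
      · rintro ⟨h3, h4⟩
        simp
        omega
    · simp [hgo]
  · have h1 : σ₁.reg rMatch < σ₁.arr tDep u := by simpa using h1
    have hpu := hpc h0
    have hsu := hsM (σ₁.arr tOcc u + σ₁.reg rMatch)
    have hsi := hsM (i + σ₁.reg rMatch)
    rw [wp_ite]
    refine ⟨?_, fun h2 => ?_, fun h2 => ?_⟩
    · simp [hB1, hw, h₁.idx]
      omega
    · have h2 : s (σ₁.arr tOcc u + σ₁.reg rMatch) = s (i + σ₁.reg rMatch) := by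
        simpa [hw, h₁.idx] using h2
      rw [wp_assign]
      refine ⟨by simp; omega, wp_block_nil.2 ?_⟩
      have he := (heq h0 _ le_rfl h1.le).succ h2
      have h₃ : TrieState s N i V T ((σ₁.setReg rChild u).setReg rMatch (σ₁.reg rMatch + 1)) :=
        h₂.congr rfl rfl rfl (by simpa using h₁.node_mem)
          (by simpa using h₁.node_eq) (by simpa using h₁.node_le.trans (Nat.le_succ _))
          (by simpa using ⟨_, hpu.1, hpu.2, he⟩)
      have hadd := hs.add_le hpu.1 hpu.2 hiN he
      refine ⟨100 * (triePotential N i ((σ₁.setReg rChild u).setReg rMatch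
        (σ₁.reg rMatch + 1)) + 1) + 1, ?_, by simpa using h₃, by simpa using hT, fun hV => ?_,
        by simp [hgo], ?_, by simp [hgo]⟩
      · simp [triePotential]
        omega
      · refine .inl ?_
        -- If the link were still pending, this comparison would be the one at depth `T`. All
        -- earlier occurrences of that length run along the edge to `u`, in particular the one in
        -- `last` that continues with a different letter than the word at `i`; so the comparison
        -- could not have succeeded.
        have := (hl₁ hV).resolve_right fun h3 => ?_
        · simpa using this
        · obtain ⟨-, -, b, hb, hbi, hbe, hbn⟩ := h₁.last hV
          have := h₁.tree.eqLen_child_of_eqLen h₁.node_mem h₁.node_eq h3.1 hb hbi hbe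
          rw [← hu] at this
          refine hbn ?_
          rw [← this T (by omega), ← h3.2]
          exact h2
      · simp [hgo]
    · have h2 : s (σ₁.arr tOcc u + σ₁.reg rMatch) ≠ s (i + σ₁.reg rMatch) := by
        simpa [hw, h₁.idx] using h2
      rw [wp_assign]
      refine ⟨by simp, wp_block_nil.2 ?_⟩
      have h₃ : TrieState s N i V T ((σ₁.setReg rChild u).setReg rGo 0) :=
        h₂.congr rfl rfl rfl h₂.node_mem h₂.node_eq h₂.node_le h₂.match_eq
      refine ⟨100 * triePotential N i σ₁ + 1, ?_, by simpa using h₃, by simpa using hT,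
        fun hV => ?_, by simp, ?_, fun _ => ⟨by simpa using h₃,
          by simpa using hT, by simpa using hu, fun _ => by simpa using ⟨h1, h2⟩,
          fun hV => ?_⟩⟩
      · simp
        omega
      · refine (hl₁ hV).imp ?_ ?_
        · simp
        · rintro ⟨h3, h4⟩
          simp
          omega
      · simp [triePotential]
      · refine (hl₁ hV).imp ?_ ?_
        · simp
        · rintro ⟨h3, h4⟩
          simp
          omega
end
end RAM

namespace RAM
section
variable {s : ℕ → ℕ} {N i T B M : ℕ} {V V' : Set ℕ} {σ τ : State}

/-- The walk stops at a missing child or at a mismatch on an edge, and a longer earlier occurrence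
would have to run along that very child. -/
theorem DescendEnd.not_eqLen (h : DescendEnd s N i V T σ) {a : ℕ} (ha : 1 ≤ a) (hai : a < i) :
    ¬ EqLen s a i (σ.reg rMatch + 1) := by
  intro he
  have hst := h.state
  have hc := h.child
  by_cases h0 : σ.reg rChild = 0
  · rw [h0] at hc
    have := hst.tree.eq_dep_of_child_eq_zero hst.node_mem hst.node_eq hst.node_le hst.match_eq
      hc.symm
    rw [this] at he
    exact hst.tree.not_eqLen_of_child_eq_zero hst.node_mem hst.node_eq hc.symm ha hai he
  · have := hst.tree.eqLen_child_of_eqLen hst.node_mem hst.node_eq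
      (Nat.lt_succ_of_le hst.node_le) ha hai he
    rw [← hc] at this
    exact (h.mismatch h0).2 ((this _ (h.mismatch h0).1).trans (he _ (Nat.lt_succ_self _)))

/-- The trie after the insertion of the suffix at `i`. -/
structure Inserted (s : ℕ → ℕ) (N i : ℕ) (V V' : Set ℕ) (σ τ : State) : Prop where
  regs : τ.reg = σ.reg
  word : τ.arr tWord = s
  tree : STree s N (i + 1) V' (childOf N (τ.arr tChild)) (τ.arr tDep) (τ.arr tOcc)
  subset : V ⊆ V'
  cases : ∀ x ∈ V', x = N + i ∨ x ∈ V
  dep : ∀ x ∈ V, τ.arr tDep x = σ.arr tDep x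
  occ : ∀ x ∈ V, τ.arr tOcc x = σ.arr tOcc x
  link_zero : τ.arr tLink 0 = 0
  link : ∀ x ∈ V, x ≠ 0 → LinkOK s V' (τ.arr tDep) (τ.arr tOcc) (τ.arr tLink) x
  last : N + i ∈ V' → τ.arr tDep (N + i) = σ.reg rMatch ∧ 0 < σ.reg rMatch ∧
    τ.arr tOcc (N + i) = i ∧ ∃ b, 1 ≤ b ∧ b < i ∧ EqLen s b i (σ.reg rMatch) ∧
      s (b + σ.reg rMatch) ≠ s (i + σ.reg rMatch)
  lpf : τ.arr tLpf = Function.update (σ.arr tLpf) i (σ.reg rMatch)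
  prev : ∀ k, k ≠ i → τ.arr tPrev k = σ.arr tPrev k
  prev_self : σ.reg rMatch = 0 ∨ 1 ≤ τ.arr tPrev i ∧ τ.arr tPrev i < i ∧
    EqLen s (τ.arr tPrev i) i (σ.reg rMatch)
  beg : τ.arr tBeg = σ.arr tBeg
  fin : τ.arr tEnd = σ.arr tEnd

/-- The next suffix can be inserted. -/
theorem DescendEnd.next (h : DescendEnd s N i V T σ) (hs : Terminated s N) (hi : 1 ≤ i)
    (hiN : i ≤ N) (hB : (2 * N + 1) * M + 4 * N + 10 ≤ B)
    (hτ : Inserted s N i V V' σ τ) :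
    Wp B (block [.assign rNode (.cell tLink xNode), .assign rMatch (xMatch - 1),
      .assign rI (xI + 1)]) τ fun t υ => t ≤ 15 ∧ TrieState s N (i + 1) V' (υ.reg rMatch) υ ∧
      triePotential N (i + 1) υ ≤ triePotential N i σ := by
  have hst := h.state
  obtain ⟨regs, word, tree, hVV', hV'V, hdep, hocc, link0, link, last, lpf, prev, previ, beg,
    fin⟩ := hτ
  have h0V := hst.tree.zero_mem
  have hle := hst.node_le
  obtain ⟨x₀, hx₀⟩ : ∃ x, x = τ.arr tLink (σ.reg rNode) := ⟨_, rfl⟩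
  have hnode : x₀ ∈ V' ∧ τ.arr tDep (x₀) = σ.arr tDep (σ.reg rNode) - 1 ∧
      EqLen s (i + 1) (τ.arr tOcc (x₀)) (τ.arr tDep (x₀)) := by
    rw [hx₀]
    by_cases h0 : σ.reg rNode = 0
    · rw [h0, link0, hdep 0 h0V, hst.tree.dep_zero]
      exact ⟨hVV' h0V, rfl, EqLen.zero _ _ _⟩
    · obtain ⟨h1, h2, h3⟩ := link _ hst.node_mem h0
      rw [hdep _ hst.node_mem] at h2
      rw [hocc _ hst.node_mem] at h3
      refine ⟨h1, by omega, (h3.trans ?_).symm⟩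
      have := hst.node_eq
      rw [← h2] at this
      exact this.tail.symm
  have hfin : ∀ (r : ℕ → ℕ), r rLen = N → r rI = i + 1 → r rNode = x₀ →
      r rMatch = σ.reg rMatch - 1 → TrieState s N (i + 1) V' (r rMatch) ⟨r, τ.arr⟩ ∧
        triePotential N (i + 1) ⟨r, τ.arr⟩ ≤ triePotential N i σ := by
    intro r hul hui hn hum
    constructor
    · refine ⟨hul, hui, word, tree, link0, ?_, ?_, ?_, fun k hk hki => ?_, ?_, ?_, (hn.symm ▸ hnode.1 : r rNode ∈ V'),
        by
        simp only [hn]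
        exact hnode.2.2, ?_, ?_⟩
      · rw [hocc 0 h0V, hst.occ_zero]
      · intro x hx hx0 hne
        exact link x ((hV'V x hx).resolve_left (by omega)) hx0
      · intro hV
        rw [show N + (i + 1) - 1 = N + i by omega] at hV ⊢
        obtain ⟨h1, h2, h3, b, hb, hbi, he, hne⟩ := last hV
        -- Two words that branch after a common part still branch after their first letter is
        -- removed. This is why the target of the pending link is a branching place, hence a node,
        -- once the suffix at `i + 1` has been inserted.
        obtain ⟨l, hl⟩ : ∃ l, σ.reg rMatch = l + 1 := ⟨_, (Nat.succ_pred_eq_of_pos h2).symm⟩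
        rw [hl] at he hne
        rw [h1, h3, hum, hl]
        refine ⟨rfl, rfl, b + 1, by omega, by omega, he.tail, ?_⟩
        rwa [Nat.add_sub_cancel, add_assoc, add_comm 1 l, add_assoc, add_comm 1 l]
      · rw [lpf]
        by_cases h1 : k = i
        · subst h1
          rw [Function.update_self]
          exact ⟨previ, fun a ha hai => h.not_eqLen ha hai⟩
        · rw [Function.update_of_ne h1, prev k h1]
          exact hst.best k hk (by omega)
      · rw [beg]
        exact hst.beg
      · rw [fin]
        exact hst.fin
      · change τ.arr tDep (r rNode) ≤ r rMatch
        rw [hn, hnode.2.1, hum]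
        omega
      · change r rMatch = 0 ∨ ∃ a, 1 ≤ a ∧ a < i + 1 ∧ EqLen s a (i + 1) (r rMatch)
        rw [hum]
        rcases hst.match_eq with h1 | ⟨a, ha, hai, he⟩
        · exact .inl (by omega)
        · by_cases h1 : σ.reg rMatch = 0
          · exact .inl (by omega)
          · refine .inr ⟨a + 1, by omega, by omega, ?_⟩
            rw [← Nat.sub_add_cancel (Nat.one_le_iff_ne_zero.2 h1)] at he
            exact he.tail
    -- Node depth and match length each drop by at most one, while `2 * i` grows by two.
    · simp only [triePotential, hn, hnode.2.1, hum]
      omega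
  have hadd := hst.add_match_le hs hiN
  have hx₀N : x₀ ≤ 2 * N := by
    rcases hV'V _ hnode.1 with h1 | h1
    · omega
    · have := hst.tree.mem_cases _ h1
      omega
  have hnN := hst.node_le_two_mul hiN
  rw [wp_block_cons, wp_assign]
  refine ⟨by simp [regs, ← hx₀]; omega, ?_⟩
  rw [wp_block_cons, wp_assign]
  refine ⟨by simp [regs]; omega, ?_⟩
  rw [wp_block_cons, wp_assign]
  refine ⟨by simp [regs, hst.idx]; omega, wp_block_nil.2 ⟨by simp, ?_⟩⟩
  exact hfin _ (by simp [regs, hst.len]) (by simp [regs, hst.idx]) (by simp [regs, hx₀])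
    (by simp [regs])

/-- The walk has ended inside an edge (nonzero child: split the edge) or at a node without the
required child (attach a leaf). In both cases the position stored at the child or node is an earlier
occurrence of the longest match, unless that match is empty. -/
theorem wp_lzInsert (hs : Terminated s N) (hi : 1 ≤ i) (hiN : i ≤ N) (hsM : ∀ k, s k ≤ M)
    (hB : (2 * N + 1) * M + 4 * N + 10 ≤ B) (hMB : M ≤ B) (hT : T ≤ N + 1)
    (h : DescendEnd s N i V T σ) :
    Wp B lzInsert σ fun t τ => t ≤ 200 ∧ triePotential N (i + 1) τ ≤ triePotential N i σ ∧
      ∃ V', TrieState s N (i + 1) V' (τ.reg rMatch) τ := by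
  have hB1 : 1 ≤ B := by omega
  have hst := h.state
  have hadd := hst.add_match_le hs hiN
  have hlen := hst.len
  have hidx := hst.idx
  have hword := hst.word
  have hVle : ∀ x ∈ V, x ≤ 2 * N ∧ x ≠ i ∧ x ≠ N + i := fun x hx => by
    have := hst.tree.mem_cases x hx
    omega
  have hv := hVle _ hst.node_mem
  have hvo := hst.occ_node_lt hi (.inl hst.node_mem)
  have hvd := hst.node_le
  have hsi := hsM (i + σ.arr tDep (σ.reg rNode))
  rw [lzInsert, wp_block_cons, wp_store]
  refine ⟨by simp; omega, by simp; omega, ?_⟩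
  rw [wp_block_cons, wp_store]
  refine ⟨by simp; omega, by simp; omega, ?_⟩
  rw [wp_block_cons, wp_store]
  refine ⟨by simp; omega, by simp; omega, ?_⟩
  simp only [Expr.eval_reg, Expr.eval_add, Expr.eval_sub, Expr.two_eq, Expr.eval_const,
    State.reg_setCell, hidx, hlen, Expr.cost_reg, Expr.cost_add, Expr.cost_sub, Expr.cost_const]
  obtain ⟨σ₁, hσ₁⟩ : ∃ x, x = ((σ.setCell tLpf i (σ.reg rMatch)).setCell tDep i
    (N + 2 - i)).setCell tOcc i i := ⟨_, rfl⟩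
  rw [← hσ₁]
  have r₁ : σ₁.reg = σ.reg := by rw [hσ₁]; rfl
  have d₁ : σ₁.arr tDep = Function.update (σ.arr tDep) i (N + 2 - i) := by simp [hσ₁]
  have o₁ : σ₁.arr tOcc = Function.update (σ.arr tOcc) i i := by simp [hσ₁]
  have l₁ : σ₁.arr tLpf = Function.update (σ.arr tLpf) i (σ.reg rMatch) := by simp [hσ₁]
  have a₁ : ∀ a, a ≠ tDep → a ≠ tOcc → a ≠ tLpf → σ₁.arr a = σ.arr a := by
    intro a h1 h2 h3
    simp [hσ₁, h1, h2, h3]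
  clear hσ₁
  have hw₁ : σ₁.arr tWord = s := by rw [a₁ _ (by decide) (by decide) (by decide), hword]
  have hv₁ : σ₁.arr tOcc (σ.reg rNode) = σ.arr tOcc (σ.reg rNode) := by
    rw [o₁, Function.update_of_ne hv.2.1]
  have hd₁ : σ₁.arr tDep (σ.reg rNode) = σ.arr tDep (σ.reg rNode) := by
    rw [d₁, Function.update_of_ne hv.2.1]
  rw [wp_block_cons]
  suffices hins : Wp B _ σ₁ fun t τ => t ≤ 150 ∧ ∃ V', Inserted s N i V V' σ τ by
    refine hins.mono fun t τ ⟨ht, V', hτ⟩ => ?_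
    refine (h.next hs hi hiN hB hτ).mono fun t' υ ⟨ht', h1, h2⟩ => ?_
    exact ⟨by omega, h2, V', h1⟩
  rw [wp_ite]
  refine ⟨by simp [r₁, h.child]; exact (hst.child_le hiN _).trans (by omega), ?_, ?_⟩
  · intro h0
    have h0 : σ.reg rChild ≠ 0 := by simpa [r₁] using h0
    have hc := h.child
    obtain ⟨hlt, hmis⟩ := h.mismatch h0
    have hch0 := hc ▸ h0
    have hcn := hst.tree.ch_node _ hst.node_mem _ hch0
    have hpc := hst.tree.pos_child hst.node_mem hch0
    have heq := hst.tree.eqLen_child hst.node_mem hst.node_eq hst.node_le hst.match_eq hch0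
      (l := σ.reg rMatch) le_rfl
    have hvL := hst.tree.lt_of_mismatch hst.node_mem hst.node_le hch0
    have huN := hst.child_le hiN (s (i + σ.arr tDep (σ.reg rNode)))
    rw [← hc] at hcn hpc heq hvL huN
    have heq := heq hlt.le
    have hvL := hvL hmis
    have hne := hst.tree.ne_new hi hiN hcn.1
    have hu₁ : σ₁.arr tOcc (σ.reg rChild) = σ.arr tOcc (σ.reg rChild) := by rw [o₁, Function.update_of_ne hne.1]
    have hsu := hsM (σ.arr tOcc (σ.reg rChild) + (σ.reg rMatch))
    have hsL := hsM (i + (σ.reg rMatch))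
    rw [wp_block_cons, wp_store]
    refine ⟨by simp [r₁]; omega, by simp [r₁, hu₁]; omega, ?_⟩
    rw [wp_block_cons, wp_store]
    refine ⟨by simp [r₁]; omega, by simp [r₁]; omega, ?_⟩
    rw [wp_block_cons, wp_store]
    refine ⟨by simp [r₁]; omega, by simp [r₁]; omega, ?_⟩
    simp only [Expr.eval_reg, Expr.eval_cell, r₁, hidx, hu₁, Expr.cost_reg, Expr.cost_cell,
      Expr.eval_add, State.reg_setCell, hlen, Expr.cost_add]
    obtain ⟨σ₂, hσ₂⟩ : ∃ x, x = ((σ₁.setCell tPrev i (σ.arr tOcc (σ.reg rChild))).setCell tDep (N + i)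
      (σ.reg rMatch)).setCell tOcc (N + i) i := ⟨_, rfl⟩
    rw [← hσ₂]
    have r₂ : σ₂.reg = σ.reg := by rw [hσ₂, ← r₁]; rfl
    have d₂ : ∀ x, x ≠ N + i → σ₂.arr tDep x = σ₁.arr tDep x := fun x hx => by
      simp [hσ₂, hx]
    have d₂' : σ₂.arr tDep (N + i) = (σ.reg rMatch) := by simp [hσ₂]
    have o₂ : ∀ x, x ≠ N + i → σ₂.arr tOcc x = σ₁.arr tOcc x := fun x hx => by
      simp [hσ₂, hx]
    have o₂' : σ₂.arr tOcc (N + i) = i := by simp [hσ₂]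
    have a₂ : ∀ a, a ≠ tDep → a ≠ tOcc → a ≠ tPrev → σ₂.arr a = σ₁.arr a := by
      intro a h1 h2 h3
      simp [hσ₂, h1, h2, h3]
    have p₂ : σ₂.arr tPrev = Function.update (σ.arr tPrev) i (σ.arr tOcc (σ.reg rChild)) := by
      simp [hσ₂, a₁]
    clear hσ₂
    have hw₂ : σ₂.arr tWord = s := by rw [a₂ _ (by decide) (by decide) (by decide), hw₁]
    have hv₂ : σ₂.arr tDep (σ.reg rNode) = σ.arr tDep (σ.reg rNode) := by rw [d₂ _ hv.2.2, hd₁]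
    have hu₂ : σ₂.arr tOcc (σ.reg rChild) = σ.arr tOcc (σ.reg rChild) := by rw [o₂ _ hne.2, hu₁]
    rw [wp_block_cons, wp_store]
    refine ⟨xAddr_fits (N := N) (by simpa [r₂] using hlen) hB ?_ ?_ ?_ ?_, ?_, ?_⟩
    · simp [r₂, hidx, hv₂, hw₂]
      omega
    · simp [r₂]
      omega
    · simpa [hw₂] using hsM _
    · simpa [r₂] using hv.1
    · simp [r₂]
      omega
    rw [wp_block_cons, wp_store]
    refine ⟨xAddr_fits (N := N) (by simpa [r₂] using hlen) hB ?_ ?_ ?_ ?_, ?_, ?_⟩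
    · simp [r₂, hu₂, hw₂]
      omega
    · simp [r₂]
      omega
    · simpa [hw₂] using hsM _
    · simp [r₂, hlen, hidx]
      omega
    · simp [r₂]
      omega
    rw [wp_block_cons, wp_store]
    refine ⟨xAddr_fits (N := N) (by simpa [r₂] using hlen) hB ?_ ?_ ?_ ?_, ?_, ?_⟩
    · simp [r₂, hidx, hw₂]
      omega
    · simp [r₂]
      omega
    · simpa [hw₂] using hsM _
    · simp [r₂, hlen, hidx]
      omega
    · simp [r₂]
      omega
    obtain ⟨σ₃, hσ₃⟩ : ∃ x, x = ((σ₂.setCell tChild ((2 * N + 1) * s (i + σ.arr tDep (σ.reg rNode)) + (σ.reg rNode))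
      (N + i)).setCell tChild ((2 * N + 1) * s (σ.arr tOcc (σ.reg rChild) + (σ.reg rMatch)) + (N + i)) (σ.reg rChild)).setCell tChild
      ((2 * N + 1) * s (i + (σ.reg rMatch)) + (N + i)) i := ⟨_, rfl⟩
    have r₃ : σ₃.reg = σ.reg := by rw [hσ₃, ← r₂]; rfl
    have a₃ : ∀ a, a ≠ tChild → σ₃.arr a = σ₂.arr a := by
      intro a h1
      simp [hσ₃, h1]
    have hNi : N + i ≤ 2 * N := by omega
    have c₃ : ∀ x ≤ 2 * N, ∀ c, childOf N (σ₃.arr tChild) x c =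
        if x = N + i ∧ c = s (i + (σ.reg rMatch)) then i else if x = N + i ∧ c = s (σ.arr tOcc (σ.reg rChild) + (σ.reg rMatch)) then (σ.reg rChild)
        else if x = (σ.reg rNode) ∧ c = s (i + σ.arr tDep (σ.reg rNode)) then N + i
        else childOf N (σ.arr tChild) x c := by
      intro x hx c
      simp only [hσ₃, State.arr_setCell, if_true]
      rw [childOf_update hNi hx, childOf_update hNi hx, childOf_update hv.1 hx,
        a₂ _ (by decide) (by decide) (by decide), a₁ _ (by decide) (by decide) (by decide)]
    have hgoal : Wp B (block [when (xMatch.isEq xStart)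
        (.store tLink (xLen + xI - 1) (xLen + xI))]) σ₃ fun t τ => t ≤ 20 ∧
        Inserted s N i V (insert (N + i) V) σ τ := by
      have hins : ∀ τ : State, τ.reg = σ.reg → (∀ a, a ≠ tLink → τ.arr a = σ₃.arr a) →
          (σ.reg rMatch = T ∧ τ.arr tLink = Function.update (σ.arr tLink) (N + i - 1) (N + i) ∨
            σ.reg rMatch ≠ T ∧ τ.arr tLink = σ.arr tLink) →
          Inserted s N i V (insert (N + i) V) σ τ := by
        intro τ hr ha hl
        have hdep : ∀ x, x ≠ N + i → τ.arr tDep x = σ₁.arr tDep x := fun x hx => by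
          rw [ha _ (by decide), a₃ _ (by decide), d₂ x hx]
        have hdep' : τ.arr tDep (N + i) = σ.reg rMatch := by
          rw [ha _ (by decide), a₃ _ (by decide), d₂']
        have hocc : ∀ x, x ≠ N + i → τ.arr tOcc x = σ₁.arr tOcc x := fun x hx => by
          rw [ha _ (by decide), a₃ _ (by decide), o₂ x hx]
        have hocc' : τ.arr tOcc (N + i) = i := by
          rw [ha _ (by decide), a₃ _ (by decide), o₂']
        have hdV : ∀ x ∈ V, τ.arr tDep x = σ.arr tDep x := fun x hx => by
          rw [hdep x (hVle x hx).2.2, d₁, Function.update_of_ne (hVle x hx).2.1]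
        have hoV : ∀ x ∈ V, τ.arr tOcc x = σ.arr tOcc x := fun x hx => by
          rw [hocc x (hVle x hx).2.2, o₁, Function.update_of_ne (hVle x hx).2.1]
        have hold : ∀ a, a ≠ tLink → a ≠ tChild → a ≠ tDep → a ≠ tOcc → a ≠ tPrev →
            τ.arr a = σ₁.arr a := fun a h1 h2 h3 h4 h5 => by
          rw [ha a h1, a₃ a h2, a₂ a h3 h4 h5]
        have hiNi : i ≠ N + i := by omega
        refine ⟨hr, ?_, ?_, Set.subset_insert _ _, fun x hx => hx, hdV, hoV, ?_, ?_, ?_, ?_, ?_,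
          ?_, ?_, ?_⟩
        · rw [hold _ (by decide) (by decide) (by decide) (by decide) (by decide), hw₁]
        · refine hst.tree.insert_split hs hi hiN hst.node_mem hst.node_eq hc.symm h0 hvL hlt heq
            hmis (fun x hx hx' => ?_) ?_ hdep' (fun x hx hx' => ?_) ?_ hocc'
            (fun x hx hx' c hxc => ?_) ?_ ?_ ?_ (fun c h1 h2 => ?_)
          · rw [hdep x hx', d₁, Function.update_of_ne hx]
          · rw [hdep i hiNi, d₁, Function.update_self]
          · rw [hocc x hx', o₁, Function.update_of_ne hx]
          · rw [hocc i hiNi, o₁, Function.update_self]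
          · rw [ha _ (by decide), c₃ x hx, if_neg (by tauto), if_neg (by tauto), if_neg hxc]
          · rw [ha _ (by decide), c₃ _ hv.1, if_neg (fun h => hv.2.2 h.1),
              if_neg (fun h => hv.2.2 h.1), if_pos ⟨rfl, rfl⟩]
          · rw [ha _ (by decide), c₃ _ hNi, if_pos ⟨rfl, rfl⟩]
          · rw [ha _ (by decide), c₃ _ hNi, if_neg (fun h => hmis h.2), if_pos ⟨rfl, rfl⟩]
          · rw [ha _ (by decide), c₃ _ hNi, if_neg (fun h => h1 h.2), if_neg (fun h => h2 h.2),
              if_neg (fun h => hv.2.2 h.1.symm)]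
            refine hst.tree.ch_zero _ (fun h => ?_) hNi _
            exact (hVle _ h).2.2 rfl
        · rcases hl with ⟨-, hl⟩ | ⟨-, hl⟩
          · rw [hl, Function.update_of_ne (by omega), hst.link_zero]
          · rw [hl, hst.link_zero]
        · intro x hx hx0
          have hkeep : LinkOK s V (σ.arr tDep) (σ.arr tOcc) (σ.arr tLink) x →
              τ.arr tLink x = σ.arr tLink x →
              LinkOK s (insert (N + i) V) (τ.arr tDep) (τ.arr tOcc) (τ.arr tLink) x := by
            rintro ⟨h1, h2, h3⟩ h4
            rw [LinkOK, h4, hdV _ hx, hoV _ hx, hdV _ h1, hoV _ h1]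
            exact ⟨.inr h1, h2, h3⟩
          by_cases hxl : x = N + i - 1
          -- If the split is at depth `T`, the new node itself is the target of the pending link.
          -- Otherwise the walk has already set the link.
          · rcases hl with ⟨h1, hl⟩ | ⟨h1, hl⟩
            · obtain ⟨h2, h3, -⟩ := hst.last (hxl ▸ hx)
              rw [LinkOK, hdV _ hx, hoV _ hx, hxl, hl, Function.update_self, hdep', hocc', h1, h2,
                h3]
              exact ⟨.inl rfl, rfl, EqLen.refl _ _ _⟩
            · refine hkeep ?_ (by rw [hl])
              rw [hxl]
              exact (h.last (hxl ▸ hx)).resolve_right fun h2 => h1 h2.2.1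
          · refine hkeep (hst.link x hx hx0 hxl) ?_
            rcases hl with ⟨-, hl⟩ | ⟨-, hl⟩
            · rw [hl, Function.update_of_ne hxl]
            · rw [hl]
        · exact fun _ => ⟨hdep', by omega, hocc', _, hpc.1, hpc.2, heq, hmis⟩
        · rw [hold _ (by decide) (by decide) (by decide) (by decide) (by decide), l₁]
        · intro k hk
          rw [ha _ (by decide), a₃ _ (by decide), p₂, Function.update_of_ne hk]
        · rw [ha _ (by decide), a₃ _ (by decide), p₂, Function.update_self]
          exact .inr ⟨hpc.1, hpc.2, heq⟩
        · rw [hold _ (by decide) (by decide) (by decide) (by decide) (by decide),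
            a₁ _ (by decide) (by decide) (by decide)]
        · rw [hold _ (by decide) (by decide) (by decide) (by decide) (by decide),
            a₁ _ (by decide) (by decide) (by decide)]
      have hl₃ : σ₃.arr tLink = σ.arr tLink := by
        rw [a₃ _ (by decide), a₂ _ (by decide) (by decide) (by decide),
          a₁ _ (by decide) (by decide) (by decide)]
      rw [wp_block_cons, wp_when]
      refine ⟨?_, fun h1 => ?_, fun h1 => ?_⟩
      · simp [hB1, r₃, h.start]
        omega
      · have h1 : σ.reg rMatch = T := by simpa [r₃, h.start] using h1
        rw [wp_store, wp_block_nil]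
        refine ⟨by simp [r₃]; omega, by simp [r₃]; omega, by simp, ?_⟩
        refine hins _ r₃ (fun a ha => by simp [ha]) (.inl ⟨h1, ?_⟩)
        simp [hl₃, r₃, hlen, hidx]
      · have h1 : σ.reg rMatch ≠ T := by simpa [r₃, h.start] using h1
        rw [wp_block_nil]
        exact ⟨by simp, hins _ r₃ (fun a ha => rfl) (.inr ⟨h1, hl₃⟩)⟩
    have hσ₃' := hgoal
    rw [hσ₃] at hσ₃'
    simp [r₂, hlen, hidx, hv₂, hw₂, hu₂]
    exact hσ₃'.mono fun t τ h => ⟨by omega, _, h.2⟩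
  · intro h0
    have h0 : σ.reg rChild = 0 := by simpa [r₁] using h0
    have hc := h.child
    rw [h0] at hc
    have hLd := hst.tree.eq_dep_of_child_eq_zero hst.node_mem hst.node_eq hst.node_le
      hst.match_eq hc.symm
    rw [wp_block_cons, wp_store]
    refine ⟨by simp [r₁]; omega, by simp [r₁, hv₁]; omega, ?_⟩
    simp only [Expr.eval_reg, Expr.eval_cell, r₁, hidx, hv₁, Expr.cost_reg, Expr.cost_cell]
    rw [wp_block_cons, wp_store]
    refine ⟨xAddr_fits (N := N) (by simpa [r₁] using hlen) hB ?_ ?_ ?_ ?_, ?_, ?_⟩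
    · simp [r₁, hidx, hd₁, hw₁]
      omega
    · simp [r₁]
      omega
    · simpa [hw₁] using hsM _
    · simpa [r₁] using hv.1
    · simp [r₁]
      omega
    rw [wp_block_nil]
    refine ⟨by simp, V, ?_⟩
    obtain ⟨τ, hτ⟩ : ∃ τ, τ = (σ₁.setCell tPrev i (σ.arr tOcc (σ.reg rNode))).setCell tChild
      ((2 * N + 1) * s (i + σ.arr tDep (σ.reg rNode)) + σ.reg rNode) i := ⟨_, rfl⟩
    have hτ' : ∀ a, a ≠ tPrev → a ≠ tChild → τ.arr a = σ₁.arr a := by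
      intro a h1 h2
      simp [hτ, h1, h2]
    have hch : τ.arr tChild = Function.update (σ.arr tChild)
        ((2 * N + 1) * s (i + σ.arr tDep (σ.reg rNode)) + σ.reg rNode) i := by
      simp [hτ, a₁]
    have hpr : τ.arr tPrev = Function.update (σ.arr tPrev) i (σ.arr tOcc (σ.reg rNode)) := by
      simp [hτ, a₁]
    have hrg : τ.reg = σ.reg := by rw [hτ, ← r₁]; rfl
    have hgoal : Inserted s N i V V σ τ := by
      have hdep : τ.arr tDep = Function.update (σ.arr tDep) i (N + 2 - i) := by
        rw [hτ' _ (by decide) (by decide), d₁]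
      have hocc : τ.arr tOcc = Function.update (σ.arr tOcc) i i := by
        rw [hτ' _ (by decide) (by decide), o₁]
      have hlink : τ.arr tLink = σ.arr tLink := by
        rw [hτ' _ (by decide) (by decide), a₁ _ (by decide) (by decide) (by decide)]
      have hdV : ∀ x ∈ V, τ.arr tDep x = σ.arr tDep x := fun x hx => by
        rw [hdep, Function.update_of_ne (hVle x hx).2.1]
      have hoV : ∀ x ∈ V, τ.arr tOcc x = σ.arr tOcc x := fun x hx => by
        rw [hocc, Function.update_of_ne (hVle x hx).2.1]
      refine ⟨hrg, ?_, ?_, subset_rfl, fun x hx => .inr hx, hdV, hoV, ?_, ?_, ?_, ?_, ?_, ?_,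
        ?_, ?_⟩
      · rw [hτ' _ (by decide) (by decide), hw₁]
      · refine hst.tree.insert_leaf hs hi hiN hst.node_mem hst.node_eq hc.symm
          (fun x hx => ?_) ?_ (fun x hx => ?_) ?_ (fun x hx c hxc => ?_) ?_
        · rw [hdep, Function.update_of_ne hx]
        · rw [hdep, Function.update_self]
        · rw [hocc, Function.update_of_ne hx]
        · rw [hocc, Function.update_self]
        · rw [hch, childOf_update hv.1 hx, if_neg hxc]
        · rw [hch, childOf_update hv.1 hv.1, if_pos ⟨rfl, rfl⟩]
      · rw [hlink, hst.link_zero]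
      · intro x hx hx0
        have : LinkOK s V (σ.arr tDep) (σ.arr tOcc) (σ.arr tLink) x := by
          by_cases hxl : x = N + i - 1
          · subst hxl
            exact (h.last hx).resolve_right fun h => h.2.2 h0
          · exact hst.link x hx hx0 hxl
        simp only [LinkOK] at this ⊢
        rw [hlink, hdV _ hx, hoV _ hx, hdV _ this.1, hoV _ this.1]
        exact this
      · intro hx
        have := hVle _ hx
        omega
      · rw [hτ' _ (by decide) (by decide), l₁]
      · intro k hk
        rw [hpr, Function.update_of_ne hk]
      · rw [hpr, Function.update_self]
        by_cases hL0 : σ.reg rMatch = 0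
        · exact .inl hL0
        · have := hst.tree.pos_mem _ hst.node_mem (hst.tree.ne_zero_of_dep_pos (by omega))
          refine .inr ⟨this.1, this.2, ?_⟩
          rw [hLd]
          exact hst.node_eq.symm
      · rw [hτ' _ (by decide) (by decide), a₁ _ (by decide) (by decide) (by decide)]
      · rw [hτ' _ (by decide) (by decide), a₁ _ (by decide) (by decide) (by decide)]
    convert hgoal using 1
    rw [hτ]
    simp [r₁, hidx, hlen, hd₁, hw₁]
end
end RAM

/-! ### The greedy factorisation and its optimality. -/

theorem IsLZ77.take_cases {w : List ℕ} {F : List (Phrase ℕ)} {m : ℕ} (h : IsLZ77 F (w.take m))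
    (hm : 1 ≤ m) (hmw : m ≤ w.length) :
    ∃ F' m', F.length = F'.length + 1 ∧ IsLZ77 F' (w.take m') ∧ (m' + 1 = m ∨
      m' < m ∧ ∃ j, 1 ≤ j ∧ j ≤ m' ∧
        EqLen (fun k => w.getD (k - 1) 0) j (m' + 1) (m - m')) := by
  generalize hu : w.take m = u at h
  have hlen : u.length = m := by simp [← hu, hmw]
  cases h with
  | nil => simp at hlen; omega
  | @free F' u' a h =>
    simp at hlen
    refine ⟨F', m - 1, by simp, ?_, .inl (by omega)⟩
    have : w.take (m - 1) = u' := by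
      rw [← Nat.min_eq_left (Nat.sub_le m 1), ← List.take_take, hu]
      simp [← hlen]
    rwa [this]
  | @copy F' u' v j h hv hj hju hdef =>
    simp at hlen
    have hv0 := List.length_pos_iff.2 hv
    have hu' : w.take u'.length = u' := by
      rw [← Nat.min_eq_left (show u'.length ≤ m by omega), ← List.take_take, hu]
      simp
    refine ⟨F', u'.length, by simp, hu'.symm ▸ h, .inr ⟨by omega, j, hj, hju, fun k hk => ?_⟩⟩
    have hw : ∀ l, l < m → w.getD l 0 = (u' ++ v).getD l 0 := by
      intro l hl
      rw [← hu]
      simp [List.getD, hl]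
    have h1 := congrArg (fun l => l.getD k 0) hdef
    simp only
    rw [show j + k - 1 = j - 1 + k by omega, show u'.length + 1 + k - 1 = u'.length + k by omega,
      hw _ (by omega), hw _ (by omega)]
    have hk : k < v.length := by omega
    simpa [List.getD, List.getElem?_append_right, hk] using h1

namespace RAM
section
variable {s : ℕ → ℕ} {N i T B M : ℕ} {V V' : Set ℕ} {σ τ : State}

/-- The table of longest previous factors is complete. -/
structure LongestPrevState (s : ℕ → ℕ) (N : ℕ) (σ : State) : Prop where
  len : σ.reg rLen = N
  word : σ.arr tWord = s
  best : ∀ k, 1 ≤ k → k ≤ N → LongestPrev s k (σ.arr tLpf k) (σ.arr tPrev k)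
  beg : ∀ k, σ.arr tBeg k = 0
  fin : ∀ k, σ.arr tEnd k = 0

theorem wp_lzLongestPrev (hs : Terminated s N) (hN : 1 ≤ N) (hsM : ∀ k, s k ≤ M)
    (hB : (2 * N + 1) * M + 4 * N + 10 ≤ B) (hMB : M ≤ B)
    (h : TrieState s N 1 V (σ.reg rMatch) (σ.setReg rI 1)) :
    Wp B lzLongestPrev σ fun t τ => t ≤ 1000 * N ∧ LongestPrevState s N τ := by
  rw [lzLongestPrev, wp_block_cons, wp_assign]
  refine ⟨by simp; omega, ?_⟩
  rw [wp_block_cons]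
  -- The initial potential is `2 * N`, at `100` units each, and every suffix costs `400` more.
  refine (Wp.loop (m := 600 * N + 210) (fun m τ => ∃ i V, TrieState s N i V (τ.reg rMatch) τ ∧
    1 ≤ i ∧ i ≤ N + 1 ∧ 100 * triePotential N i τ + 400 * (N + 1 - i) + 10 ≤ m)
    (fun _ τ => LongestPrevState s N τ) ?_ ⟨1, V, h, le_rfl, by omega, ?_⟩).mono ?_
  · clear h
    rintro m σ ⟨i, V, h, hi, hiN, hm⟩
    have hidx := h.idx
    have hlen := h.len
    refine ⟨by simp [h.idx, h.len]; omega, fun h0 => ?_, fun h0 => ⟨0, by simp; omega, ?_⟩⟩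
    · have hiN : i ≤ N := by simpa [h.idx, h.len] using h0
      have hadd := h.add_match_le hs hiN
      rw [wp_block_cons, wp_assign]
      refine ⟨by simp; omega, ?_⟩
      rw [wp_block_cons, wp_assign]
      refine ⟨by simp; omega, ?_⟩
      obtain ⟨σ₁, hσ₁⟩ : ∃ x, x = ((σ.setReg rStart (σ.reg rMatch)).setReg rGo 1) := ⟨_, rfl⟩
      have h₁ : TrieState s N i V (σ.reg rMatch) σ₁ := by
        subst hσ₁
        exact h.congr rfl rfl rfl h.node_mem h.node_eq h.node_le h.match_eq
      have hp₁ : triePotential N i σ₁ = triePotential N i σ := by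
        subst hσ₁
        rfl
      simp only [Expr.eval_reg, Expr.one_eq, Expr.eval_const]
      rw [← hσ₁, wp_block_cons]
      refine (wp_lzDescend hs hi hiN hsM hB hMB h₁ (by simp [hσ₁]) (by simp [hσ₁])
        (by simp [hσ₁])).mono ?_
      rintro t₁ σ₂ ⟨m₂, ht₁, hm₂, h₂⟩
      rw [wp_block_cons]
      refine (wp_lzInsert hs hi hiN hsM hB hMB (by omega) h₂).mono ?_
      rintro t₂ σ₃ ⟨ht₂, hp₂, V', h₃⟩
      rw [wp_block_nil]
      refine ⟨100 * triePotential N (i + 1) σ₃ + 400 * (N + 1 - (i + 1)) + 10, ?_, i + 1, V', h₃,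
        by omega, by omega, le_rfl⟩
      simp
      omega
    · have hiN : N < i := by simpa [h.idx, h.len] using h0
      exact ⟨h.len, h.word, fun k hk hkN => h.best k hk (by omega), h.beg, h.fin⟩
  · simp only [triePotential]
    omega
  · rintro t τ ⟨m', ht, hQ⟩
    rw [wp_block_nil]
    refine ⟨?_, hQ⟩
    simp
    omega

theorem getD_append_begRow (l : List ℕ) (p n k : ℕ) :
    (l ++ p :: List.replicate (n - 1) 0).getD k 0 =
      if k = l.length then p else l.getD k 0 := by
  simp only [List.getD_eq_getElem?_getD, List.getElem?_append, List.getElem?_cons]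
  split_ifs with h1 h2 h3 h4 <;> first | rfl | omega | skip
  simp [List.getElem?_replicate, h1]
  split_ifs <;> rfl

theorem getD_append_endRow (l : List ℕ) {n : ℕ} (hn : 1 ≤ n) (k : ℕ) :
    (l ++ (List.replicate (n - 1) 0 ++ [1])).getD k 0 =
      if k = l.length + n - 1 then 1 else l.getD k 0 := by
  obtain ⟨n, rfl⟩ := Nat.exists_eq_add_of_le' hn
  rw [Nat.add_sub_cancel, ← add_assoc, Nat.add_sub_cancel]
  rcases lt_or_ge k l.length with hk | hk
  · rw [if_neg (by omega), List.getD_append _ _ _ _ hk]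
  · obtain ⟨d, rfl⟩ := Nat.exists_eq_add_of_le hk
    rw [List.getD_append_right _ _ _ _ hk, Nat.add_sub_cancel_left,
      List.getD_eq_default l _ (Nat.le_add_right _ _)]
    rcases lt_trichotomy d n with h | rfl | h
    · rw [if_neg (by omega), List.getD_append _ _ _ _ (by simpa using h)]
      simp
    · rw [if_pos rfl, List.getD_append_right _ _ _ _ (by simp)]
      simp
    · rw [if_neg (by omega), List.getD_eq_default _ _ (by simp; omega)]

/-- The state of the greedy algorithm before position `i`. -/
structure GreedyState (w : List ℕ) (i : ℕ) (F : List (Phrase ℕ)) (σ : State) : Prop where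
  len : σ.reg rLen = w.length
  idx : σ.reg rI = i
  word : σ.arr tWord = fun k => if 1 ≤ k then w.getD (k - 1) 0 else 0
  best : ∀ k, 1 ≤ k → k ≤ w.length →
    LongestPrev (fun k => w.getD (k - 1) 0) k (σ.arr tLpf k) (σ.arr tPrev k)
  lz : IsLZ77 F (w.take (i - 1))
  beg_len : (F.flatMap begRow).length = i - 1
  beg : ∀ k, σ.arr tBeg (k + 1) = (F.flatMap begRow).getD k 0
  fin_len : (F.flatMap endRow).length = i - 1
  fin : ∀ k, σ.arr tEnd (k + 1) = (F.flatMap endRow).getD k 0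
  opt : ∀ F' m, i ≤ m → m ≤ w.length → IsLZ77 F' (w.take m) → F.length < F'.length
  opt' : ∀ F' m, i ≤ m + 1 → m ≤ w.length → IsLZ77 F' (w.take m) → F.length ≤ F'.length

/-- Remove the last phrase of the competitor. If what remains still covers position `i`, the bound
for `F` applies to it. Otherwise the last phrase begins at or before `i`, and its part from `i` on
is a factor longer than the longest previous one. -/
theorem GreedyState.opt_succ {w : List ℕ} {F : List (Phrase ℕ)} (h : GreedyState w i F σ)
    (hi : 1 ≤ i) (hiw : i ≤ w.length) {F' : List (Phrase ℕ)} {m : ℕ}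
    (hm : i + max 1 (σ.arr tLpf i) ≤ m) (hmw : m ≤ w.length) (hF' : IsLZ77 F' (w.take m)) :
    F.length + 1 < F'.length := by
  obtain ⟨F'', m', hlen, hF'', hm'⟩ := hF'.take_cases (by omega) hmw
  suffices i ≤ m' by
    have := h.opt F'' m' this (by omega) hF''
    omega
  by_contra hlt
  rcases hm' with rfl | ⟨hm', j, hj, hjm, he⟩
  · omega
  -- The definition is shifted by as many letters as the phrase has before position `i`.
  refine (h.best i hi hiw).max (j + (i - 1 - m')) (by omega) (by omega) fun k hk => ?_
  have := he (i - 1 - m' + k) (by omega)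
  rw [show m' + 1 + (i - 1 - m' + k) = i + k by omega, ← add_assoc] at this
  exact this

theorem GreedyState.step_free {w : List ℕ} {F : List (Phrase ℕ)} (h : GreedyState w i F σ)
    (hi : 1 ≤ i) (hiw : i ≤ w.length) (h0 : σ.arr tLpf i = 0) :
    GreedyState w (i + 1) (F ++ [.free (w.getD (i - 1) 0)]) (σ.setReg rI (i + 1)) := by
  have hmax : max 1 (σ.arr tLpf i) = 1 := by omega
  refine ⟨by simpa using h.len, by simp, h.word, h.best, ?_, ?_, fun k => ?_, ?_, fun k => ?_,
    fun F' m hm hmw hF' => ?_, fun F' m hm hmw hF' => ?_⟩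
  · have : w.take i = w.take (i - 1) ++ [w.getD (i - 1) 0] := by
      conv_lhs => rw [← Nat.sub_add_cancel hi]
      rw [List.take_succ_eq_append_getElem (by omega), List.getD_eq_getElem _ _ (by omega)]
    rw [Nat.add_sub_cancel, this]
    exact .free _ h.lz
  · simp [h.beg_len, begRow]
    omega
  · have := getD_append_begRow (F.flatMap begRow) 0 1 k
    simp only [Nat.sub_self, List.replicate_zero] at this
    simp only [List.flatMap_append, List.flatMap_cons, List.flatMap_nil, begRow, List.append_nil,
      this, State.arr_setReg, h.beg]
    split_ifs with h1
    · rw [h1, List.getD_eq_default _ _ le_rfl]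
    · rfl
  · simp [h.fin_len, endRow]
    omega
  · have := getD_append_begRow (F.flatMap endRow) 0 1 k
    simp only [Nat.sub_self, List.replicate_zero] at this
    simp only [List.flatMap_append, List.flatMap_cons, List.flatMap_nil, endRow, List.append_nil,
      this, State.arr_setReg, h.fin]
    split_ifs with h1
    · rw [h1, List.getD_eq_default _ _ le_rfl]
    · rfl
  · simpa using h.opt_succ hi hiw (by omega) hmw hF'
  · simpa using h.opt F' m (by omega) hmw hF'

theorem GreedyState.step_copy {w : List ℕ} {F : List (Phrase ℕ)} (h : GreedyState w i F σ)
    (hi : 1 ≤ i) (hiw : i ≤ w.length) {L p : ℕ} (hL : σ.arr tLpf i = L) (hp : σ.arr tPrev i = p)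
    (hL1 : 1 ≤ L) (hiL : i + L ≤ w.length + 1)
    (hτr : ∀ r, r ≠ rI → τ.reg r = σ.reg r) (hτi : τ.reg rI = i + L)
    (hτ : ∀ a, a ≠ tBeg → a ≠ tEnd → τ.arr a = σ.arr a)
    (hτb : τ.arr tBeg = Function.update (σ.arr tBeg) i p)
    (hτe : τ.arr tEnd = Function.update (σ.arr tEnd) (i + L - 1) 1) :
    GreedyState w (i + L) (F ++ [.copy p L]) τ := by
  have hmax : max 1 (σ.arr tLpf i) = L := by omega
  have hocc := (h.best i hi hiw).occ.resolve_left (by omega)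
  rw [hp, hL] at hocc
  obtain ⟨hp1, hpi, he⟩ := hocc
  refine ⟨by rw [hτr _ (by decide), h.len], hτi, by rw [hτ _ (by decide) (by decide), h.word],
    by rw [hτ _ (by decide) (by decide), hτ _ (by decide) (by decide)]; exact h.best,
    ?_, ?_, fun k => ?_, ?_, fun k => ?_,
    fun F' m hm hmw hF' => ?_, fun F' m hm hmw hF' => ?_⟩
  · have hlen : ((w.drop (i - 1)).take L).length = L := by
      simp
      omega
    have htake : w.take (i + L - 1) = w.take (i - 1) ++ (w.drop (i - 1)).take L := by
      rw [show i + L - 1 = i - 1 + L by omega, List.take_add]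
    rw [htake]
    conv => 
      congr
      rw [← hlen]
    refine .copy _ _ h.lz ?_ hp1 (by simp; omega) ?_
    · rw [← List.length_pos_iff, hlen]
      exact hL1
    · rw [← htake, hlen]
      refine List.ext_getElem (by simp; omega) fun k h1 h2 => ?_
      have hk : k < L := by simpa [hlen] using h2
      have := he k hk
      simp only at this
      rw [List.getD_eq_getElem _ _ (by omega), List.getD_eq_getElem _ _ (by omega)] at this
      simp only [List.getElem_take, List.getElem_drop]
      convert this using 2 <;> omega
  · simp [h.beg_len, begRow]
    omega
  · simp only [List.flatMap_append, List.flatMap_cons, List.flatMap_nil, begRow, List.append_nil,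
      getD_append_begRow, hτb, Function.update_apply, h.beg, h.beg_len]
    congr 1
    simp
    omega
  · simp [h.fin_len, endRow]
    omega
  · simp only [List.flatMap_append, List.flatMap_cons, List.flatMap_nil, endRow, List.append_nil,
      getD_append_endRow _ hL1, hτe, Function.update_apply, h.fin, h.fin_len]
    congr 1
    simp
    omega
  · simpa using h.opt_succ hi hiw (by omega) hmw hF'
  · simpa using h.opt F' m (by omega) hmw hF'

theorem wp_lzGreedy {w : List ℕ} (hw : w ≠ []) (hpos : ∀ a ∈ w, 1 ≤ a)
    (hB : 4 * w.length + 10 ≤ B)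
    (h : LongestPrevState (fun k => if 1 ≤ k then w.getD (k - 1) 0 else 0) w.length σ) :
    Wp B lzGreedy σ fun t τ => t ≤ 100 * w.length ∧
      ∃ F, IsLZ77 F w ∧ F.length = lzSize w ∧ τ.Stores w F := by
  have hs : Terminated (fun k => w.getD (k - 1) 0) w.length := by
    refine ⟨fun k hk hkw => ?_, by simp⟩
    rw [List.getD_eq_getElem _ _ (by omega)]
    exact hpos _ (List.getElem_mem _)
  have hN := List.length_pos_iff.2 hw
  rw [lzGreedy, wp_block_cons, wp_assign]
  refine ⟨by simp; omega, ?_⟩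
  rw [wp_block_cons]
  refine (Wp.loop (m := 50 * w.length + 10) (fun m τ => ∃ i F, GreedyState w i F τ ∧ 1 ≤ i ∧
    i ≤ w.length + 1 ∧ 50 * (w.length + 1 - i) + 10 ≤ m)
    (fun _ τ => ∃ F, IsLZ77 F w ∧ F.length = lzSize w ∧ τ.Stores w F) ?_
    ⟨1, [], ?_, le_rfl, by omega, by omega⟩).mono ?_
  · clear h
    rintro m σ ⟨i, F, h, hi, hiN, hm⟩
    have hidx := h.idx
    have hlen := h.len
    refine ⟨by simp [hidx, hlen]; omega, fun h0 => ?_, fun h0 => ⟨0, by simp; omega, F, ?_⟩⟩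
    · have hiN : i ≤ w.length := by simpa [hidx, hlen] using h0
      have hb := h.best i hi hiN
      have hle : i + σ.arr tLpf i ≤ w.length + 1 := by
        rcases hb.occ with h1 | h1
        · omega
        · exact hs.add_le h1.1 h1.2.1 hiN h1.2.2
      rw [wp_ite]
      refine ⟨by simp [hidx]; omega, fun h1 => ?_, fun h1 => ?_⟩
      · have h1 : σ.arr tLpf i ≠ 0 := by simpa [hidx] using h1
        have hp := hb.occ.resolve_left h1
        rw [wp_block_cons, wp_store]
        refine ⟨by simp [hidx]; omega, by simp [hidx]; omega, ?_⟩
        rw [wp_block_cons, wp_assign]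
        refine ⟨by simp [hidx]; omega, ?_⟩
        rw [wp_block_cons, wp_store]
        refine ⟨by simp [hidx]; omega, by simp; omega, wp_block_nil.2 ?_⟩
        refine ⟨50 * (w.length + 1 - (i + σ.arr tLpf i)) + 10, ?_, i + σ.arr tLpf i, _,
          h.step_copy hi hiN rfl rfl (by omega) hle ?_ ?_ ?_ ?_ ?_, by omega, by omega, le_rfl⟩
        · simp
          omega
        · intro r hr
          simp [hr]
        · simp [hidx]
        · intro a h1 h2
          simp [h1, h2]
        · simp [hidx]
        · simp [hidx]
      · have h1 : σ.arr tLpf i = 0 := by simpa [hidx] using h1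
        rw [wp_assign]
        refine ⟨by simp [hidx]; omega, 50 * (w.length + 1 - (i + 1)) + 10, ?_, i + 1,
          F ++ [.free (w.getD (i - 1) 0)], ?_, by omega, by omega, le_rfl⟩
        · simp
          omega
        · have := h.step_free hi hiN h1
          simp only [Expr.eval_add, Expr.eval_reg, Expr.one_eq, Expr.eval_const, hidx]
          exact this
    · have hiN : i = w.length + 1 := by
        have : w.length < i := by simpa [hidx, hlen] using h0
        omega
      have hlz := h.lz
      rw [hiN, Nat.add_sub_cancel, List.take_length] at hlz
      refine ⟨hlz, le_antisymm ?_ (lzSize_le_length_of_isLZ77 hlz), hlen, ?_, ?_, ?_⟩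
      · obtain ⟨F', hF', hlen'⟩ := exists_isLZ77_length_eq w
        rw [← hlen']
        exact h.opt' F' w.length (by omega) le_rfl (by rwa [List.take_length])
      · intro k hk
        rw [h.word]
        simp [hk]
      · intro k hk
        rw [h.beg, List.getD_eq_getElem _ _ hk]
      · intro k hk
        rw [h.fin, List.getD_eq_getElem _ _ hk]
  · refine ⟨by simpa using h.len, by simp, h.word, fun k hk hkw => ?_, by simpa using .nil,
      by simp, fun k => by simpa using h.beg _, by simp, fun k => by simpa using h.fin _, ?_, ?_⟩
    · have := h.best k hk hkw
      refine ⟨this.occ.imp_right fun h1 => ⟨h1.1, h1.2.1, fun l hl => ?_⟩, fun a ha hak he => ?_⟩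
      · have := h1.2.2 l hl
        simp only at this
        rwa [if_pos (by omega), if_pos (by omega)] at this
      · refine this.max a ha hak fun l hl => ?_
        simp only
        rw [if_pos (by omega), if_pos (by omega)]
        exact he l hl
    · intro F' m hm hmw hF'
      refine hF'.ne_nil ?_
      rw [← List.length_pos_iff]
      simp
      omega
    · intro F' m hm hmw hF'
      simp
  · rintro t τ ⟨m', ht, hQ⟩
    rw [wp_block_nil]
    refine ⟨?_, hQ⟩
    simp
    omega

/-- A program that computes a smallest LZ77 factorisation. -/
def lzProgram : Cmd := .seq lzLongestPrev lzGreedy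

/-- Memory filled with zeros already is the trie of no suffixes: the root is node `0` of depth `0`,
it has no children, and its link leads to itself. -/
theorem trieState_inputState {w : List ℕ} (hw : w ≠ []) :
    TrieState (fun k => if 1 ≤ k then w.getD (k - 1) 0 else 0) w.length 1 {0}
      ((inputState w).reg rMatch) ((inputState w).setReg rI 1) := by
  have harr : ∀ a, a ≠ tWord → ∀ k, ((inputState w).setReg rI 1).arr a k = 0 := by
    intro a ha k
    simp [inputState, ha]
  have hd : ((inputState w).setReg rI 1).arr tDep 0 = 0 := harr _ (by decide) _
  have hc : ∀ v c, childOf w.length (((inputState w).setReg rI 1).arr tChild) v c = 0 :=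
    fun v c => harr _ (by decide) _
  refine ⟨rfl, rfl, ?_, ⟨rfl, hd, ?_, ?_, ?_, ?_, ?_, ?_, ?_, ?_⟩, harr _ (by decide) _,
    harr _ (by decide) _, ?_, ?_, ?_, fun k => harr _ (by decide) _, fun k => harr _ (by decide) _,
    rfl, ?_, ?_, .inl rfl⟩
  · funext k
    simp [inputState]
  · rintro v rfl
    exact .inl rfl
  · rintro v rfl h
    exact absurd rfl h
  · rintro v rfl
    omega
  · intro a h1 h2
    omega
  · intro v _ _ c
    exact hc v c
  · intro v _ c h
    exact absurd (hc v c) h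
  · intro v _ a h1 h2
    omega
  · rintro v rfl v' rfl - -
    exact .inl rfl
  · rintro v rfl h
    exact absurd rfl h
  · intro h
    have := List.length_pos_iff.2 hw
    have h1 : w.length + 1 - 1 = 0 := h
    omega
  · intro k h1 h2
    omega
  · rw [show ((inputState w).setReg rI 1).reg rNode = 0 from rfl, hd]
    exact EqLen.zero _ _ _
  · exact hd.le

theorem computesLZ77_lzProgram : ComputesLZ77 lzProgram := by
  intro c
  -- The largest address is about `2 * N * N ^ c`, which needs the exponent `c + 1`; the `1100`
  -- covers the times `1000 * N` and `100 * N` of the two phases.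
  refine ⟨c + 1100, fun w hw hpos => ?_⟩
  have hN := List.length_pos_iff.2 hw
  have hpow : 17 * w.length ^ (c + 1) ≤ (c + 1100) * w.length ^ (c + 1100) :=
    Nat.mul_le_mul (by omega) (Nat.pow_le_pow_right hN (by omega))
  have hM : 1 ≤ w.length ^ c := Nat.one_le_pow _ _ hN
  have hsucc : w.length ^ (c + 1) = w.length * w.length ^ c := by ring
  have hNM : w.length ≤ w.length * w.length ^ c := Nat.le_mul_of_pos_right _ hM
  have hMN : w.length ^ c ≤ w.length * w.length ^ c := Nat.le_mul_of_pos_left _ hN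
  have hs : Terminated (fun k => if 1 ≤ k then w.getD (k - 1) 0 else 0) w.length := by
    refine ⟨fun k hk hkw => ?_, by simp⟩
    rw [if_pos hk, List.getD_eq_getElem _ _ (by omega)]
    exact (hpos _ (List.getElem_mem _)).1
  have hsM : ∀ k, (fun k => if 1 ≤ k then w.getD (k - 1) 0 else 0) k ≤ w.length ^ c := by
    intro k
    simp only
    split_ifs
    · rcases lt_or_ge (k - 1) w.length with h | h
      · rw [List.getD_eq_getElem _ _ h]
        exact (hpos _ (List.getElem_mem _)).2
      · rw [List.getD_eq_default _ _ h]
        omega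
    · omega
  have hB : (2 * w.length + 1) * w.length ^ c + 4 * w.length + 10 ≤
      (c + 1100) * w.length ^ (c + 1100) := by
    nlinarith
  change Wp _ lzProgram _ _
  rw [lzProgram, wp_seq]
  refine (wp_lzLongestPrev hs hN hsM hB (by omega) (trieState_inputState hw)).mono ?_
  rintro t σ ⟨ht, hσ⟩
  refine (wp_lzGreedy hw (fun a ha => (hpos a ha).1) (by omega) hσ).mono ?_
  rintro t' τ ⟨ht', h⟩
  refine ⟨?_, h⟩
  nlinarith
end
end RAM

/-! ### Factorisations and pairings stored in tables. -/

/-- The positions `i, …, m - 1` are divided into `k` factors and `f` free letters. The table `b`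
holds the beginnings of the definitions of the factors at their first positions, and `e` marks their
last positions; `R i p j` holds for every factor `i, …, p - 1` with definition at `j`. -/
inductive Seg (R : ℕ → ℕ → ℕ → Prop) (b e : ℕ → ℕ) : ℕ → ℕ → ℕ → ℕ → Prop where
  | nil (i : ℕ) : Seg R b e 0 0 i i
  | free {k f i m : ℕ} (hb : b i = 0) (he : e i = 0) (h : Seg R b e k f (i + 1) m) :
      Seg R b e k (f + 1) i m
  | fac {k f i m : ℕ} (p : ℕ) (hip : i < p) (hb : 1 ≤ b i) (hbi : b i < i)
      (hbq : ∀ q, i < q → q < p → b q = 0) (he : e (p - 1) = 1)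
      (heq : ∀ q, i ≤ q → q + 1 < p → e q = 0) (hR : R i p (b i)) (h : Seg R b e k f p m) :
      Seg R b e (k + 1) f i m

namespace Seg
variable {R R' : ℕ → ℕ → ℕ → Prop} {b e b' e' : ℕ → ℕ} {k f k' f' i m r : ℕ}

theorem add_le (h : Seg R b e k f i m) : i + k + f ≤ m := by
  induction h with
  | nil => omega
  | free => omega
  | fac => omega

theorem append (h : Seg R b e k f i m) (h' : Seg R b e k' f' m r) :
    Seg R b e (k + k') (f + f') i r := by
  induction h with
  | nil => simpa using h'
  | free hb he _ ih =>
    have := Seg.free hb he (ih h')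
    rwa [add_right_comm] at this
  | fac p hip hb hbi hbq he heq hR _ ih =>
    have := Seg.fac p hip hb hbi hbq he heq hR (ih h')
    rwa [add_right_comm] at this

/-- The relation `R` often depends on a table that changes elsewhere. It has to be transferred only
for factors inside the range whose definition lies further left and whose end is marked. -/
theorem imp (h : Seg R b e k f i m) (hbe : ∀ q, i ≤ q → q < m → b' q = b q ∧ e' q = e q)
    (hR : ∀ x p j, i ≤ x → x < p → p ≤ m → j < x → e (p - 1) = 1 → R x p j → R' x p j) :
    Seg R' b' e' k f i m := by
  induction h with
  | nil => exact .nil _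
  | @free k f i m hb he h ih =>
    have hle := h.add_le
    obtain ⟨h1, h2⟩ := hbe i le_rfl (by omega)
    exact .free (h1.trans hb) (h2.trans he) (ih (fun q hq hqm => hbe q (by omega) hqm)
      fun x p j hx => hR x p j (by omega))
  | @fac k f i m p hip hb hbi hbq he heq h2 h ih =>
    have hle := h.add_le
    have h1 := (hbe i le_rfl (by omega)).1
    refine .fac p hip (h1 ▸ hb) (h1 ▸ hbi) (fun q hq hqp => ?_) ?_ (fun q hq hqp => ?_) ?_
      (ih (fun q hq hqm => hbe q (by omega) hqm) fun x p j hx => hR x p j (by omega))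
    · rw [(hbe q (by omega) (by omega)).1, hbq q hq hqp]
    · rw [(hbe _ (by omega) (by omega)).2, he]
    · rw [(hbe q (by omega) (by omega)).2, heq q hq hqp]
    · rw [h1]
      exact hR _ _ _ le_rfl hip (by omega) hbi he h2

theorem congr (h : Seg R b e k f i m) (hbe : ∀ q, i ≤ q → q < m → b' q = b q ∧ e' q = e q) :
    Seg R b' e' k f i m := h.imp hbe fun _ _ _ _ _ _ _ _ h => h

theorem snoc_free (h : Seg R b e k f i m) (hb : b m = 0) (he : e m = 0) :
    Seg R b e k (f + 1) i (m + 1) := h.append (.free hb he (.nil _))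

theorem free_cases (h : Seg R b e k f i m) (him : i < m) (hb : b i = 0) :
    e i = 0 ∧ ∃ f', f = f' + 1 ∧ Seg R b e k f' (i + 1) m := by
  cases h with
  | nil => omega
  | free _ he h => exact ⟨he, _, rfl, h⟩
  | fac => omega

theorem fac_cases (h : Seg R b e k f i m) (him : i < m) (hb : b i ≠ 0) :
    ∃ k' p, k = k' + 1 ∧ i < p ∧ p ≤ m ∧ b i < i ∧ (∀ q, i < q → q < p → b q = 0) ∧ e (p - 1) = 1 ∧
      (∀ q, i ≤ q → q + 1 < p → e q = 0) ∧ R i p (b i) ∧ Seg R b e k' f p m := by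
  cases h with
  | nil => omega
  | free hb' => exact absurd hb' hb
  | fac p hip hb hbi hbq he heq hR h =>
    have := h.add_le
    exact ⟨_, p, rfl, hip, by omega, hbi, hbq, he, heq, hR, h⟩

theorem bounds (h : Seg R b e k f i m) : ∀ q, i ≤ q → q < m → b q ≤ q ∧ e q ≤ 1 := by
  induction h with
  | nil => omega
  | @free k f i m hb he h ih =>
    intro q hq hqm
    rcases hq.lt_or_eq with hq | rfl
    · exact ih q hq hqm
    · omega
  | @fac k f i m p hip hb hbi hbq he heq h2 h ih =>
    intro q hq hqm
    rcases lt_or_ge q p with hqp | hqp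
    · constructor
      · rcases hq.lt_or_eq with hq | rfl
        · rw [hbq q hq hqp]
          omega
        · exact hbi.le
      · rcases lt_or_ge (q + 1) p with h1 | h1
        · rw [heq q hq h1]
          omega
        · rw [show q = p - 1 by omega, he]
    · exact ih q hqp hqm

end Seg

/-- A factor is equal to its definition. -/
def CopyWord (W : ℕ → ℕ) (i p j : ℕ) : Prop := ∀ d, i + d < p → W (i + d) = W (j + d)

/-- A factor is paired as its definition, and consists of whole pairs and unpaired letters; it
begins and ends with a pair. -/
def CopyPair (pr : ℕ → ℕ) (i p j : ℕ) : Prop :=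
  j + 1 < i ∧ i + 1 < p ∧ pr j = 1 ∧ pr (p - 1) = 2 ∧ ∀ d, i + d < p → pr (i + d) = pr (j + d)

/-- A pairing of the positions `1, …, m - 1` without two consecutive unpaired positions,
except that the last position may be the first one of a pair. -/
structure PairedOpen (pr : ℕ → ℕ) (m : ℕ) : Prop where
  le_two : ∀ q, 1 ≤ q → q < m → pr q ≤ 2
  one : pr 1 ≠ 2
  pair : ∀ q, 1 ≤ q → q + 1 < m → (pr q = 1 ↔ pr (q + 1) = 2)
  none : ∀ q, 1 ≤ q → q + 1 < m → pr q = 0 → pr (q + 1) ≠ 0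

/-- A pairing of the positions `1, …, m - 1` without two consecutive unpaired positions. -/
structure Paired (pr : ℕ → ℕ) (m : ℕ) : Prop extends PairedOpen pr m where
  last : pr (m - 1) ≠ 1

theorem PairedOpen.congr {pr pr' : ℕ → ℕ} {m : ℕ} (h : PairedOpen pr m) (hm : 1 < m)
    (hpr : ∀ q, 1 ≤ q → q < m → pr' q = pr q) : PairedOpen pr' m := by
  refine ⟨fun q hq hqm => ?_, ?_, fun q hq hqm => ?_, fun q hq hqm => ?_⟩
  · rw [hpr q hq hqm]
    exact h.le_two q hq hqm
  · rw [hpr 1 le_rfl hm]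
    exact h.one
  · rw [hpr q hq (by omega), hpr _ (by omega) hqm]
    exact h.pair q hq hqm
  · rw [hpr q hq (by omega), hpr _ (by omega) hqm]
    exact h.none q hq hqm

theorem PairedOpen.mono {pr : ℕ → ℕ} {m m' : ℕ} (h : PairedOpen pr m) (hm : m' ≤ m) :
    PairedOpen pr m' :=
  ⟨fun q hq hqm => h.le_two q hq (by omega), h.one, fun q hq hqm => h.pair q hq (by omega),
    fun q hq hqm => h.none q hq (by omega)⟩

/-- Copying the pairing of the definition onto a factor. -/
theorem Paired.copy {pr pr' : ℕ → ℕ} {i p j : ℕ} (h : Paired pr i) (hj1 : 1 ≤ j)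
    (hj : j + 2 ≤ i) (hip : i < p) (hprj : pr j = 1) (hlt : ∀ q < i, pr' q = pr q)
    (hc : ∀ d, i + d < p → pr' (i + d) = pr' (j + d)) : PairedOpen pr' p := by
  have h0 := h.toPairedOpen.congr (by omega) (fun q _ hq => hlt q hq)
  have hi : pr' i = 1 := by
    have := hc 0 hip
    rwa [add_zero, add_zero, hlt j (by omega), hprj] at this
  have hl : pr' (i - 1) ≠ 1 := by
    rw [hlt _ (by omega)]
    exact h.last
  have hl2 := h0.le_two (i - 1) (by omega) (by omega)
  have key : ∀ q, 1 ≤ q → q + 1 < p → (pr' q = 1 ↔ pr' (q + 1) = 2) ∧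
      (pr' q = 0 → pr' (q + 1) ≠ 0) := by
    intro q
    induction q using Nat.strong_induction_on with
    | _ q ih =>
      intro hq hqp
      rcases lt_trichotomy (q + 1) i with h1 | h1 | h1
      -- Two neighbours before `i` are unchanged. At the junction, `i` is first in a pair and `i -
      -- 1` is not. Further right, both neighbours are pulled back into the definition, which is
      -- smaller even where it overlaps the factor.
      · exact ⟨h0.pair q hq h1, h0.none q hq h1⟩
      · have : q = i - 1 := by omega
        subst this
        rw [h1, hi]
        omega
      · obtain ⟨d, rfl⟩ := Nat.exists_eq_add_of_le (show i ≤ q by omega)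
        rw [add_assoc, hc d (by omega), hc (d + 1) (by omega), ← add_assoc]
        exact ih (j + d) (by omega) (by omega) (by omega)
  refine ⟨fun q => ?_, h0.one, fun q hq hqp => (key q hq hqp).1, fun q hq hqp => (key q hq hqp).2⟩
  induction q using Nat.strong_induction_on with
  | _ q ih =>
    intro hq hqp
    rcases lt_or_ge q i with h1 | h1
    · exact h0.le_two q hq h1
    · obtain ⟨d, rfl⟩ := Nat.exists_eq_add_of_le h1
      rw [hc d (by omega)]
      exact ih (j + d) (by omega) (by omega) (by omega)

/-- Processing a free letter at position `i`. -/
theorem Paired.snoc {pr pr' : ℕ → ℕ} {i : ℕ} (h : Paired pr i) (hi : 2 ≤ i)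
    (hlt : ∀ q, q + 1 < i → pr' q = pr q)
    (h0 : pr (i - 1) = 0 → pr' (i - 1) = 1 ∧ pr' i = 2)
    (h1 : pr (i - 1) ≠ 0 → pr' (i - 1) = pr (i - 1) ∧ pr' i = 0) : Paired pr' (i + 1) := by
  have hl := h.last
  have hl2 := h.le_two (i - 1) (by omega) (by omega)
  have hn : pr (i - 1) = 0 → pr (i - 2) ≠ 0 ∨ i = 2 := by
    intro h2
    rcases hi.lt_or_eq with hi | hi
    · refine .inl fun h3 => h.none (i - 2) (by omega) (by omega) h3 ?_
      rwa [show i - 2 + 1 = i - 1 by omega]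
    · exact .inr hi.symm
  have hp : 2 < i → (pr (i - 2) = 1 ↔ pr (i - 1) = 2) := by
    intro h2
    have := h.pair (i - 2) (by omega) (by omega)
    rwa [show i - 2 + 1 = i - 1 by omega] at this
  have ho : i = 2 → pr (i - 1) ≠ 2 := by
    rintro rfl
    exact h.one
  refine ⟨⟨fun q hq hqi => ?_, ?_, fun q hq hqi => ?_, fun q hq hqi => ?_⟩, ?_⟩
  · rcases lt_trichotomy (q + 1) i with h2 | h2 | h2
    · rw [hlt q h2]
      exact h.le_two q hq (by omega)
    · rw [show q = i - 1 by omega]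
      omega
    · rw [show q = i by omega]
      omega
  · rcases hi.lt_or_eq with hi | rfl
    · rw [hlt 1 (by omega)]
      exact h.one
    · have := h.one
      simp only [show 2 - 1 = 1 from rfl] at *
      omega
  · rcases lt_trichotomy (q + 2) i with h2 | h2 | h2
    · rw [hlt q (by omega), hlt (q + 1) (by omega)]
      exact h.pair q hq (by omega)
    · rw [hlt q (by omega), show q + 1 = i - 1 by omega, show q = i - 2 by omega]
      omega
    · rw [show q + 1 = i by omega, show q = i - 1 by omega]
      omega
  · rcases lt_trichotomy (q + 2) i with h2 | h2 | h2
    · rw [hlt q (by omega), hlt (q + 1) (by omega)]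
      exact h.none q hq (by omega)
    · rw [hlt q (by omega), show q + 1 = i - 1 by omega, show q = i - 2 by omega]
      omega
    · rw [show q + 1 = i by omega, show q = i - 1 by omega]
      omega
  · rw [Nat.add_sub_cancel]
    omega

namespace CopyWord
variable {W : ℕ → ℕ} {i p p' j : ℕ}

theorem tail (h : CopyWord W i p j) : CopyWord W (i + 1) p (j + 1) := by
  intro d hd
  rw [add_right_comm i, add_right_comm j]
  exact h (d + 1) (by omega)

/-- A definition one position to the left makes the factor a power of a single letter, so the rest
may keep that definition instead of shifting it. -/
theorem tail_of_eq (h : CopyWord W i p (i - 1)) (hi : 1 ≤ i) : CopyWord W (i + 1) p (i - 1) := by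
  intro d hd
  have h1 := h (d + 1) (by omega)
  have h2 := h d (by omega)
  rw [show i - 1 + (d + 1) = i + d by omega] at h1
  rw [add_right_comm i, ← h2, ← h1, add_assoc]

theorem mono (h : CopyWord W i p j) (hp : p' ≤ p) : CopyWord W i p' j :=
  fun d hd => h d (hd.trans_le hp)

end CopyWord

/-! ### Pairing: few letters become free. -/

namespace RAM

/-- The state while the pairing is computed: the positions before `i` are processed. -/
structure PairState (W : ℕ → ℕ) (n i k₁ f₁ k₂ f₂ : ℕ) (σ : State) : Prop where
  len : σ.reg rLen = n
  idx : σ.reg rI = i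
  two_le : 2 ≤ i
  le : i ≤ n + 1
  pre : Seg (fun x p j => CopyWord W x p j ∧ CopyPair (σ.arr tPair) x p j)
    (σ.arr tBeg) (σ.arr tEnd) k₁ f₁ 1 i
  suf : Seg (CopyWord W) (σ.arr tBeg) (σ.arr tEnd) k₂ f₂ i (n + 1)
  paired : Paired (σ.arr tPair) i

/-- Only the factorisation and the pairing are changed. -/
structure PairFrame (σ τ : State) : Prop where
  arr : ∀ a, a ≠ tBeg → a ≠ tEnd → a ≠ tPair → τ.arr a = σ.arr a
  reg : ∀ r, r ≠ rI → r ≠ rJ → τ.reg r = σ.reg r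

theorem PairFrame.refl (σ : State) : PairFrame σ σ := ⟨fun _ _ _ _ => rfl, fun _ _ _ => rfl⟩

theorem PairFrame.trans {σ τ υ : State} (h : PairFrame σ τ) (h' : PairFrame τ υ) :
    PairFrame σ υ :=
  ⟨fun a h1 h2 h3 => (h'.arr a h1 h2 h3).trans (h.arr a h1 h2 h3),
    fun r h1 h2 => (h'.reg r h1 h2).trans (h.reg r h1 h2)⟩

/-- Pair the free letter at `i` with its predecessor if that is unpaired. -/
def pairFree : Cmd := block [
  .ite ((Expr.cell tPair (xI - 1)).isEq pNone)
    (block [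
      .store tPair (xI - 1) pFirst,
      .store tPair xI pSecond])
    (.store tPair xI pNone),
  .assign rI (xI + 1)]

section
variable {W : ℕ → ℕ} {n i k₁ f₁ k₂ f₂ B : ℕ} {σ : State}

/-- Of the old marks only the one at `i - 1` can change, and only if it was unpaired. A processed
factor ends with the second letter of a pair, so neither such a factor nor its definition, which
lies to its left, is affected. -/
theorem PairState.snoc (h : PairState W n i k₁ f₁ k₂ f₂ σ) (hin : i ≤ n)
    (hb : σ.arr tBeg i = 0) {τ : State} (hF : PairFrame σ τ) (hbeg : τ.arr tBeg = σ.arr tBeg)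
    (hend : τ.arr tEnd = σ.arr tEnd) (hidx : τ.reg rI = i + 1)
    (hlt : ∀ q, q + 1 < i → τ.arr tPair q = σ.arr tPair q)
    (h0 : σ.arr tPair (i - 1) = 0 → τ.arr tPair (i - 1) = 1 ∧ τ.arr tPair i = 2)
    (h1 : σ.arr tPair (i - 1) ≠ 0 →
      τ.arr tPair (i - 1) = σ.arr tPair (i - 1) ∧ τ.arr tPair i = 0) :
    ∃ f, f₂ = f + 1 ∧ PairState W n (i + 1) k₁ (f₁ + 1) k₂ f τ := by
  obtain ⟨he, f, rfl, hsuf⟩ := h.suf.free_cases (by omega) hb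
  have hi := h.two_le
  refine ⟨f, rfl, (hF.reg _ (by decide) (by decide)).trans h.len, hidx, by omega, by omega, ?_, ?_,
    h.paired.snoc hi hlt h0 h1⟩
  · rw [hbeg, hend]
    refine (h.pre.imp (fun _ _ _ => ⟨rfl, rfl⟩) ?_).snoc_free hb he
    rintro x p j hx hxp hpi hjx he' ⟨hW, hj, hlen, hprj, hprp, hpr⟩
    have hsame : ∀ q, q < p → τ.arr tPair q = σ.arr tPair q := by
      intro q hq
      rcases lt_trichotomy (q + 1) i with h2 | h2 | h2
      · exact hlt q h2
      · rw [show q = i - 1 by omega]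
        refine (h1 fun h3 => ?_).1
        rw [show i - 1 = p - 1 by omega, hprp] at h3
        omega
      · omega
    refine ⟨hW, hj, hlen, ?_, ?_, fun d hd => ?_⟩
    · rw [hsame _ (by omega), hprj]
    · rw [hsame _ (by omega), hprp]
    · rw [hsame _ hd, hsame _ (by omega), hpr d hd]
  · rw [hbeg, hend]
    exact hsuf

theorem wp_pairFree (h : PairState W n i k₁ f₁ k₂ f₂ σ) (hin : i ≤ n)
    (hb : σ.arr tBeg i = 0) (hB : 2 * n + 10 ≤ B) :
    Wp B pairFree σ fun t τ => t ≤ 30 ∧ PairFrame σ τ ∧ τ.arr tBeg = σ.arr tBeg ∧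
      τ.arr tEnd = σ.arr tEnd ∧ (∃ f, f₂ = f + 1 ∧ PairState W n (i + 1) k₁ (f₁ + 1) k₂ f τ) ∧
      (∀ q, q + 1 < i → τ.arr tPair q = σ.arr tPair q) ∧
      (σ.arr tPair (i - 1) = 0 → τ.arr tPair (i - 1) = 1 ∧ τ.arr tPair i = 2) ∧
      (σ.arr tPair (i - 1) ≠ 0 →
        τ.arr tPair (i - 1) = σ.arr tPair (i - 1) ∧ τ.arr tPair i = 0) := by
  have hidx := h.idx
  have hi := h.two_le
  have hle := h.paired.le_two (i - 1) (by omega) (by omega)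
  have hB1 : 1 ≤ B := by omega
  rw [pairFree, wp_block_cons, wp_ite]
  refine ⟨by simp [hB1, hidx]; omega, fun hc => ?_, fun hc => ?_⟩
  · have hc : σ.arr tPair (i - 1) = 0 := by simpa [hidx] using hc
    rw [wp_block_cons, wp_store]
    refine ⟨by simp [hidx]; omega, by simp; omega, ?_⟩
    rw [wp_block_cons, wp_store]
    refine ⟨by simp [hidx]; omega, by simp; omega, wp_block_nil.2 ?_⟩
    rw [wp_block_cons, wp_assign]
    refine ⟨by simp [hidx]; omega, wp_block_nil.2 ?_⟩
    refine ⟨by simp, ?_⟩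
    simp only [Expr.eval_reg, Expr.eval_add, Expr.eval_sub, Expr.one_eq, Expr.eval_const, hidx,
      State.reg_setCell]
    obtain ⟨τ, hτ⟩ : ∃ τ, τ = (((σ.setCell tPair (i - 1) 1).setCell tPair i 2).setReg rI
      (i + 1)) := ⟨_, rfl⟩
    rw [← hτ]
    have hF : PairFrame σ τ := ⟨fun a h1 h2 h3 => by simp [hτ, h3], fun r h1 h2 => by
      simp [hτ, h1]⟩
    have h1 : τ.arr tBeg = σ.arr tBeg := by simp [hτ]
    have h2 : τ.arr tEnd = σ.arr tEnd := by simp [hτ]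
    have h3 : ∀ q, q + 1 < i → τ.arr tPair q = σ.arr tPair q := fun q hq => by
      simp [hτ, Function.update_of_ne (show q ≠ i - 1 by omega),
        Function.update_of_ne (show q ≠ i by omega)]
    have h4 : τ.arr tPair (i - 1) = 1 ∧ τ.arr tPair i = 2 := by
      simp [hτ, Function.update_of_ne (show i - 1 ≠ i by omega)]
    exact ⟨hF, h1, h2, h.snoc hin hb hF h1 h2 (by simp [hτ]) h3 (fun _ => h4)
      (fun h5 => absurd hc h5), h3, fun _ => h4, fun h5 => absurd hc h5⟩
  · have hc : σ.arr tPair (i - 1) ≠ 0 := by simpa [hidx] using hc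
    rw [wp_store]
    refine ⟨by simp [hidx]; omega, by simp, ?_⟩
    rw [wp_block_cons, wp_assign]
    refine ⟨by simp [hidx]; omega, wp_block_nil.2 ?_⟩
    refine ⟨by simp, ?_⟩
    simp only [Expr.eval_reg, Expr.eval_add, Expr.one_eq, Expr.eval_const, hidx,
      State.reg_setCell]
    obtain ⟨τ, hτ⟩ : ∃ τ, τ = ((σ.setCell tPair i 0).setReg rI (i + 1)) := ⟨_, rfl⟩
    rw [← hτ]
    have hF : PairFrame σ τ := ⟨fun a h1 h2 h3 => by simp [hτ, h3], fun r h1 h2 => by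
      simp [hτ, h1]⟩
    have h1 : τ.arr tBeg = σ.arr tBeg := by simp [hτ]
    have h2 : τ.arr tEnd = σ.arr tEnd := by simp [hτ]
    have h3 : ∀ q, q + 1 < i → τ.arr tPair q = σ.arr tPair q := fun q hq => by
      simp [hτ, Function.update_of_ne (show q ≠ i by omega)]
    have h4 : τ.arr tPair (i - 1) = σ.arr tPair (i - 1) ∧ τ.arr tPair i = 0 := by
      simp [hτ, Function.update_of_ne (show i - 1 ≠ i by omega)]
    exact ⟨hF, h1, h2, h.snoc hin hb hF h1 h2 (by simp [hτ]) h3 (fun h5 => absurd h5 hc)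
      (fun _ => h4), h3, fun h5 => absurd h5 hc, fun _ => h4⟩
end
end RAM

namespace RAM
section
variable {W : ℕ → ℕ} {n i j p k₁ f₁ k₂ f₂ B : ℕ} {σ σ₀ : State}

/-- Copy the pairing of the definition letter by letter. -/
def pairCopyLoop : Cmd := repeatUntil (block [
    .store tPair xI (.cell tPair xJ),
    .assign rI (xI + 1),
    .assign rJ (xJ + 1)])
  (.cell tEnd (xI - 1))

/-- The source stays strictly behind the target, so overlapping definitions are copied correctly:
every cell that is read already holds its final mark. -/
theorem wp_pairCopyLoop (hi : σ.reg rI = i) (hj : σ.reg rJ = j) (hj1 : 1 ≤ j) (hji : j < i)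
    (hip : i < p) (hpn : p ≤ n + 1) (hB : 2 * n + 10 ≤ B) (he : σ.arr tEnd (p - 1) = 1)
    (heq : ∀ q, i ≤ q → q + 1 < p → σ.arr tEnd q = 0)
    (hpr : ∀ q, 1 ≤ q → q < i → σ.arr tPair q ≤ 2) :
    Wp B pairCopyLoop σ fun t τ => t ≤ 40 * (p - i) ∧ τ.reg rI = p ∧ PairFrame σ τ ∧
      τ.arr tBeg = σ.arr tBeg ∧ τ.arr tEnd = σ.arr tEnd ∧
      (∀ q < i, τ.arr tPair q = σ.arr tPair q) ∧
      ∀ d, i + d < p → τ.arr tPair (i + d) = τ.arr tPair (j + d) := by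
  have hB1 : 1 ≤ B := by omega
  refine (Wp.repeatUntil (m := 40 * (p - i)) hB1 (fun m τ => ∃ q, i ≤ q ∧ q < p ∧ τ.reg rI = q ∧
    τ.reg rJ + i = j + q ∧ 40 * (p - q) ≤ m ∧ PairFrame σ τ ∧
    τ.arr tBeg = σ.arr tBeg ∧ τ.arr tEnd = σ.arr tEnd ∧
    (∀ x < i, τ.arr tPair x = σ.arr tPair x) ∧ (∀ x, 1 ≤ x → x < q → τ.arr tPair x ≤ 2) ∧
    ∀ d, i + d < q → τ.arr tPair (i + d) = τ.arr tPair (j + d))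
    (fun _ τ => τ.reg rI = p ∧ PairFrame σ τ ∧
      τ.arr tBeg = σ.arr tBeg ∧ τ.arr tEnd = σ.arr tEnd ∧
      (∀ q < i, τ.arr tPair q = σ.arr tPair q) ∧
      ∀ d, i + d < p → τ.arr tPair (i + d) = τ.arr tPair (j + d)) ?_
    ⟨i, le_rfl, hip, hi, by omega, le_rfl, PairFrame.refl σ, rfl, rfl, fun _ _ => rfl, hpr,
      by omega⟩).mono ?_
  · rintro m τ ⟨q, hiq, hqp, hq, hqj, hm, hF, hbeg, hend, hlt, hle, hc⟩
    have hJ : 1 ≤ τ.reg rJ ∧ τ.reg rJ < q := by omega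
    have hpJ := hle _ hJ.1 hJ.2
    rw [wp_block_cons, wp_store]
    refine ⟨by simp [hq]; omega, by simp; omega, ?_⟩
    rw [wp_block_cons, wp_assign]
    refine ⟨by simp [hq]; omega, ?_⟩
    rw [wp_block_cons, wp_assign]
    refine ⟨by simp; omega, wp_block_nil.2 ?_⟩
    simp only [Expr.eval_reg, Expr.eval_add, Expr.one_eq, Expr.eval_const, hq,
      State.reg_setCell, Expr.eval_cell]
    obtain ⟨υ, hυ⟩ : ∃ υ, υ = ((τ.setCell tPair q (τ.arr tPair (τ.reg rJ))).setReg rI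
      (q + 1)).setReg rJ (τ.reg rJ + 1) := ⟨_, rfl⟩
    have hυ' : (((τ.setCell tPair q (τ.arr tPair (τ.reg rJ))).setReg rI (q + 1)).setReg rJ
      (((τ.setCell tPair q (τ.arr tPair (τ.reg rJ))).setReg rI (q + 1)).reg rJ + 1)) = υ := by
      simp [hυ]
    rw [hυ']
    have r1 : υ.reg rI = q + 1 := by simp [hυ]
    have r2 : υ.reg rJ = τ.reg rJ + 1 := by simp [hυ]
    have h1 : υ.arr tBeg = σ.arr tBeg := by simp [hυ, hbeg]
    have h2 : υ.arr tEnd = σ.arr tEnd := by simp [hυ, hend]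
    have h3 : ∀ x, x ≠ q → υ.arr tPair x = τ.arr tPair x := fun x hx => by
      simp [hυ, Function.update_of_ne hx]
    have h4 : υ.arr tPair q = τ.arr tPair (τ.reg rJ) := by simp [hυ]
    have hF' : PairFrame σ υ := hF.trans ⟨fun a h1 h2 h3 => by simp [hυ, h3],
      fun r h1 h2 => by simp [hυ, h1, h2]⟩
    have hlt' : ∀ x < i, υ.arr tPair x = σ.arr tPair x := fun x hx => by
      rw [h3 x (by omega), hlt x hx]
    have hc' : ∀ d, i + d < q + 1 → υ.arr tPair (i + d) = υ.arr tPair (j + d) := by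
      intro d hd
      rw [h3 (j + d) (by omega)]
      by_cases hdq : i + d = q
      · rw [hdq, h4]
        congr 1
        omega
      · rw [h3 _ hdq]
        exact hc d (by omega)
    have heB : υ.arr tEnd q ≤ 1 := by
      rw [h2]
      rcases lt_or_ge (q + 1) p with h | h
      · rw [heq q hiq h]
        omega
      · rw [show q = p - 1 by omega, he]
    refine ⟨by simp [r1]; omega, m - 25, by simp; omega, fun h0 => ?_, fun h0 => ?_⟩
    · have h0 : σ.arr tEnd q = 0 := by simpa [r1, h2] using h0
      have hqp' : q + 1 < p := by
        by_contra hn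
        rw [show q = p - 1 by omega, he] at h0
        omega
      refine ⟨q + 1, by omega, hqp', r1, by omega, by omega, hF', h1, h2, hlt', ?_, hc'⟩
      intro x hx hxq
      by_cases hxq' : x = q
      · rw [hxq', h4]
        exact hpJ
      · rw [h3 x hxq']
        exact hle x hx (by omega)
    · have h0 : σ.arr tEnd q ≠ 0 := by simpa [r1, h2] using h0
      have hqp' : q + 1 = p := by
        by_contra hn
        exact h0 (heq q hiq (by omega))
      subst hqp'
      exact ⟨r1, hF', h1, h2, hlt', hc'⟩
  · rintro t τ ⟨m, hm, h⟩
    exact ⟨by omega, h⟩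

/-- Cut off letters at the end of a factor until it ends with a pair. -/
def pairCutLoop : Cmd := .loop ((Expr.cell tPair (xI - 1)).isNe pSecond) (block [
  .assign rI (xI - 1),
  .store tEnd (xI - 1) 1,
  .store tEnd xI 0,
  .store tPair xI pNone])

/-- At most two letters are cut off: possibly one that is first in a pair cut by the end of the
factor, and possibly an unpaired one before it. The letter before an unpaired one is neither
unpaired nor first in a pair, so it is second. The pair at `i` stops the loop at the latest. -/
theorem wp_pairCutLoop (hp : σ.reg rI = p) (hpr : PairedOpen (σ.arr tPair) p) (hi : 1 ≤ i)
    (hip : i + 2 ≤ p) (hpi : σ.arr tPair (i + 1) = 2) (hpn : p ≤ n + 1) (hB : 2 * n + 10 ≤ B)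
    (he : σ.arr tEnd (p - 1) = 1) (heq : ∀ q, i ≤ q → q + 1 < p → σ.arr tEnd q = 0) :
    Wp B pairCutLoop σ fun t τ => t ≤ 130 ∧ ∃ q, τ.reg rI = q ∧ i + 2 ≤ q ∧ q ≤ p ∧ p ≤ q + 2 ∧
      σ.arr tPair (q - 1) = 2 ∧ PairFrame σ τ ∧
      τ.arr tBeg = σ.arr tBeg ∧ (∀ x < q, τ.arr tPair x = σ.arr tPair x) ∧
      (∀ x, x < i ∨ p ≤ x → τ.arr tEnd x = σ.arr tEnd x) ∧ τ.arr tEnd (q - 1) = 1 ∧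
      ∀ x, i ≤ x → x < p → x ≠ q - 1 → τ.arr tEnd x = 0 := by
  have hB1 : 1 ≤ B := by omega
  refine (Wp.loop (m := 130) (fun m τ => ∃ q, τ.reg rI = q ∧ i + 2 ≤ q ∧ q ≤ p ∧
      (q = p ∨ q + 1 = p ∧ σ.arr tPair q ≠ 2 ∨ q + 2 = p ∧ σ.arr tPair q = 0) ∧
      40 * (2 - (p - q)) + 20 ≤ m ∧ PairFrame σ τ ∧
      τ.arr tBeg = σ.arr tBeg ∧ (∀ x < q, τ.arr tPair x = σ.arr tPair x) ∧
      (∀ x, x < i ∨ p ≤ x → τ.arr tEnd x = σ.arr tEnd x) ∧ τ.arr tEnd (q - 1) = 1 ∧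
      ∀ x, i ≤ x → x < p → x ≠ q - 1 → τ.arr tEnd x = 0)
    (fun _ τ => ∃ q, τ.reg rI = q ∧ i + 2 ≤ q ∧ q ≤ p ∧ p ≤ q + 2 ∧
      σ.arr tPair (q - 1) = 2 ∧ PairFrame σ τ ∧
      τ.arr tBeg = σ.arr tBeg ∧ (∀ x < q, τ.arr tPair x = σ.arr tPair x) ∧
      (∀ x, x < i ∨ p ≤ x → τ.arr tEnd x = σ.arr tEnd x) ∧ τ.arr tEnd (q - 1) = 1 ∧
      ∀ x, i ≤ x → x < p → x ≠ q - 1 → τ.arr tEnd x = 0) ?_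
    ⟨p, hp, hip, le_rfl, .inl rfl, by omega, PairFrame.refl σ, rfl, fun _ _ => rfl,
      fun _ _ => rfl, he, fun x hx hxp hne => heq x hx (by omega)⟩).mono ?_
  · rintro m τ ⟨q, hq, hiq, hqp, hcase, hm, hF, hbeg, hlt, hout, hqe, hin⟩
    have hq1 : τ.arr tPair (q - 1) = σ.arr tPair (q - 1) := hlt _ (by omega)
    have hle := hpr.le_two (q - 1) (by omega) (by omega)
    refine ⟨by simp [hB1, hq, hq1]; omega, fun h0 => ?_, fun h0 => ?_⟩
    · have h0 : σ.arr tPair (q - 1) ≠ 2 := by simpa [hq, hq1] using h0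
      have hne : q ≠ i + 2 := by
        rintro rfl
        exact h0 hpi
      have hpair := hpr.pair (q - 2) (by omega) (by omega)
      have hnone := hpr.none (q - 2) (by omega) (by omega)
      rw [show q - 2 + 1 = q - 1 by omega] at hpair hnone
      have hpair' : q < p → (σ.arr tPair (q - 1) = 1 ↔ σ.arr tPair q = 2) := fun h => by
        have := hpr.pair (q - 1) (by omega) (by omega)
        rwa [show q - 1 + 1 = q by omega] at this
      have hnone' : q < p → σ.arr tPair (q - 1) = 0 → σ.arr tPair q ≠ 0 := fun h => by
        have := hpr.none (q - 1) (by omega) (by omega)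
        rwa [show q - 1 + 1 = q by omega] at this
      rw [wp_block_cons, wp_assign]
      refine ⟨by simp [hq]; omega, ?_⟩
      rw [wp_block_cons, wp_store]
      refine ⟨by simp [hq]; omega, by simp; omega, ?_⟩
      rw [wp_block_cons, wp_store]
      refine ⟨by simp [hq]; omega, by simp, ?_⟩
      rw [wp_block_cons, wp_store]
      refine ⟨by simp [hq]; omega, by simp, wp_block_nil.2 ?_⟩
      simp only [Expr.eval_reg, Expr.eval_sub, Expr.one_eq, Expr.zero_eq, Expr.eval_const, hq,
        State.reg_setCell, State.reg_setReg, if_true]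
      obtain ⟨υ, hυ⟩ : ∃ υ, υ = ((((τ.setReg rI (q - 1)).setCell tEnd (q - 1 - 1) 1).setCell tEnd
        (q - 1) 0).setCell tPair (q - 1) 0) := ⟨_, rfl⟩
      rw [← hυ]
      have he' : ∀ x, x ≠ q - 1 - 1 → x ≠ q - 1 → υ.arr tEnd x = τ.arr tEnd x := by
        intro x h1 h2
        simp [hυ, Function.update_of_ne h1, Function.update_of_ne h2]
      refine ⟨m - 35, by simp; omega, q - 1, by simp, by omega, by omega, ?_, by omega,
        hF.trans ⟨fun a h1 h2 h3 => by simp [hυ, h2, h3], fun r h1 h2 => by simp [hυ, h1]⟩,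
        by simp [hυ, hbeg], fun x hx => ?_, fun x hx => ?_, ?_, fun x hx hxp hne => ?_⟩
      · rcases hcase with h | ⟨h1, h2⟩ | ⟨h1, h2⟩
        · exact .inr (.inl ⟨by omega, h0⟩)
        · have := hpair' (by omega)
          refine .inr (.inr ⟨by omega, ?_⟩)
          omega
        · have := hpair' (by omega)
          have := hnone' (by omega)
          omega
      · rw [← hlt x (by omega)]
        simp [hυ, Function.update_of_ne (show x ≠ q - 1 by omega)]
      · rw [he' x (by omega) (by omega), hout x hx]
      · simp [hυ, Function.update_of_ne (show q - 1 - 1 ≠ q - 1 by omega)]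
      · by_cases hx' : x = q - 1
        · rw [hx']
          simp [hυ]
        · rw [he' x hne hx', hin x hx hxp hx']
    · have h0 : σ.arr tPair (q - 1) = 2 := by simpa [hq, hq1] using h0
      exact ⟨0, by simp; omega, q, hq, hiq, hqp, by omega, h0, hF, hbeg, hlt, hout, hqe, hin⟩
  · rintro t τ ⟨m, hm, h⟩
    exact ⟨by omega, h⟩

/-- Copy the pairing of the definition onto the factor that begins at `i`, and shorten it. -/
def pairGood : Cmd := block [.assign rJ (.cell tBeg xI), pairCopyLoop, pairCutLoop]

theorem _root_.Seg.of_zero {R : ℕ → ℕ → ℕ → Prop} {b e : ℕ → ℕ} {q p : ℕ} (hqp : q ≤ p)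
    (h : ∀ x, q ≤ x → x < p → b x = 0 ∧ e x = 0) : Seg R b e 0 (p - q) q p := by
  induction p, hqp using Nat.le_induction with
  | base => simpa using Seg.nil q
  | succ p hp ih =>
    have := (ih fun x hx hxp => h x hx (by omega)).snoc_free (h p hp (by omega)).1
      (h p hp (by omega)).2
    rwa [Nat.sub_add_comm hp]

theorem wp_pairGood (h : PairState W n i k₁ f₁ k₂ f₂ σ) (hin : i ≤ n) (hb : σ.arr tBeg i ≠ 0)
    (hbi : σ.arr tBeg i + 2 ≤ i) (hpb : σ.arr tPair (σ.arr tBeg i) = 1) (hB : 2 * n + 10 ≤ B)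
    (hone : σ.arr tEnd i = 0) :
    Wp B pairGood σ fun t τ => PairFrame σ τ ∧ ∃ q k f, t + 60 ≤ 200 * (q - i) ∧ k₂ = k + 1 ∧
      f ≤ f₂ + 2 ∧ i < q ∧ PairState W n q (k₁ + 1) f₁ k f τ := by
  obtain ⟨k, p, rfl, hip, hpn, -, hbq, he, heq, hW, hsuf⟩ := h.suf.fac_cases (by omega) hb
  have hidx := h.idx
  have hi2 := h.two_le
  have hip' : i + 1 < p := by
    by_contra hn
    rw [show p - 1 = i by omega] at he
    omega
  rw [pairGood, wp_block_cons, wp_assign]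
  refine ⟨by simp [hidx]; omega, ?_⟩
  rw [wp_block_cons]
  simp only [Expr.eval_cell, Expr.eval_reg, hidx]
  refine (wp_pairCopyLoop (n := n) (i := i) (p := p) (j := σ.arr tBeg i) (by simpa using hidx)
    (by simp) (by omega) (by omega) hip hpn hB (by simpa using he) (by simpa using heq)
    (by simpa using fun q h1 h2 => h.paired.le_two q h1 h2)).mono ?_
  rintro t₁ σ₁ ⟨ht₁, hr₁, hF₁, hb₁, he₁, hlt₁, hc₁⟩
  have hF₀ : PairFrame σ (σ.setReg rJ (σ.arr tBeg i)) :=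
    ⟨fun _ _ _ _ => rfl, fun r _ h2 => by simp [h2]⟩
  replace hF₁ := hF₀.trans hF₁
  simp only [State.arr_setReg] at hb₁ he₁ hlt₁
  have hpr₁ := h.paired.copy (by omega) hbi hip hpb hlt₁ hc₁
  have h1 : σ₁.arr tPair i = 1 := by
    have := hc₁ 0 hip
    rwa [add_zero, add_zero, hlt₁ (σ.arr tBeg i) (by omega), hpb] at this
  -- The factor begins with a complete pair, so it survives the cutting with at least two letters.
  have h2 := (hpr₁.pair i (by omega) hip').1 h1
  rw [wp_block_cons]
  refine (wp_pairCutLoop (n := n) hr₁ hpr₁ (by omega) hip' h2 hpn hB (by rwa [he₁])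
    (by rwa [he₁])).mono ?_
  rintro t₂ τ ⟨ht₂, q, hq, hiq, hqp, hpq, hpq2, hF₂, hb₂, hlt₂, hout₂, heq₂, hin₂⟩
  have hF := hF₁.trans hF₂
  rw [wp_block_nil]
  refine ⟨hF, q, k, (p - q) + f₂, by simp; omega, rfl, by omega, by omega,
    (hF.reg _ (by decide) (by decide)).trans h.len, hq, by omega, by omega, ?_, ?_, ?_⟩
  · have hbeg : τ.arr tBeg = σ.arr tBeg := hb₂.trans hb₁
    have hpre : Seg (fun x p j => CopyWord W x p j ∧ CopyPair (τ.arr tPair) x p j)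
        (τ.arr tBeg) (τ.arr tEnd) k₁ f₁ 1 i := by
      refine h.pre.imp (fun x hx hxi => ⟨by rw [hbeg], ?_⟩) ?_
      · rw [hout₂ x (.inl hxi), he₁]
      · rintro x p' j hx hxp hpi hjx he' ⟨hW', hj, hlen, hprj, hprp, hpr⟩
        have hsame : ∀ y < i, τ.arr tPair y = σ.arr tPair y := fun y hy => by
          rw [hlt₂ y (by omega), hlt₁ y hy]
        refine ⟨hW', hj, hlen, ?_, ?_, fun d hd => ?_⟩
        · rw [hsame _ (by omega), hprj]
        · rw [hsame _ (by omega), hprp]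
        · rw [hsame _ (by omega), hsame _ (by omega), hpr d hd]
    refine hpre.append (f' := 0) (k' := 1) (.fac q (by omega) ?_ ?_ ?_ heq₂ ?_ ⟨?_, ?_⟩ (.nil _))
    · rw [hbeg]
      omega
    · rw [hbeg]
      omega
    · intro x hx hxq
      rw [hbeg, hbq x hx (by omega)]
    · intro x hx hxq
      exact hin₂ x hx (by omega) (by omega)
    · rw [hbeg]
      exact hW.mono hqp
    · rw [hbeg]
      refine ⟨by omega, by omega, ?_, ?_, fun d hd => ?_⟩
      · rw [hlt₂ _ (by omega), hlt₁ _ (by omega), hpb]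
      · rw [hlt₂ _ (by omega), hpq2]
      · rw [hlt₂ _ hd, hlt₂ _ (by omega), hc₁ d (by omega)]
  · have hbeg : τ.arr tBeg = σ.arr tBeg := hb₂.trans hb₁
    have h3 : Seg (CopyWord W) (τ.arr tBeg) (τ.arr tEnd) 0 (p - q) q p :=
      Seg.of_zero hqp fun x hx hxp => ⟨by rw [hbeg, hbq x (by omega) hxp],
        hin₂ x (by omega) hxp (by omega)⟩
    have h4 := h3.append (hsuf.congr (b' := τ.arr tBeg) (e' := τ.arr tEnd) fun x hx hxn =>
      ⟨by rw [hbeg], by rw [hout₂ x (.inr hx), he₁]⟩)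
    rwa [Nat.zero_add] at h4
  · refine ⟨(hpr₁.mono hqp).congr (by omega) fun x hx hxq => hlt₂ x hxq, ?_⟩
    rw [hlt₂ _ (by omega), hpq2]
    omega

/-- The first letters of the factor at `i` become free at most `2 - δ` times. -/
def PairStage (δ i : ℕ) (b pr : ℕ → ℕ) : Prop :=
  δ = 0 ∨ b i ≠ 0 ∧ b i + 2 ≤ i ∧
    (δ = 1 ∧ (pr (b i) = 1 ∨ pr (b i + 1) = 1 ∨
      b i + 2 = i ∧ pr (b i) = 2 ∧ pr (b i + 1) = 0) ∨
    δ = 2 ∧ pr (b i) = 1)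

/-- A definition at `i - 1` stays there, and processing `i` makes its first two marks either begin a
pair or be second and unpaired. If the definition does not begin with a pair, shift it by one
letter. The new first letter is first in a pair, or it is unpaired; then the letter after it is
first in a pair, or it is the letter at `i - 1`, which is paired with `i` right now. Hence after two
freed letters the definition begins with a pair. -/
theorem PairStage.next {δ : ℕ} {b b' pr pr' : ℕ → ℕ} (h : PairStage δ i b pr)
    (hpr : Paired pr i) (hi : 2 ≤ i) (hb : b i ≠ 0) (hbi : b i < i)
    (hb' : b i = i - 1 ∧ b' (i + 1) = i - 1 ∨ b i + 2 ≤ i ∧ pr (b i) ≠ 1 ∧ b' (i + 1) = b i + 1)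
    (hlt : ∀ q, q + 1 < i → pr' q = pr q)
    (h0 : pr (i - 1) = 0 → pr' (i - 1) = 1 ∧ pr' i = 2)
    (h1 : pr (i - 1) ≠ 0 → pr' (i - 1) = pr (i - 1) ∧ pr' i = 0) :
    PairStage (δ + 1) (i + 1) b' pr' := by
  have hl := hpr.last
  have hl2 := hpr.le_two (i - 1) (by omega) (by omega)
  refine .inr ?_
  rcases hb' with ⟨hbi', hb'⟩ | ⟨hbi', hj, hb'⟩
  · rcases h with rfl | h
    · rw [hb', show i - 1 + 1 = i by omega]
      refine ⟨by omega, by omega, .inl ⟨rfl, ?_⟩⟩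
      by_cases h3 : pr (i - 1) = 0
      · exact .inl (h0 h3).1
      · have := h1 h3
        exact .inr (.inr ⟨by omega, by omega, this.2⟩)
    · omega
  · rw [hb']
    refine ⟨by omega, by omega, ?_⟩
    obtain ⟨j, hj'⟩ : ∃ j, j = b i := ⟨_, rfl⟩
    rw [PairStage, ← hj'] at h
    rw [← hj'] at hbi' hj hbi hb ⊢
    have hj2 := hpr.le_two j (by omega) hbi
    have hj3 := hpr.le_two (j + 1) (by omega) (by omega)
    have hp1 := hpr.pair j (by omega) (by omega)
    have hn1 := hpr.none j (by omega) (by omega)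
    have key : pr (j + 1) = 1 → pr' (j + 1) = 1 := fun h => by
      rcases hbi'.lt_or_eq with h' | h'
      · rw [hlt _ (by omega), h]
      -- Here `j + 1` is the last processed position, which is never first in a pair.
      · exact absurd h (by rwa [show j + 1 = i - 1 by omega])
    have key2 : j + 2 = i → pr (j + 1) = 0 → pr' (j + 1) = 1 := fun h h' => by
      rw [show j + 1 = i - 1 by omega] at h' ⊢
      exact (h0 h').1
    rcases h with rfl | ⟨-, -, ⟨rfl, h⟩ | ⟨rfl, h⟩⟩
    · refine .inl ⟨rfl, ?_⟩
      by_cases h4 : pr (j + 1) = 1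
      · exact .inl (key h4)
      · have h5 : pr (j + 1) = 0 := by omega
        rcases hbi'.lt_or_eq with h' | h'
        · have hp2 := hpr.pair (j + 1) (by omega) (by omega)
          have hn2 := hpr.none (j + 1) (by omega) (by omega)
          have hj4 := hpr.le_two (j + 2) (by omega) (by omega)
          have h6 : pr (j + 2) = 1 := by
            simp only [add_assoc, Nat.reduceAdd] at hp2 hn2
            omega
          refine .inr (.inl ?_)
          have : j + 2 ≠ i - 1 := fun h => hl (by rwa [← h])
          rw [show j + 1 + 1 = j + 2 from rfl, hlt _ (by omega), h6]
        · exact .inl (key2 h' h5)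
    · refine .inr ⟨rfl, ?_⟩
      rcases h with h | h | ⟨h, -, h'⟩
      · exact absurd h hj
      · exact key h
      · exact key2 h h'
    · exact absurd h hj

theorem _root_.Seg.split_first {b e b' : ℕ → ℕ} {k f m : ℕ} (h : Seg (CopyWord W) b e k f i m)
    (him : i < m) (hb : b i ≠ 0) (he : e i = 0) (hb' : ∀ q, i + 1 < q → b' q = b q)
    (hbi : b' i = 0) (hb1 : 1 ≤ b' (i + 1)) (hb2 : b' (i + 1) ≤ i)
    (hj : ∀ p, CopyWord W i p (b i) → CopyWord W (i + 1) p (b' (i + 1))) :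
    Seg (CopyWord W) b' e k (f + 1) i m := by
  obtain ⟨k, p, rfl, hip, hpm, -, hbq, hep, heq, hW, h'⟩ := h.fac_cases him hb
  have hip' : i + 1 < p := by
    by_contra hn
    rw [show p - 1 = i by omega] at hep
    omega
  exact .free hbi he (.fac p hip' hb1 (by omega)
    (fun q hq hqp => by rw [hb' q hq, hbq q (by omega) hqp]) hep
    (fun q hq hqp => heq q (by omega) hqp) (hj p hW)
    (h'.congr fun q hq hqm => ⟨hb' q (by omega), rfl⟩))

theorem _root_.Seg.free_first {b e b' e' : ℕ → ℕ} {k f m : ℕ} (h : Seg (CopyWord W) b e k f i m)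
    (him : i < m) (hb : b i ≠ 0) (he : e i ≠ 0) (hb' : ∀ q, i < q → b' q = b q ∧ e' q = e q)
    (hbi : b' i = 0) (hei : e' i = 0) :
    ∃ k', k = k' + 1 ∧ Seg (CopyWord W) b' e' k' (f + 1) i m := by
  obtain ⟨k, p, rfl, hip, hpm, -, hbq, hep, heq, hW, h'⟩ := h.fac_cases him hb
  have hip' : p = i + 1 := by
    by_contra hn
    exact he (heq i le_rfl (by omega))
  subst hip'
  exact ⟨k, rfl, .free hbi hei (h'.congr fun q hq hqm => hb' q (by omega))⟩

/-- The first letter at `i` becomes free, or the factor at `i` is processed. -/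
def pairFactor : Cmd := when (.cell tBeg xI) (
  .ite (.cell tEnd xI)
    (block [
      .store tBeg xI 0,
      .store tEnd xI 0]) (
  .ite ((Expr.cell tBeg xI).isEq (xI - 1))
    (block [
      .store tBeg (xI + 1) (xI - 1),
      .store tBeg xI 0]) (
  .ite ((Expr.cell tPair (.cell tBeg xI)).isNe pFirst)
    (block [
      .store tBeg (xI + 1) (.cell tBeg xI + 1),
      .store tBeg xI 0])
    pairGood)))

/-- The factorisation changes before position `i`, but not before `i`. -/
theorem PairState.of_first {k₂' f₂' : ℕ} (h : PairState W n i k₁ f₁ k₂ f₂ σ) {τ : State}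
    (hF : PairFrame σ τ) (hidx : τ.reg rI = i) (hpr : τ.arr tPair = σ.arr tPair)
    (hlt : ∀ q < i, τ.arr tBeg q = σ.arr tBeg q ∧ τ.arr tEnd q = σ.arr tEnd q)
    (hsuf : Seg (CopyWord W) (τ.arr tBeg) (τ.arr tEnd) k₂' f₂' i (n + 1)) :
    PairState W n i k₁ f₁ k₂' f₂' τ :=
  ⟨(hF.reg _ (by decide) (by decide)).trans h.len, hidx, h.two_le, h.le,
    by rw [hpr]; exact h.pre.congr fun q _ hq => hlt q hq, hsuf, by rw [hpr]; exact h.paired⟩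

/-- Each factor carries a credit of `4` for the letters it may set free, and `δ` is what its front
has used so far. Freeing a letter at the front keeps `f₂ + 4 * k₂ - δ`; a good factor frees at most
two more letters and gives up its whole credit, which suffices as `δ ≤ 2`. When `i` itself becomes
free it is not paired yet, so the next stage is asserted for any marks that follow the rule for free
letters. -/
theorem wp_pairFactor {δ : ℕ} (h : PairState W n i k₁ f₁ k₂ f₂ σ) (hin : i ≤ n)
    (hδ : PairStage δ i (σ.arr tBeg) (σ.arr tPair)) (hB : 2 * n + 10 ≤ B) :
    Wp B pairFactor σ fun t τ => PairFrame σ τ ∧ ∃ q k₁' k₂' f₂',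
      PairState W n q k₁' f₁ k₂' f₂' τ ∧ k₁' + k₂' ≤ k₁ + k₂ ∧
      (q = i ∧ t ≤ 100 ∧ τ.arr tBeg i = 0 ∧ (∃ δ', f₂' + 4 * k₂' + δ ≤ f₂ + 4 * k₂ + δ' ∧ (δ' = 0 ∨ k₂' ≠ 0) ∧
          ∀ pr', (∀ q, q + 1 < i → pr' q = τ.arr tPair q) →
            (τ.arr tPair (i - 1) = 0 → pr' (i - 1) = 1 ∧ pr' i = 2) →
            (τ.arr tPair (i - 1) ≠ 0 → pr' (i - 1) = τ.arr tPair (i - 1) ∧ pr' i = 0) →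
            PairStage δ' (i + 1) (τ.arr tBeg) pr') ∨
        i < q ∧ t + 25 ≤ 200 * (q - i) ∧ f₂' + 4 * k₂' + δ ≤ f₂ + 4 * k₂) := by
  have hidx := h.idx
  have hi := h.two_le
  have hB1 : 1 ≤ B := by omega
  have hδ2 : δ ≤ 2 := by
    rcases hδ with h | ⟨-, -, ⟨h, -⟩ | ⟨h, -⟩⟩ <;> omega
  have hbd := h.suf.bounds i le_rfl (by omega)
  rw [pairFactor, wp_when]
  refine ⟨by simp [hidx]; omega, fun hc => ?_, fun hc => ?_⟩
  swap
  · have hc : σ.arr tBeg i = 0 := by simpa [hidx] using hc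
    refine ⟨PairFrame.refl σ, i, k₁, k₂, f₂, h, le_rfl, .inl ⟨rfl, by simp, hc, 0, ?_, .inl rfl,
      fun _ _ _ _ => .inl rfl⟩⟩
    rcases hδ with h | h <;> omega
  have hc : σ.arr tBeg i ≠ 0 := by simpa [hidx] using hc
  obtain ⟨hk₂, hbi⟩ : k₂ ≠ 0 ∧ σ.arr tBeg i < i := by
    obtain ⟨-, -, rfl, -, -, h, -⟩ := h.suf.fac_cases (by omega) hc
    exact ⟨by omega, h⟩
  rw [wp_ite]
  refine ⟨by simp [hidx]; omega, fun h1 => ?_, fun h1 => ?_⟩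
  · have h1 : σ.arr tEnd i ≠ 0 := by simpa [hidx] using h1
    rw [wp_block_cons, wp_store]
    refine ⟨by simp [hidx]; omega, by simp, ?_⟩
    rw [wp_block_cons, wp_store]
    refine ⟨by simp [hidx]; omega, by simp, wp_block_nil.2 ?_⟩
    simp only [Expr.eval_reg, Expr.zero_eq, Expr.eval_const, hidx, State.reg_setCell]
    obtain ⟨τ, hτ⟩ : ∃ τ, τ = (σ.setCell tBeg i 0).setCell tEnd i 0 := ⟨_, rfl⟩
    rw [← hτ]
    have hF : PairFrame σ τ := ⟨fun a h1 h2 h3 => by simp [hτ, h1, h2], fun r h1 h2 => by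
      simp [hτ]⟩
    have hq : ∀ q, q ≠ i → τ.arr tBeg q = σ.arr tBeg q ∧ τ.arr tEnd q = σ.arr tEnd q :=
      fun q hq => by simp [hτ, Function.update_of_ne hq]
    have hb0 : τ.arr tBeg i = 0 := by simp [hτ]
    obtain ⟨k, rfl, hsuf⟩ := h.suf.free_first (by omega) hc h1 (fun q hiq => hq q (by omega)) hb0
      (e' := τ.arr tEnd) (by simp [hτ])
    exact ⟨hF, i, k₁, k, f₂ + 1, h.of_first hF (by simp [hτ, hidx]) (by simp [hτ])
      (fun q hqi => hq q (by omega)) hsuf, by omega,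
      .inl ⟨rfl, by simp, hb0, 0, by omega, .inl rfl, fun _ _ _ _ => .inl rfl⟩⟩
  have h1 : σ.arr tEnd i = 0 := by simpa [hidx] using h1
  have key : ∀ τ : State, PairFrame σ τ → τ.reg rI = i → τ.arr tPair = σ.arr tPair →
      τ.arr tEnd = σ.arr tEnd → τ.arr tBeg i = 0 →
      (∀ q, q ≠ i → q ≠ i + 1 → τ.arr tBeg q = σ.arr tBeg q) →
      (σ.arr tBeg i = i - 1 ∧ τ.arr tBeg (i + 1) = i - 1 ∨
        σ.arr tBeg i + 2 ≤ i ∧ σ.arr tPair (σ.arr tBeg i) ≠ 1 ∧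
          τ.arr tBeg (i + 1) = σ.arr tBeg i + 1) →
      PairState W n i k₁ f₁ k₂ (f₂ + 1) τ ∧
          ∀ pr', (∀ q, q + 1 < i → pr' q = τ.arr tPair q) →
            (τ.arr tPair (i - 1) = 0 → pr' (i - 1) = 1 ∧ pr' i = 2) →
            (τ.arr tPair (i - 1) ≠ 0 → pr' (i - 1) = τ.arr tPair (i - 1) ∧ pr' i = 0) →
            PairStage (δ + 1) (i + 1) (τ.arr tBeg) pr' := by
    intro τ hF hidx' hpr hend hbi0 hq hb'
    refine ⟨h.of_first hF hidx' hpr (fun q hqi => ⟨hq q (by omega) (by omega), by rw [hend]⟩) ?_,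
      fun pr' a1 a2 a3 => hδ.next h.paired hi hc hbi hb' ?_ ?_ ?_⟩
    · rw [hend]
      refine h.suf.split_first (by omega) hc h1 (fun q hiq => hq q (by omega) (by omega)) hbi0
        (by omega) (by omega) fun p hW => ?_
      rcases hb' with ⟨h2, h3⟩ | ⟨-, -, h3⟩
      · rw [h3]
        rw [h2] at hW
        exact hW.tail_of_eq (by omega)
      · rw [h3]
        exact hW.tail
    · rwa [← hpr]
    · rwa [← hpr]
    · rwa [← hpr]
  rw [wp_ite]
  refine ⟨by simp [hB1, hidx]; omega, fun h2 => ?_, fun h2 => ?_⟩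
  · have h2 : σ.arr tBeg i = i - 1 := by simpa [hidx] using h2
    rw [wp_block_cons, wp_store]
    refine ⟨by simp [hidx]; omega, by simp [hidx]; omega, ?_⟩
    rw [wp_block_cons, wp_store]
    refine ⟨by simp [hidx]; omega, by simp, wp_block_nil.2 ?_⟩
    simp only [Expr.eval_reg, Expr.zero_eq, Expr.one_eq, Expr.eval_add, Expr.eval_sub,
      Expr.eval_const, hidx, State.reg_setCell]
    obtain ⟨τ, hτ⟩ : ∃ τ, τ = (σ.setCell tBeg (i + 1) (i - 1)).setCell tBeg i 0 := ⟨_, rfl⟩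
    rw [← hτ]
    have hF : PairFrame σ τ := ⟨fun a h1 h2 h3 => by simp [hτ, h1], fun r h1 h2 => by
      simp [hτ]⟩
    have hb0 : τ.arr tBeg i = 0 := by simp [hτ]
    obtain ⟨h3, h4⟩ := key τ hF (by simp [hτ, hidx]) (by simp [hτ]) (by simp [hτ]) hb0
      (fun q h1 h2 => by simp [hτ, Function.update_of_ne h1, Function.update_of_ne h2])
      (.inl ⟨h2, by simp [hτ]⟩)
    exact ⟨hF, i, k₁, k₂, f₂ + 1, h3, le_rfl, .inl ⟨rfl, by simp, hb0, δ + 1, by omega, .inr hk₂, h4⟩⟩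
  have h2 : σ.arr tBeg i ≠ i - 1 := by simpa [hidx] using h2
  have h3' := h.paired.le_two (σ.arr tBeg i) (by omega) hbi
  rw [wp_ite]
  refine ⟨by simp [hB1, hidx]; omega, fun h3 => ?_, fun h3 => ?_⟩
  · have h3 : σ.arr tPair (σ.arr tBeg i) ≠ 1 := by simpa [hidx] using h3
    rw [wp_block_cons, wp_store]
    refine ⟨by simp [hidx]; omega, by simp [hidx]; omega, ?_⟩
    rw [wp_block_cons, wp_store]
    refine ⟨by simp [hidx]; omega, by simp, wp_block_nil.2 ?_⟩
    simp only [Expr.eval_reg, Expr.zero_eq, Expr.one_eq, Expr.eval_add, Expr.eval_cell,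
      Expr.eval_const, hidx, State.reg_setCell]
    obtain ⟨τ, hτ⟩ : ∃ τ, τ = (σ.setCell tBeg (i + 1) (σ.arr tBeg i + 1)).setCell tBeg i 0 :=
      ⟨_, rfl⟩
    rw [← hτ]
    have hF : PairFrame σ τ := ⟨fun a h1 h2 h3 => by simp [hτ, h1], fun r h1 h2 => by
      simp [hτ]⟩
    have hb0 : τ.arr tBeg i = 0 := by simp [hτ]
    obtain ⟨h4, h5⟩ := key τ hF (by simp [hτ, hidx]) (by simp [hτ]) (by simp [hτ]) hb0
      (fun q h1 h2 => by simp [hτ, Function.update_of_ne h1, Function.update_of_ne h2])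
      (.inr ⟨by omega, h3, by simp [hτ]⟩)
    exact ⟨hF, i, k₁, k₂, f₂ + 1, h4, le_rfl, .inl ⟨rfl, by simp, hb0, δ + 1, by omega, .inr hk₂, h5⟩⟩
  · have h3 : σ.arr tPair (σ.arr tBeg i) = 1 := by simpa [hidx] using h3
    refine (wp_pairGood h hin hc (by omega) h3 hB h1).mono ?_
    rintro t τ ⟨hF, q, k, f, ht, rfl, hf, hiq, hτ⟩
    exact ⟨hF, q, k₁ + 1, k, f, hτ, by omega, .inr ⟨hiq, by simp; omega, by omega⟩⟩

/-- One iteration of the loop. -/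
def pairStep : Cmd := block [pairFactor,
  when (xI.isLe xLen) (when (Expr.cell tBeg xI).neg pairFree)]

theorem wp_pairStep {δ : ℕ} (h : PairState W n i k₁ f₁ k₂ f₂ σ) (hin : i ≤ n)
    (hδ : PairStage δ i (σ.arr tBeg) (σ.arr tPair)) (hB : 2 * n + 10 ≤ B) :
    Wp B pairStep σ fun t τ => PairFrame σ τ ∧ ∃ q k₁' f₁' k₂' f₂' δ', i < q ∧
      t + 10 ≤ 200 * (q - i) ∧ PairState W n q k₁' f₁' k₂' f₂' τ ∧ k₁' + k₂' ≤ k₁ + k₂ ∧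
      f₁' + f₂' + 4 * k₂' + δ ≤ f₁ + f₂ + 4 * k₂ + δ' ∧
      (δ' = 0 ∨ k₂' ≠ 0) ∧ PairStage δ' q (τ.arr tBeg) (τ.arr tPair) := by
  have hB1 : 1 ≤ B := by omega
  rw [pairStep, wp_block_cons]
  refine (wp_pairFactor h hin hδ hB).mono ?_
  rintro t₁ σ₁ ⟨hF₁, q, k₁', k₂', f₂', h', hk, hcase⟩
  have hidx := h'.idx
  have hlen := h'.len
  have hq2 := h'.two_le
  have hqn := h'.le
  rw [wp_block_cons, wp_when]
  refine ⟨by simp [hidx, hlen]; omega, fun hc => ?_, fun hc => ?_⟩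
  · have hc : q ≤ n := by
      simp [hidx, hlen] at hc
      omega
    have hbd := h'.suf.bounds q le_rfl (by omega)
    rw [wp_when]
    refine ⟨by simp [hidx, hB1]; omega, fun hc' => ?_, fun hc' => ?_⟩
    · have hc' : σ₁.arr tBeg q = 0 := by simpa [hidx] using hc'
      refine (wp_pairFree h' hc hc' hB).mono ?_
      rintro t₂ τ ⟨ht₂, hF₂, hb₂, he₂, ⟨f, rfl, h2⟩, hlt, h0, h1⟩
      rw [wp_block_nil]
      refine ⟨hF₁.trans hF₂, ?_⟩
      rcases hcase with ⟨rfl, ht₁, hbq, δ', hf, hδ', hst⟩ | ⟨hiq, ht₁, hf⟩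
      · exact ⟨q + 1, k₁', f₁ + 1, k₂', f, δ', by omega, by simp; omega, h2, hk, by omega, hδ', by
          rw [hb₂]
          exact hst _ hlt h0 h1⟩
      · exact ⟨q + 1, k₁', f₁ + 1, k₂', f, 0, by omega, by simp; omega, h2, hk, by omega, .inl rfl, .inl rfl⟩
    · have hc' : σ₁.arr tBeg q ≠ 0 := by simpa [hidx] using hc'
      rw [wp_block_nil]
      refine ⟨hF₁, ?_⟩
      rcases hcase with ⟨rfl, ht₁, hbq, δ', hf, hδ', hst⟩ | ⟨hiq, ht₁, hf⟩
      · exact absurd hbq hc'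
      · exact ⟨q, k₁', f₁, k₂', f₂', 0, by omega, by simp; omega, h', hk, by omega, .inl rfl, .inl rfl⟩
  · have hc : n < q := by
      simp [hidx, hlen] at hc
      omega
    rw [wp_block_nil]
    refine ⟨hF₁, ?_⟩
    rcases hcase with ⟨rfl, ht₁, hbq, δ', hf, hδ', hst⟩ | ⟨hiq, ht₁, hf⟩
    · omega
    · exact ⟨q, k₁', f₁, k₂', f₂', 0, by omega, by simp; omega, h', hk, by omega, .inl rfl, .inl rfl⟩

theorem wp_algPairing {k f : ℕ} (hlen : σ.reg rLen = n) (hn : 1 ≤ n)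
    (h : Seg (CopyWord W) (σ.arr tBeg) (σ.arr tEnd) k f 1 (n + 1)) (hB : 2 * n + 10 ≤ B) :
    Wp B algPairing σ fun t τ => t ≤ 200 * n + 20 ∧ PairFrame σ τ ∧ ∃ k' f',
      Seg (fun x p j => CopyWord W x p j ∧ CopyPair (τ.arr tPair) x p j)
        (τ.arr tBeg) (τ.arr tEnd) k' f' 1 (n + 1) ∧
      Paired (τ.arr tPair) (n + 1) ∧ k' ≤ k ∧ f' ≤ f + 4 * k := by
  have hb1 : σ.arr tBeg 1 = 0 := by
    by_contra hb
    obtain ⟨-, -, -, -, -, h, -⟩ := h.fac_cases (by omega) hb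
    omega
  obtain ⟨he1, f, rfl, hsuf⟩ := h.free_cases (by omega) hb1
  have hB1 : 1 ≤ B := by omega
  change Wp B (block [.store tPair 1 pNone, .assign rI 2, .loop (xI.isLe xLen) pairStep]) σ _
  rw [wp_block_cons, wp_store]
  refine ⟨by simp; omega, by simp, ?_⟩
  rw [wp_block_cons, wp_assign]
  refine ⟨by simp; omega, ?_⟩
  rw [wp_block_cons]
  simp only [Expr.one_eq, Expr.two_eq, Expr.eval_const]
  obtain ⟨τ, hτ⟩ : ∃ τ, τ = (σ.setCell tPair 1 0).setReg rI 2 := ⟨_, rfl⟩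
  rw [← hτ]
  have hF : PairFrame σ τ := ⟨fun a h1 h2 h3 => by simp [hτ, h3], fun r h1 h2 => by
    simp [hτ, h1]⟩
  have hp1 : τ.arr tPair 1 = 0 := by simp [hτ]
  have hb : τ.arr tBeg = σ.arr tBeg := by simp [hτ]
  have he : τ.arr tEnd = σ.arr tEnd := by simp [hτ]
  have h0 : PairState W n 2 0 1 k f τ := by
    refine ⟨(hF.reg _ (by decide) (by decide)).trans hlen, by simp [hτ], le_rfl, by omega, ?_, ?_,
      ⟨⟨fun q h1 h2 => ?_, ?_, fun q h1 h2 => ?_, fun q h1 h2 => ?_⟩, ?_⟩⟩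
    · rw [hb, he]
      exact .free hb1 he1 (.nil _)
    · rw [hb, he]
      exact hsuf
    · rw [show q = 1 by omega, hp1]
      omega
    · omega
    · omega
    · omega
    · rw [show 2 - 1 = 1 from rfl, hp1]
      omega
  refine (Wp.loop (m := 200 * (n + 1 - 2) + 10) (fun m υ => ∃ i k₁ f₁ k₂ f₂ δ,
    PairState W n i k₁ f₁ k₂ f₂ υ ∧ PairFrame σ υ ∧ PairStage δ i (υ.arr tBeg) (υ.arr tPair) ∧
    (δ = 0 ∨ k₂ ≠ 0) ∧ k₁ + k₂ ≤ k ∧ f₁ + f₂ + 4 * k₂ ≤ f + 1 + 4 * k + δ ∧ 200 * (n + 1 - i) + 10 ≤ m)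
    (fun _ υ => PairFrame σ υ ∧ ∃ k' f',
      Seg (fun x p j => CopyWord W x p j ∧ CopyPair (υ.arr tPair) x p j)
        (υ.arr tBeg) (υ.arr tEnd) k' f' 1 (n + 1) ∧
      Paired (υ.arr tPair) (n + 1) ∧ k' ≤ k ∧ f' ≤ f + 1 + 4 * k) ?_
    ⟨2, 0, 1, k, f, 0, h0, hF, .inl rfl, .inl rfl, by omega, by omega, le_rfl⟩).mono ?_
  · rintro m υ ⟨i, k₁, f₁, k₂, f₂, δ, h', hF', hδ, hδk, hk, hf, hm⟩
    have hidx := h'.idx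
    have hlen' := h'.len
    have hle := h'.le
    refine ⟨by simp [hidx, hlen']; omega, fun hc => ?_, fun hc => ?_⟩
    · have hin : i ≤ n := by
        simp [hidx, hlen'] at hc
        omega
      refine (wp_pairStep h' hin hδ hB).mono ?_
      rintro t υ' ⟨hF₂, q, k₁', f₁', k₂', f₂', δ', hiq, ht, h2, hk', hf', hδk', hδ'⟩
      have := h2.le
      exact ⟨m - t - 5, by simp; omega, q, k₁', f₁', k₂', f₂', δ', h2, hF'.trans hF₂, hδ',
        hδk', by omega, by omega, by omega⟩
    · have hin : i = n + 1 := by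
        simp [hidx, hlen'] at hc
        omega
      subst hin
      refine ⟨0, by simp; omega, hF', k₁, f₁, h'.pre, h'.paired, by omega, ?_⟩
      -- Nothing is left to process, so `k₂ = 0`, and then no partly spent credit `δ` remains.
      have hz := h'.suf.add_le
      omega
  · rintro t υ ⟨m, hm, h1⟩
    rw [wp_block_nil]
    exact ⟨by simp; omega, h1⟩

end
end RAM

/-! ### Replacement: the new word inherits the factorisation. -/

/-- The concatenation of the words `v (W 1), …, v (W m)`. -/
def expand (v : ℕ → List ℕ) (W : ℕ → ℕ) (m : ℕ) : List ℕ :=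
  (List.range m).flatMap fun q => v (W (q + 1))

theorem expand_succ (v : ℕ → List ℕ) (W : ℕ → ℕ) (m : ℕ) :
    expand v W (m + 1) = expand v W m ++ v (W (m + 1)) := by
  simp [expand, List.range_succ]

theorem expand_congr {v v' : ℕ → List ℕ} {W W' : ℕ → ℕ} {m : ℕ}
    (h : ∀ q, 1 ≤ q → q ≤ m → v (W q) = v' (W' q)) : expand v W m = expand v' W' m := by
  induction m with
  | zero => rfl
  | succ m ih =>
    rw [expand_succ, expand_succ, ih fun q h1 h2 => h q h1 (by omega), h (m + 1) (by omega) le_rfl]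

/-- The tables describe the rules of the nonterminals below `cnt`, and `v c` is the word derived
from the nonterminal `c`. -/
def Gram (cnt : ℕ) (v : ℕ → List ℕ) (kind left right : ℕ → ℕ) : Prop :=
  ∀ c < cnt, kind c = 0 ∧ v c = [left c] ∨
    kind c = 1 ∧ left c < c ∧ right c < c ∧ v c = v (left c) ++ v (right c)

/-- The next position that is not the second one of a pair. -/
def nextUnit (pr : ℕ → ℕ) (k : ℕ) : ℕ := if pr k = 1 then k + 2 else k + 1

/-- The word derived from the letter or pair that begins at `k`. -/
def unitWord (val : ℕ → List ℕ) (W pr : ℕ → ℕ) (k : ℕ) : List ℕ :=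
  if pr k = 1 then val (W k) ++ val (W (k + 1)) else val (W k)

/-- The letters and pairs before position `i` have been replaced; they give the positions before
`i'` of the new word. -/
structure ReplWord (val : ℕ → List ℕ) (W₀ pr : ℕ → ℕ) (n i i' : ℕ) (v : ℕ → List ℕ)
    (W P : ℕ → ℕ) : Prop where
  one_le : 1 ≤ i
  one_le' : 1 ≤ i'
  le : i ≤ n + 1
  start : i ≤ n → pr i ≠ 2
  len : 3 * i' ≤ 2 * i + 2
  len' : 3 * i' ≤ 2 * i + 1 ∨ 2 ≤ i ∧ pr (i - 1) = 0
  old : ∀ x, i ≤ x → x ≤ n → W x = W₀ x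
  pos : ∀ k, 1 ≤ k → k < i → pr k ≠ 2 → 1 ≤ P k ∧ P k < i' ∧ v (W (P k)) = unitWord val W₀ pr k ∧
    (nextUnit pr k < i → P (nextUnit pr k) = P k + 1) ∧ (nextUnit pr k = i → i' = P k + 1)
  word : expand v W (i' - 1) = expand val W₀ (i - 1)

namespace ReplWord
variable {val v v' : ℕ → List ℕ} {W₀ pr W P W' P' : ℕ → ℕ} {n i i' : ℕ}

/-- A pair that begins before `i` also ends before `i`, since `i` is not second in a pair. -/
theorem next_le (h : ReplWord val W₀ pr n i i' v W P) (hpr : Paired pr (n + 1)) {k : ℕ}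
    (hk : 1 ≤ k) (hki : k < i) : nextUnit pr k ≤ i := by
  have hle := h.le
  rw [nextUnit]
  split_ifs with hk1
  · by_contra hn
    have hin : i ≤ n := by
      by_contra hin
      have := hpr.last
      rw [show n + 1 - 1 = k by omega] at this
      exact this hk1
    have := (hpr.pair k hk (by omega)).1 hk1
    rw [show k + 1 = i by omega] at this
    exact h.start hin this
  · omega

/-- A pair contributes one letter for two positions and an unpaired letter one for one, but the
latter are never adjacent. The worst case alternates single letters and pairs, which gives `3 * (i'
- 1) ≤ 2 * (i - 1) + 1`, with slack unless the last letter read is unpaired. -/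
theorem step (h : ReplWord val W₀ pr n i i' v W P) (hpr : Paired pr (n + 1)) (hin : i ≤ n)
    (hv : ∀ q, 1 ≤ q → q < i' → v' (W' q) = v (W q)) (hold : ∀ q, i < q → W' q = W q)
    (hP : ∀ q, q < i → P' q = P q) (hPi : P' i = i')
    (hx : v' (W' i') = unitWord val W₀ pr i) :
    ReplWord val W₀ pr n (nextUnit pr i) (i' + 1) v' W' P' := by
  have h1 := h.one_le
  have h1' := h.one_le'
  have hst := h.start hin
  have hle := hpr.le_two i h1 (by omega)
  have hlast : pr i = 1 → i + 1 ≤ n := fun h1 => by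
    by_contra hn
    have := hpr.last
    rw [show n + 1 - 1 = i by omega] at this
    exact this h1
  have hnext : i < nextUnit pr i := by
    rw [nextUnit]
    split_ifs <;> omega
  refine ⟨by omega, by omega, ?_, fun hn => ?_, ?_, ?_, fun x hx hxn => ?_, fun k hk hki hk2 => ?_,
    ?_⟩
  · rw [nextUnit]
    split_ifs with h2
    · have := hlast h2
      omega
    · omega
  · rw [nextUnit] at hn ⊢
    split_ifs at hn ⊢ with h2
    · have h3 := (hpr.pair i h1 (by omega)).1 h2
      intro h4
      have := (hpr.pair (i + 1) (by omega) (by omega)).2 h4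
      omega
    · exact fun h3 => h2 ((hpr.pair i h1 (by omega)).2 h3)
  · have := h.len
    have := h.len'
    rw [nextUnit]
    split_ifs with h2
    · omega
    · have : 2 ≤ i → pr (i - 1) = 0 → pr i ≠ 0 := fun h3 h4 => by
        have := hpr.none (i - 1) (by omega) (by omega) h4
        rwa [show i - 1 + 1 = i by omega] at this
      omega
  · have := h.len
    have := h.len'
    rw [nextUnit]
    split_ifs with h2
    · omega
    · refine .inr ⟨by omega, ?_⟩
      rw [Nat.add_sub_cancel]
      omega
  · rw [hold x (by omega), h.old x (by omega) hxn]
  · rcases lt_trichotomy k i with hki' | rfl | hki'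
    · obtain ⟨a1, a2, a3, a4, a5⟩ := h.pos k hk hki' hk2
      have hle := h.next_le hpr hk hki'
      rw [hP k hki']
      refine ⟨a1, by omega, by rw [hv _ a1 a2, a3], fun _ => ?_, fun h3 => by omega⟩
      rcases hle.lt_or_eq with h3 | h3
      · rw [hP _ h3, a4 h3]
      · rw [h3, hPi, a5 h3]
    · rw [hPi]
      exact ⟨h1', by omega, hx, fun h3 => by omega, fun _ => rfl⟩
    · rw [nextUnit] at hki
      split_ifs at hki with h2
      · rw [show k = i + 1 by omega] at hk2
        exact absurd ((hpr.pair i h1 (by have := hlast h2; omega)).1 h2) hk2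
      · omega
  · obtain ⟨i', rfl⟩ := Nat.exists_eq_add_of_le' h1'
    obtain ⟨i, rfl⟩ := Nat.exists_eq_add_of_le' h1
    have hw := h.word
    simp only [Nat.add_sub_cancel] at hw ⊢
    rw [expand_succ, expand_congr (v' := v) (W' := W) fun q h1 h2 => hv q h1 (by omega), hw, hx,
      unitWord, nextUnit]
    split_ifs with h2
    · rw [show i + 1 + 2 - 1 = i + 1 + 1 from rfl, expand_succ, expand_succ, List.append_assoc]
    · rw [Nat.add_sub_cancel, expand_succ]

end ReplWord

namespace RAM

/-- The state while the pairs are replaced: the positions before `i` are processed. -/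
structure ReplState (val : ℕ → List ℕ) (W₀ pr : ℕ → ℕ) (n cnt₀ i i' k₁ f₁ k₂ f₂ : ℕ)
    (v : ℕ → List ℕ) (σ : State) : Prop where
  word : ReplWord val W₀ pr n i i' v (σ.arr tWord) (σ.arr tPos)
  reg_len : σ.reg rLen = n
  idx : σ.reg rI = i
  idx' : σ.reg rI' = i'
  pair : σ.arr tPair = pr
  pre : Seg (CopyWord (σ.arr tWord)) (σ.arr tBeg) (σ.arr tEnd) k₁ f₁ 1 i'
  suf : Seg (fun x p j => CopyWord W₀ x p j ∧ CopyPair pr x p j) (σ.arr tBeg) (σ.arr tEnd)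
    k₂ f₂ i (n + 1)
  zero : ∀ x, i' ≤ x → x < i → σ.arr tBeg x = 0 ∧ σ.arr tEnd x = 0
  lt : ∀ x, 1 ≤ x → x < i' → σ.arr tWord x < σ.reg rCnt
  gram : Gram (σ.reg rCnt) v (σ.arr tKind) (σ.arr tLeft) (σ.arr tRight)
  ext : ∀ c < cnt₀, v c = val c
  cnt_le : cnt₀ ≤ σ.reg rCnt
  two : i' = 2 → i = 2 ∨ σ.arr tWord 1 + 1 = σ.reg rCnt

/-- Copy the new definition to the new factor. -/
def replCopyLoop : Cmd := repeatUntil (block [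
    .store tPos xI xI',
    .store tWord xI' (.cell tWord xJ'),
    .assign rI' (xI' + 1),
    .assign rJ' (xJ' + 1),
    .ite ((Expr.cell tPair xI).isEq pFirst)
      (.assign rI (xI + 2))
      (.assign rI (xI + 1))])
  (.cell tEnd (xI - 1))

variable {val v : ℕ → List ℕ} {W₀ pr : ℕ → ℕ} {n cnt₀ i i' k₁ f₁ k₂ f₂ p j B : ℕ} {σ : State}

/-- The factor is read unit by unit, a unit being a pair or an unpaired letter. Marks and letters
agree with the definition, so `j + (q - i)` runs through the units of the definition in step, and
their images are consecutive in the new word; hence `rJ'` always points at the image of the current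
source unit. -/
theorem wp_replCopyLoop (h : ReplWord val W₀ pr n i i' v (σ.arr tWord) (σ.arr tPos))
    (hpr : Paired pr (n + 1)) (hpair : σ.arr tPair = pr) (hi : σ.reg rI = i)
    (hi' : σ.reg rI' = i') (hj : σ.reg rJ' = σ.arr tPos j) (hj1 : 1 ≤ j) (hip : i < p)
    (hpn : p ≤ n + 1) (hW : CopyWord W₀ i p j) (hP : CopyPair pr i p j)
    (he : σ.arr tEnd (p - 1) = 1) (heq : ∀ q, i ≤ q → q + 1 < p → σ.arr tEnd q = 0)
    (hlt : ∀ x, 1 ≤ x → x < i' → σ.arr tWord x < σ.reg rCnt) (hcB : σ.reg rCnt ≤ B)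
    (hB : 2 * n + 10 ≤ B) :
    Wp B replCopyLoop σ fun t τ => t ≤ 60 * (p - i) ∧ ∃ q',
      ReplWord val W₀ pr n p q' v (τ.arr tWord) (τ.arr tPos) ∧ τ.reg rI = p ∧ τ.reg rI' = q' ∧
      i' < q' ∧ (∀ x < i', τ.arr tWord x = σ.arr tWord x) ∧
      (∀ x, 1 ≤ x → x < q' → τ.arr tWord x < σ.reg rCnt) ∧
      CopyWord (τ.arr tWord) i' q' (σ.arr tPos j) ∧
      (∀ a, a ≠ tWord → a ≠ tPos → τ.arr a = σ.arr a) ∧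
      τ.reg rLen = σ.reg rLen ∧ τ.reg rCnt = σ.reg rCnt := by
  have hB1 : 1 ≤ B := by omega
  obtain ⟨hji, hlen, hprj, hprp, hprc⟩ := hP
  obtain ⟨hP1, hP2, -⟩ := h.pos j hj1 (by omega) (by omega)
  refine (Wp.repeatUntil (m := 60 * (p - i)) hB1 (fun m τ => ∃ q q', i ≤ q ∧ q < p ∧
      ReplWord val W₀ pr n q q' v (τ.arr tWord) (τ.arr tPos) ∧ τ.reg rI = q ∧ τ.reg rI' = q' ∧
      τ.reg rJ' = τ.arr tPos (j + (q - i)) ∧ τ.reg rJ' + i' = σ.arr tPos j + q' ∧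
      i' ≤ q' ∧ (∀ x < i', τ.arr tWord x = σ.arr tWord x) ∧
      (∀ x, 1 ≤ x → x < q' → τ.arr tWord x < σ.reg rCnt) ∧
      CopyWord (τ.arr tWord) i' q' (σ.arr tPos j) ∧
      (∀ a, a ≠ tWord → a ≠ tPos → τ.arr a = σ.arr a) ∧
      τ.reg rLen = σ.reg rLen ∧ τ.reg rCnt = σ.reg rCnt ∧ 60 * (p - q) ≤ m)
    (fun _ τ => ∃ q',
      ReplWord val W₀ pr n p q' v (τ.arr tWord) (τ.arr tPos) ∧ τ.reg rI = p ∧ τ.reg rI' = q' ∧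
      i' < q' ∧ (∀ x < i', τ.arr tWord x = σ.arr tWord x) ∧
      (∀ x, 1 ≤ x → x < q' → τ.arr tWord x < σ.reg rCnt) ∧
      CopyWord (τ.arr tWord) i' q' (σ.arr tPos j) ∧
      (∀ a, a ≠ tWord → a ≠ tPos → τ.arr a = σ.arr a) ∧
      τ.reg rLen = σ.reg rLen ∧ τ.reg rCnt = σ.reg rCnt) ?_
    ⟨i, i', le_rfl, hip, h, hi, hi', by simpa using hj, by omega, le_rfl, fun _ _ => rfl,
      hlt, fun d hd => by omega, fun _ _ _ => rfl, rfl, rfl, le_rfl⟩).mono ?_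
  · rintro m τ ⟨q, q', hiq, hqp, hR, hq, hq', hJ, hJ', hiq', hout, hlt', hcw, harr, hrl, hrc, hm⟩
    obtain ⟨d, rfl⟩ := Nat.exists_eq_add_of_le hiq
    rw [Nat.add_sub_cancel_left] at hJ
    have hst := hR.start (by omega)
    have h1 := hR.one_le
    have hle2 := hpr.le_two (i + d) (by omega) (by omega)
    have hprd := hprc d hqp
    have htp : τ.arr tPair = pr := (harr _ (by decide) (by decide)).trans hpair
    have hte : τ.arr tEnd = σ.arr tEnd := harr _ (by decide) (by decide)
    obtain ⟨a1, a2, a3, a4, a5⟩ := hR.pos (j + d) (by omega) (by omega) (by rwa [← hprd])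
    have hnl := hR.next_le hpr (k := j + d) (by omega) (by omega)
    have hq'n : q' ≤ n + 1 := by
      have := hR.len
      have := hR.le
      have := hR.one_le
      omega
    have hqp1 : pr (i + d) = 1 → i + d + 1 < p := fun h3 => by
      by_contra hn
      rw [show p - 1 = i + d by omega] at hprp
      omega
    have hunit : unitWord val W₀ pr (j + d) = unitWord val W₀ pr (i + d) := by
      rw [unitWord, unitWord, hprd, hW d hqp]
      split_ifs with h3
      · rw [add_assoc i, hW (d + 1) (by have := hqp1 (by rw [hprd, h3]); omega), add_assoc j]
      · rfl
    have hWJ := hlt' _ a1 a2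
    rw [wp_block_cons, wp_store]
    refine ⟨by simp [hq]; omega, by simp [hq']; omega, ?_⟩
    rw [wp_block_cons, wp_store]
    refine ⟨by simp [hq']; omega, by simp [hJ]; omega, ?_⟩
    rw [wp_block_cons, wp_assign]
    refine ⟨by simp [hq']; omega, ?_⟩
    rw [wp_block_cons, wp_assign]
    refine ⟨by simp [hJ]; omega, ?_⟩
    simp only [Expr.eval_reg, Expr.eval_add, Expr.one_eq, Expr.eval_const, hq, hq', hJ,
      State.reg_setCell, State.reg_setReg, Expr.eval_cell]
    simp only [State.arr_setCell, reduceCtorEq, if_false]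
    obtain ⟨υ, hυ⟩ : ∃ υ, υ = ((((τ.setCell tPos (i + d) q').setCell tWord q'
      (τ.arr tWord (τ.arr tPos (j + d)))).setReg rI' (q' + 1)).setReg rJ'
      (τ.arr tPos (j + d) + 1)) := ⟨_, rfl⟩
    rw [if_neg (show ¬ rJ' = rI' by decide), ← hυ]
    have uI : υ.reg rI = i + d := by simp [hυ, hq]
    have uP : υ.arr tPair = pr := by simp [hυ, htp]
    have main : ∀ ω : State, ω = υ.setReg rI (nextUnit pr (i + d)) →
        (Expr.cell tEnd (xI - Expr.const 1)).Fits B ω ∧ ∃ m', 50 + m' ≤ m ∧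
        (ω.arr tEnd (ω.reg rI - 1) = 0 → ∃ q q', i ≤ q ∧ q < p ∧
      ReplWord val W₀ pr n q q' v (ω.arr tWord) (ω.arr tPos) ∧ ω.reg rI = q ∧ ω.reg rI' = q' ∧
      ω.reg rJ' = ω.arr tPos (j + (q - i)) ∧ ω.reg rJ' + i' = σ.arr tPos j + q' ∧
      i' ≤ q' ∧ (∀ x < i', ω.arr tWord x = σ.arr tWord x) ∧
      (∀ x, 1 ≤ x → x < q' → ω.arr tWord x < σ.reg rCnt) ∧
      CopyWord (ω.arr tWord) i' q' (σ.arr tPos j) ∧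
      (∀ a, a ≠ tWord → a ≠ tPos → ω.arr a = σ.arr a) ∧
      ω.reg rLen = σ.reg rLen ∧ ω.reg rCnt = σ.reg rCnt ∧ 60 * (p - q) ≤ m') ∧
      (ω.arr tEnd (ω.reg rI - 1) ≠ 0 → ∃ q',
      ReplWord val W₀ pr n p q' v (ω.arr tWord) (ω.arr tPos) ∧ ω.reg rI = p ∧ ω.reg rI' = q' ∧
      i' < q' ∧ (∀ x < i', ω.arr tWord x = σ.arr tWord x) ∧
      (∀ x, 1 ≤ x → x < q' → ω.arr tWord x < σ.reg rCnt) ∧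
      CopyWord (ω.arr tWord) i' q' (σ.arr tPos j) ∧
      (∀ a, a ≠ tWord → a ≠ tPos → ω.arr a = σ.arr a) ∧
      ω.reg rLen = σ.reg rLen ∧ ω.reg rCnt = σ.reg rCnt) := by
      intro ω hω
      have wI : ω.reg rI = nextUnit pr (i + d) := by simp [hω]
      have wI' : ω.reg rI' = q' + 1 := by simp [hω, hυ]
      have wJ : ω.reg rJ' = τ.arr tPos (j + d) + 1 := by simp [hω, hυ]
      have wL : ω.reg rLen = σ.reg rLen := by simp [hω, hυ, hrl]
      have wC : ω.reg rCnt = σ.reg rCnt := by simp [hω, hυ, hrc]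
      have wA : ∀ a, a ≠ tWord → a ≠ tPos → ω.arr a = σ.arr a := fun a h1 h2 => by
        simp [hω, hυ, h1, h2, harr a h1 h2]
      have wW : ∀ x, x ≠ q' → ω.arr tWord x = τ.arr tWord x := fun x hx => by
        simp [hω, hυ, Function.update_of_ne hx]
      have wWq : ω.arr tWord q' = τ.arr tWord (τ.arr tPos (j + d)) := by simp [hω, hυ]
      have wP : ∀ x, x ≠ i + d → ω.arr tPos x = τ.arr tPos x := fun x hx => by
        simp [hω, hυ, Function.update_of_ne hx]
      have wPq : ω.arr tPos (i + d) = q' := by simp [hω, hυ]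
      -- The new word never overtakes the old one, so it can be written into the same table without
      -- destroying unread letters.
      have hqi : q' ≤ i + d := by
        have := hR.len
        omega
      have hR' := hR.step (v' := v) (W' := ω.arr tWord) (P' := ω.arr tPos) hpr (by omega)
        (fun x h1 h2 => by rw [wW x (by omega)]) (fun x hx => wW x (by omega))
        (fun x hx => wP x (by omega)) wPq (by rw [wWq, a3, hunit])
      have hnp : nextUnit pr (i + d) ≤ p := by
        rw [nextUnit]
        split_ifs with h3
        · exact hqp1 h3
        · exact hqp
      have hnd : nextUnit pr (j + d) = j + (nextUnit pr (i + d) - i) := by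
        rw [nextUnit, nextUnit, hprd]
        split_ifs <;> omega
      have hnq : i + d < nextUnit pr (i + d) := by
        rw [nextUnit]
        split_ifs <;> omega
      have hout' : ∀ x < i', ω.arr tWord x = σ.arr tWord x := fun x hx => by
        rw [wW x (by omega), hout x hx]
      have hlt'' : ∀ x, 1 ≤ x → x < q' + 1 → ω.arr tWord x < σ.reg rCnt := fun x h1 h2 => by
        by_cases hx : x = q'
        · rw [hx, wWq]
          exact hWJ
        · rw [wW x hx]
          exact hlt' x h1 (by omega)
      have hcw' : CopyWord (ω.arr tWord) i' (q' + 1) (σ.arr tPos j) := fun y hy => by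
        rw [wW (σ.arr tPos j + y) (by omega)]
        by_cases hx : i' + y = q'
        · rw [hx, wWq]
          congr 1
          omega
        · rw [wW _ hx]
          exact hcw y (by omega)
      have wE := wA tEnd (by decide) (by decide)
      have hEle : σ.arr tEnd (nextUnit pr (i + d) - 1) ≤ 1 := by
        rcases hnp.lt_or_eq with h3 | h3
        · rw [heq _ (by omega) (by omega)]
          omega
        · rw [h3, he]
      refine ⟨by simp [wI, wE]; omega, m - 50, by omega, fun h0 => ?_, fun h0 => ?_⟩
      · rw [wI, wE] at h0
        have hnp' : nextUnit pr (i + d) < p := by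
          refine hnp.lt_of_ne fun h3 => ?_
          rw [h3, he] at h0
          omega
        refine ⟨_, _, by omega, hnp', hR', wI, wI', ?_, by omega, by omega, hout', hlt'', hcw', wA,
          wL, wC, by omega⟩
        rw [wJ, ← hnd]
        rcases hnl.lt_or_eq with h3 | h3
        · rw [wP _ (by omega), a4 h3]
        · rw [h3, wPq, a5 h3]
      · rw [wI, wE] at h0
        have hnp' : nextUnit pr (i + d) = p := by
          by_contra hn
          exact h0 (heq _ (by omega) (by omega))
        rw [hnp'] at hR' wI
        exact ⟨_, hR', wI, wI', by omega, hout', hlt'', hcw', wA, wL, wC⟩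
    rw [wp_block_cons, wp_ite]
    refine ⟨by simp [hB1, uI, uP]; omega, fun hc => ?_, fun hc => ?_⟩
    · have hc : pr (i + d) = 1 := by simpa [uI, uP] using hc
      rw [wp_assign]
      refine ⟨by simp [uI]; omega, wp_block_nil.2 ?_⟩
      obtain ⟨hfit, m', hm', h2, h3⟩ := main _ rfl
      rw [show (xI + 2 : Expr).eval υ = nextUnit pr (i + d) by simp [uI, nextUnit, hc]]
      exact ⟨hfit, m', by simp; omega, h2, h3⟩
    · have hc : pr (i + d) ≠ 1 := by simpa [uI, uP] using hc
      rw [wp_assign]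
      refine ⟨by simp [uI]; omega, wp_block_nil.2 ?_⟩
      obtain ⟨hfit, m', hm', h2, h3⟩ := main _ rfl
      rw [show (xI + Expr.const 1 : Expr).eval υ = nextUnit pr (i + d) by simp [uI, nextUnit, hc]]
      exact ⟨hfit, m', by simp; omega, h2, h3⟩
  · rintro t τ ⟨m, hm, h⟩
    exact ⟨by omega, h⟩

/-- Replace the factor that begins at `i`. -/
def replFactor : Cmd := block [
  .assign rJ' (.cell tPos (.cell tBeg xI)),
  .store tBeg xI' xJ',
  .store tBeg xI 0,
  replCopyLoop,
  .store tEnd (xI' - 1) 1,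
  .store tEnd (xI - 1) 0]

/-- The definition of the new factor begins at the image of the old definition, which exists because
the old definition begins with a pair. As `i ≥ 3` here, the new position is strictly behind `i`, and
the tables between the two positions are already cleared. -/
theorem wp_replFactor (h : ReplState val W₀ pr n cnt₀ i i' k₁ f₁ k₂ f₂ v σ)
    (hpr : Paired pr (n + 1)) (hin : i ≤ n) (hb : σ.arr tBeg i ≠ 0) (hB : 2 * n + 10 ≤ B)
    (hcB : σ.reg rCnt ≤ B) :
    Wp B replFactor σ fun t τ => ∃ p p' k, t ≤ 100 * (p - i) ∧ k₂ = k + 1 ∧ i < p ∧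
      ReplState val W₀ pr n cnt₀ p p' (k₁ + 1) f₁ k f₂ v τ ∧ τ.reg rCnt = σ.reg rCnt := by
  have hB1 : 1 ≤ B := by omega
  have hidx := h.idx
  have hidx' := h.idx'
  have hi1 := h.word.one_le'
  obtain ⟨k, p, rfl, hip, hpn, hbi, hbq, he, heq, ⟨hW, hP⟩, hsuf⟩ :=
    h.suf.fac_cases (by omega) hb
  obtain ⟨hji, hlen, hprj, -, -⟩ := id hP
  have hi'i : i' < i := by
    have := h.word.len
    omega
  obtain ⟨hP1, hP2, -⟩ := h.word.pos (σ.arr tBeg i) (by omega) hbi (by omega)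
  obtain ⟨J, hJ⟩ : ∃ J, J = σ.arr tPos (σ.arr tBeg i) := ⟨_, rfl⟩
  rw [replFactor, wp_block_cons, wp_assign]
  refine ⟨by simp [hidx]; omega, ?_⟩
  rw [wp_block_cons, wp_store]
  refine ⟨by simp [hidx']; omega, by simp [hidx]; omega, ?_⟩
  rw [wp_block_cons, wp_store]
  refine ⟨by simp [hidx]; omega, by simp, ?_⟩
  simp only [Expr.eval_reg, Expr.eval_cell, Expr.zero_eq, Expr.eval_const, hidx,
    State.reg_setCell, State.reg_setReg, if_true, ← hJ]
  rw [if_neg (show ¬ rI = rJ' by decide), if_neg (show ¬ rI' = rJ' by decide), hidx']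
  obtain ⟨ω, hω⟩ : ∃ ω, ω = (((σ.setReg rJ' J).setCell tBeg i' J).setCell tBeg i 0) := ⟨_, rfl⟩
  rw [← hω]
  have ωA : ∀ a, a ≠ tBeg → ω.arr a = σ.arr a := fun a h1 => by simp [hω, h1]
  have ωR : ∀ r, r ≠ rJ' → ω.reg r = σ.reg r := fun r h1 => by simp [hω, h1]
  have ωB : ∀ x, x ≠ i → x ≠ i' → ω.arr tBeg x = σ.arr tBeg x := fun x h1 h2 => by
    simp [hω, Function.update_of_ne h1, Function.update_of_ne h2]
  have ωBi : ω.arr tBeg i = 0 := by simp [hω]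
  have ωBi' : ω.arr tBeg i' = J := by simp [hω, Function.update_of_ne hi'i.ne]
  have ωW := ωA tWord (by decide)
  have ωP := ωA tPos (by decide)
  have ωE := ωA tEnd (by decide)
  have ωC := ωR rCnt (by decide)
  rw [wp_block_cons]
  refine (wp_replCopyLoop (p := p) (j := σ.arr tBeg i) (n := n) (by rw [ωW, ωP]; exact h.word) hpr
    ((ωA _ (by decide)).trans h.pair) ((ωR _ (by decide)).trans hidx)
    ((ωR _ (by decide)).trans hidx') (by rw [ωP, ← hJ]; simp [hω]) (by omega) hip hpn hW hP
    (by rwa [ωE]) (by rwa [ωE]) (by rw [ωW, ωC]; exact h.lt) (by rwa [ωC]) hB).mono ?_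
  rintro t τ ⟨ht, q', hR, hq, hq', hiq', hout, hlt, hcw, harr, hrl, hrc⟩
  -- Strictness matters: the old end mark at `p - 1` is erased after the new one at `q' - 1` has
  -- been written.
  have hq'p : q' < p := by
    have := hR.len
    omega
  rw [wp_block_cons, wp_store]
  refine ⟨by simp [hq']; omega, by simp; omega, ?_⟩
  rw [wp_block_cons, wp_store]
  refine ⟨by simp [hq]; omega, by simp, wp_block_nil.2 ?_⟩
  simp only [Expr.eval_reg, Expr.eval_sub, Expr.one_eq, Expr.eval_const, hq, hq',
    State.reg_setCell]
  obtain ⟨υ, hυ⟩ : ∃ υ, υ = ((τ.setCell tEnd (q' - 1) 1).setCell tEnd (p - 1) 0) := ⟨_, rfl⟩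
  rw [← hυ]
  have υR : υ.reg = τ.reg := by simp [hυ]
  have υA : ∀ a, a ≠ tEnd → υ.arr a = τ.arr a := fun a h1 => by simp [hυ, h1]
  have υA' : ∀ a, a ≠ tEnd → a ≠ tWord → a ≠ tPos → a ≠ tBeg → υ.arr a = σ.arr a :=
    fun a h1 h2 h3 h4 => by rw [υA a h1, harr a h2 h3, ωA a h4]
  have υW := υA tWord (by decide)
  have υB : υ.arr tBeg = ω.arr tBeg := by
    rw [υA tBeg (by decide), harr tBeg (by decide) (by decide)]
  have υE : ∀ x, x ≠ p - 1 → x ≠ q' - 1 → υ.arr tEnd x = σ.arr tEnd x := fun x h1 h2 => by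
    rw [← ωE, ← harr tEnd (by decide) (by decide)]
    simp [hυ, Function.update_of_ne h1, Function.update_of_ne h2]
  have υEp : υ.arr tEnd (p - 1) = 0 := by simp [hυ]
  have υEq : υ.arr tEnd (q' - 1) = 1 := by
    simp [hυ, Function.update_of_ne (show q' - 1 ≠ p - 1 by omega)]
  have υC : υ.reg rCnt = σ.reg rCnt := by rw [υR, hrc, ωC]
  have hBz : ∀ x, i' < x → x < p → υ.arr tBeg x = 0 := fun x h1 h2 => by
    rw [υB]
    rcases lt_trichotomy x i with h3 | rfl | h3
    · rw [ωB x (by omega) (by omega), (h.zero x (by omega) h3).1]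
    · exact ωBi
    · rw [ωB x (by omega) (by omega), hbq x h3 h2]
  have hEz : ∀ x, i' ≤ x → x < p → x ≠ q' - 1 → υ.arr tEnd x = 0 := fun x h1 h2 h3 => by
    by_cases h4 : x = p - 1
    · rw [h4, υEp]
    · rw [υE x h4 h3]
      rcases lt_or_ge x i with h5 | h5
      · exact (h.zero x h1 h5).2
      · exact heq x h5 (by omega)
  have hwW : ∀ x < i', υ.arr tWord x = σ.arr tWord x := fun x hx => by
    rw [υW, hout x hx, ωW]
  refine ⟨p, q', k, by simp; omega, rfl, hip, ⟨?_, ?_, ?_, ?_, ?_, ?_, ?_, ?_, ?_, ?_, h.ext, ?_, ?_⟩,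
    by rw [hrc, ωC]⟩
  · rw [υW, υA tPos (by decide)]
    exact hR
  · rw [υR, hrl, ωR _ (by decide), h.reg_len]
  · rw [υR, hq]
  · rw [υR, hq']
  · rw [υA' _ (by decide) (by decide) (by decide) (by decide), h.pair]
  · refine (h.pre.imp (b' := υ.arr tBeg) (e' := υ.arr tEnd) (fun x h1 h2 => ⟨?_, ?_⟩) ?_).append
      (k' := 1) (f' := 0) (.fac q' hiq' ?_ ?_ (fun x h1 h2 => hBz x h1 (by omega)) υEq
        (fun x h1 h2 => hEz x h1 (by omega) (by omega)) ?_ (.nil _))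
    · rw [υB, ωB x (by omega) (by omega)]
    · rw [υE x (by omega) (by omega)]
    · intro x y z h1 h2 h3 h4 h5 hc d hd
      rw [hwW _ (by omega), hwW _ (by omega), hc d hd]
    · rw [υB, ωBi']
      omega
    · rw [υB, ωBi']
      omega
    · rw [υB, ωBi', υW]
      rwa [ωP, ← hJ] at hcw
  · refine hsuf.congr fun x h1 h2 => ⟨?_, υE x (by omega) (by omega)⟩
    rw [υB, ωB x (by omega) (by omega)]
  · exact fun x h1 h2 => ⟨hBz x (by omega) h2, hEz x (by omega) h2 (by omega)⟩
  · intro x h1 h2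
    rw [υW, υC, ← ωC]
    exact hlt x h1 h2
  · rw [υC, υA' tKind (by decide) (by decide) (by decide) (by decide),
      υA' tLeft (by decide) (by decide) (by decide) (by decide),
      υA' tRight (by decide) (by decide) (by decide) (by decide)]
    exact h.gram
  · rw [υC]
    exact h.cnt_le
  · intro h2
    omega

/-- Replace the free letter or pair that begins at `i`. -/
def replFree : Cmd := block [
  .store tPos xI xI',
  .ite ((Expr.cell tPair xI).isEq pNone)
    (block [
      .store tWord xI' (.cell tWord xI),
      .assign rI (xI + 1),
      .assign rI' (xI' + 1)])
    (block [
      .store tKind xCnt 1,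
      .store tLeft xCnt (.cell tWord xI),
      .store tRight xCnt (.cell tWord (xI + 1)),
      .store tWord xI' xCnt,
      .assign rCnt (xCnt + 1),
      .assign rI (xI + 2),
      .assign rI' (xI' + 1)])]

/-- An unpaired free letter stays a free letter; a pair turns two free letters into one free letter
and one nonterminal. Either way the number of free letters plus nonterminals is preserved. -/
theorem wp_replFree (h : ReplState val W₀ pr n cnt₀ i i' k₁ f₁ k₂ f₂ v σ)
    (hpr : Paired pr (n + 1)) (hin : i ≤ n) (hb : σ.arr tBeg i = 0) (hB : 2 * n + 10 ≤ B)
    (hcB : σ.reg rCnt + f₂ + 1 ≤ B) (hW₀ : ∀ x, 1 ≤ x → x ≤ n → W₀ x < cnt₀) :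
    Wp B replFree σ fun t τ => t ≤ 60 ∧ ∃ q q' f₁' f₂' v', i < q ∧
      ReplState val W₀ pr n cnt₀ q q' k₁ f₁' k₂ f₂' v' τ ∧
      f₁' + f₂' + τ.reg rCnt = f₁ + f₂ + σ.reg rCnt := by
  have hB1 : 1 ≤ B := by omega
  have hidx := h.idx
  have hidx' := h.idx'
  have hi1 := h.word.one_le
  have hi1' := h.word.one_le'
  have hst := h.word.start hin
  have hle2 := hpr.le_two i hi1 (by omega)
  have hcnt := h.cnt_le
  have hi'i : i' ≤ i := by
    have := h.word.len
    have := h.word.len'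
    omega
  have hWi : σ.arr tWord i = W₀ i := h.word.old i le_rfl hin
  have hWlt := hW₀ i hi1 hin
  obtain ⟨he, f, rfl, hsuf⟩ := h.suf.free_cases (by omega) hb
  rw [replFree, wp_block_cons, wp_store]
  refine ⟨by simp [hidx]; omega, by simp [hidx']; omega, ?_⟩
  rw [wp_block_cons, wp_ite]
  simp only [Expr.eval_reg, hidx, hidx']
  refine ⟨by simp [hB1, hidx, h.pair]; omega, fun hc => ?_, fun hc => ?_⟩
  · have hc : pr i = 0 := by simpa [hidx, h.pair] using hc
    have hnext : nextUnit pr i = i + 1 := by simp [nextUnit, hc]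
    rw [wp_block_cons, wp_store]
    refine ⟨by simp [hidx']; omega, by simp [hidx, hWi]; omega, ?_⟩
    rw [wp_block_cons, wp_assign]
    refine ⟨by simp [hidx]; omega, ?_⟩
    rw [wp_block_cons, wp_assign]
    refine ⟨by simp [hidx']; omega, wp_block_nil.2 (wp_block_nil.2 ?_)⟩
    obtain ⟨υ, hυ⟩ : ∃ υ, υ = (((σ.setCell tPos i i').setCell tWord i' (W₀ i)).setReg rI
      (i + 1)).setReg rI' (i' + 1) := ⟨_, rfl⟩
    have hυ' : ∀ x y z u, x = i' → y = W₀ i → z = i + 1 → u = i' + 1 →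
      (((σ.setCell tPos i i').setCell tWord x y).setReg rI z).setReg rI' u = υ := by
      rintro _ _ _ _ rfl rfl rfl rfl
      exact hυ.symm
    rw [hυ' _ _ _ _ (by simp [hidx']) (by simp [hidx, hWi]) (by simp [hidx]) (by simp [hidx'])]
    have υA : ∀ a, a ≠ tWord → a ≠ tPos → υ.arr a = σ.arr a := fun a h1 h2 => by
      simp [hυ, h1, h2]
    have υR : ∀ r, r ≠ rI → r ≠ rI' → υ.reg r = σ.reg r := fun r h1 h2 => by
      simp [hυ, h1, h2]
    have υW : ∀ x, x ≠ i' → υ.arr tWord x = σ.arr tWord x := fun x hx => by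
      simp [hυ, Function.update_of_ne hx]
    have υWi : υ.arr tWord i' = W₀ i := by simp [hυ]
    have υP : ∀ x, x ≠ i → υ.arr tPos x = σ.arr tPos x := fun x hx => by
      simp [hυ, Function.update_of_ne hx]
    have υPi : υ.arr tPos i = i' := by simp [hυ]
    have υC := υR rCnt (by decide) (by decide)
    have υB := υA tBeg (by decide) (by decide)
    have υE := υA tEnd (by decide) (by decide)
    have hw := h.word.step (v' := v) (W' := υ.arr tWord) (P' := υ.arr tPos) hpr hin
      (fun x h1 h2 => by rw [υW x (by omega)]) (fun x h1 => υW x (by omega))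
      (fun x h1 => υP x (by omega)) υPi
      (by rw [υWi, h.ext _ hWlt, unitWord, if_neg (by omega)])
    rw [hnext] at hw
    have hz : σ.arr tBeg i' = 0 ∧ σ.arr tEnd i' = 0 := by
      rcases hi'i.lt_or_eq with h1 | h1
      · exact h.zero i' le_rfl h1
      · rw [h1]
        exact ⟨hb, he⟩
    refine ⟨by simp, i + 1, i' + 1, f₁ + 1, f, v, by omega, ⟨hw, ?_, ?_, ?_, ?_, ?_, ?_, ?_, ?_,
      ?_, h.ext, ?_, ?_⟩, by omega⟩
    · rw [υR _ (by decide) (by decide), h.reg_len]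
    · simp [hυ]
    · simp [hυ]
    · rw [υA _ (by decide) (by decide), h.pair]
    · rw [υB, υE]
      refine (h.pre.imp (fun _ _ _ => ⟨rfl, rfl⟩) ?_).snoc_free hz.1 hz.2
      intro x y z h1 h2 h3 h4 h5 hc d hd
      rw [υW _ (by omega), υW _ (by omega), hc d hd]
    · rw [υB, υE]
      exact hsuf
    · intro x h1 h2
      rw [υB, υE]
      rcases Nat.lt_or_ge x i with h3 | h3
      · exact h.zero x (by omega) h3
      · rw [show x = i by omega]
        exact ⟨hb, he⟩
    · intro x h1 h2
      rw [υC]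
      by_cases hx : x = i'
      · rw [hx, υWi]
        omega
      · rw [υW x hx]
        exact h.lt x h1 (by omega)
    · rw [υC, υA tKind (by decide) (by decide), υA tLeft (by decide) (by decide),
        υA tRight (by decide) (by decide)]
      exact h.gram
    · rw [υC]
      exact hcnt
    · intro h2
      have := h.word.len
      have := h.word.len'
      have hi2 : i' = 1 := by omega
      refine .inl ?_
      by_contra hn
      -- An empty new word means that nothing has been read: otherwise position `1` would have an
      -- image.
      have hw0 := h.word.pos 1 le_rfl (by omega) hpr.one
      omega
  · have hc : pr i ≠ 0 := by simpa [hidx, h.pair] using hc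
    have hc : pr i = 1 := by omega
    have hnext : nextUnit pr i = i + 2 := by simp [nextUnit, hc]
    have hin' : i + 1 ≤ n := by
      by_contra hn
      have := hpr.last
      rw [show n + 1 - 1 = i by omega] at this
      exact this hc
    have hc2 := (hpr.pair i hi1 (by omega)).1 hc
    have hWi' : σ.arr tWord (i + 1) = W₀ (i + 1) := h.word.old _ (by omega) hin'
    have hWlt' := hW₀ (i + 1) (by omega) hin'
    -- A factor begins with the first letter of a pair, so the second letter of this pair is free as
    -- well.
    have hb' : σ.arr tBeg (i + 1) = 0 := by
      by_contra hb'
      obtain ⟨-, p, -, h1, -, -, -, -, -, ⟨-, -, -, h2, -, h3⟩, -⟩ := hsuf.fac_cases (by omega) hb'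
      have := h3 0 h1
      rw [add_zero, add_zero, h2] at this
      omega
    obtain ⟨he', f, rfl, hsuf'⟩ := hsuf.free_cases (by omega) hb'
    obtain ⟨c, hcc⟩ : ∃ c, c = σ.reg rCnt := ⟨_, rfl⟩
    rw [← hcc] at hcB hcnt
    rw [wp_block_cons, wp_store]
    refine ⟨by simp [← hcc]; omega, by simp; omega, ?_⟩
    rw [wp_block_cons, wp_store]
    refine ⟨by simp [← hcc]; omega, by simp [hidx, hWi]; omega, ?_⟩
    rw [wp_block_cons, wp_store]
    refine ⟨by simp [← hcc]; omega, by simp [hidx, hWi']; omega, ?_⟩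
    rw [wp_block_cons, wp_store]
    refine ⟨by simp [hidx']; omega, by simp [← hcc]; omega, ?_⟩
    rw [wp_block_cons, wp_assign]
    refine ⟨by simp [← hcc]; omega, ?_⟩
    rw [wp_block_cons, wp_assign]
    refine ⟨by simp [hidx]; omega, ?_⟩
    rw [wp_block_cons, wp_assign]
    refine ⟨by simp [hidx']; omega, wp_block_nil.2 (wp_block_nil.2 ?_)⟩
    obtain ⟨υ, hυ⟩ : ∃ υ, υ = (((((((σ.setCell tPos i i').setCell tKind c 1).setCell tLeft c
      (W₀ i)).setCell tRight c (W₀ (i + 1))).setCell tWord i' c).setReg rCnt (c + 1)).setReg rI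
      (i + 2)).setReg rI' (i' + 1) := ⟨_, rfl⟩
    have hυ' : ∀ x₁ x₂ x₃ y₁ y₂ y₃ y₄ z₁ z₂ z₃ z₄ z₅, x₁ = c → x₂ = c → x₃ = c → y₁ = 1 →
        y₂ = W₀ i → y₃ = W₀ (i + 1) → y₄ = i' → z₁ = c → z₂ = c + 1 → z₃ = i + 2 → z₄ = i' + 1 →
        z₅ = i' →
      (((((((σ.setCell tPos i z₅).setCell tKind x₁ y₁).setCell tLeft x₂
      y₂).setCell tRight x₃ y₃).setCell tWord y₄ z₁).setReg rCnt z₂).setReg rI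
      z₃).setReg rI' z₄ = υ := by
      rintro _ _ _ _ _ _ _ _ _ _ _ _ rfl rfl rfl rfl rfl rfl rfl rfl rfl rfl rfl rfl
      exact hυ.symm
    rw [hυ' _ _ _ _ _ _ _ _ _ _ _ _ (by simp [← hcc]) (by simp [← hcc]) (by simp [← hcc])
      (by simp) (by simp [hidx, hWi]) (by simp [hidx, hWi']) (by simp [hidx']) (by simp [← hcc])
      (by simp [← hcc]) (by simp [hidx]) (by simp [hidx']) rfl]
    have υA : ∀ a, a ≠ tWord → a ≠ tPos → a ≠ tKind → a ≠ tLeft → a ≠ tRight →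
        υ.arr a = σ.arr a := fun a h1 h2 h3 h4 h5 => by
      simp [hυ, h1, h2, h3, h4, h5]
    have υR : ∀ r, r ≠ rI → r ≠ rI' → r ≠ rCnt → υ.reg r = σ.reg r := fun r h1 h2 h3 => by
      simp [hυ, h1, h2, h3]
    have υW : ∀ x, x ≠ i' → υ.arr tWord x = σ.arr tWord x := fun x hx => by
      simp [hυ, Function.update_of_ne hx]
    have υWi : υ.arr tWord i' = c := by simp [hυ]
    have υP : ∀ x, x ≠ i → υ.arr tPos x = σ.arr tPos x := fun x hx => by
      simp [hυ, Function.update_of_ne hx]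
    have υPi : υ.arr tPos i = i' := by simp [hυ]
    have υK : υ.arr tKind = Function.update (σ.arr tKind) c 1 := by simp [hυ]
    have υL : υ.arr tLeft = Function.update (σ.arr tLeft) c (W₀ i) := by simp [hυ]
    have υRt : υ.arr tRight = Function.update (σ.arr tRight) c (W₀ (i + 1)) := by simp [hυ]
    have υC : υ.reg rCnt = c + 1 := by simp [hυ]
    have υB := υA tBeg (by decide) (by decide) (by decide) (by decide) (by decide)
    have υE := υA tEnd (by decide) (by decide) (by decide) (by decide) (by decide)
    obtain ⟨v', hv'⟩ : ∃ v', v' = Function.update v c (v (W₀ i) ++ v (W₀ (i + 1))) := ⟨_, rfl⟩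
    have hvc : v' c = v (W₀ i) ++ v (W₀ (i + 1)) := by simp [hv']
    have hvne : ∀ x, x ≠ c → v' x = v x := fun x hx => by simp [hv', Function.update_of_ne hx]
    have hlt := h.lt
    rw [← hcc] at hlt
    have hw := h.word.step (v' := v') (W' := υ.arr tWord) (P' := υ.arr tPos) hpr hin
      (fun x h1 h2 => by
        have := hlt x h1 h2
        rw [υW x (by omega), hvne _ (by omega)]) (fun x h1 => υW x (by omega))
      (fun x h1 => υP x (by omega)) υPi
      (by rw [υWi, hvc, h.ext _ hWlt, h.ext _ hWlt', unitWord, if_pos hc])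
    rw [hnext] at hw
    have hz : σ.arr tBeg i' = 0 ∧ σ.arr tEnd i' = 0 := by
      rcases hi'i.lt_or_eq with h1 | h1
      · exact h.zero i' le_rfl h1
      · rw [h1]
        exact ⟨hb, he⟩
    refine ⟨by simp, i + 2, i' + 1, f₁ + 1, f, v', by omega, ⟨hw, ?_, ?_, ?_, ?_, ?_, ?_, ?_, ?_,
      ?_, ?_, ?_, ?_⟩, by omega⟩
    · rw [υR _ (by decide) (by decide) (by decide), h.reg_len]
    · simp [hυ]
    · simp [hυ]
    · rw [υA _ (by decide) (by decide) (by decide) (by decide) (by decide), h.pair]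
    · rw [υB, υE]
      refine (h.pre.imp (fun _ _ _ => ⟨rfl, rfl⟩) ?_).snoc_free hz.1 hz.2
      intro x y z h1 h2 h3 h4 h5 hc d hd
      rw [υW _ (by omega), υW _ (by omega), hc d hd]
    · rw [υB, υE]
      exact hsuf'
    · intro x h1 h2
      rw [υB, υE]
      rcases Nat.lt_or_ge x i with h3 | h3
      · exact h.zero x (by omega) h3
      · rcases h3.lt_or_eq with h3 | rfl
        · rw [show x = i + 1 by omega]
          exact ⟨hb', he'⟩
        · exact ⟨hb, he⟩
    · intro x h1 h2
      rw [υC]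
      by_cases hx : x = i'
      · rw [hx, υWi]
        omega
      · rw [υW x hx]
        have := hlt x h1 (by omega)
        omega
    · rw [υC, υK, υL, υRt]
      intro x hx
      rcases Nat.lt_succ_iff_lt_or_eq.1 hx with hx | rfl
      · have hg := h.gram
        rw [← hcc] at hg
        simp only [Function.update_of_ne hx.ne, hvne x hx.ne]
        rcases hg x hx with hg | ⟨g1, g2, g3, g4⟩
        · exact .inl hg
        · refine .inr ⟨g1, g2, g3, ?_⟩
          rw [hvne _ (by omega), hvne _ (by omega), g4]
      · simp only [Function.update_self]
        refine .inr ⟨trivial, by omega, by omega, ?_⟩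
        rw [hvc, hvne _ (by omega), hvne _ (by omega)]
    · intro x hx
      rw [hvne x (by omega), h.ext x hx]
    · omega
    · intro h2
      rw [υC, show 1 = i' by omega, υWi]
      exact .inr (by omega)

/-- One iteration of the loop. -/
def replStep : Cmd := block [when (.cell tBeg xI) replFactor,
  when (xI.isLe xLen) (when (Expr.cell tBeg xI).neg replFree)]

theorem wp_replStep (h : ReplState val W₀ pr n cnt₀ i i' k₁ f₁ k₂ f₂ v σ)
    (hpr : Paired pr (n + 1)) (hin : i ≤ n) (hB : 2 * n + 10 ≤ B)
    (hcB : σ.reg rCnt + f₂ + 1 ≤ B) (hW₀ : ∀ x, 1 ≤ x → x ≤ n → W₀ x < cnt₀) :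
    Wp B replStep σ fun t τ => ∃ q q' k₁' f₁' k₂' f₂' v', i < q ∧ t + 10 ≤ 150 * (q - i) ∧
      ReplState val W₀ pr n cnt₀ q q' k₁' f₁' k₂' f₂' v' τ ∧ k₁' + k₂' = k₁ + k₂ ∧
      f₁' + f₂' + τ.reg rCnt = f₁ + f₂ + σ.reg rCnt := by
  have hB1 : 1 ≤ B := by omega
  have hfree : ∀ {i i' k₁ k₂ : ℕ} {σ : State}, ReplState val W₀ pr n cnt₀ i i' k₁ f₁ k₂ f₂ v σ →
      i ≤ n → σ.reg rCnt + f₂ + 1 ≤ B →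
      Wp B (when (xI.isLe xLen) (when (Expr.cell tBeg xI).neg replFree)) σ fun t τ =>
        ∃ q q' f₁' f₂' v', i ≤ q ∧ (σ.arr tBeg i = 0 → i < q) ∧ t ≤ 20 + 60 * (q - i) ∧
        ReplState val W₀ pr n cnt₀ q q' k₁ f₁' k₂ f₂' v' τ ∧
        f₁' + f₂' + τ.reg rCnt = f₁ + f₂ + σ.reg rCnt := by
    intro i i' k₁ k₂ σ h hin hcB
    have hidx := h.idx
    have hlen := h.reg_len
    have hbd := h.suf.bounds i le_rfl (by omega)
    rw [wp_when]
    refine ⟨by simp [hidx, hlen]; omega, fun hc => ?_, fun hc => ?_⟩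
    swap
    · simp [hidx, hlen] at hc
      omega
    rw [wp_when]
    refine ⟨by simp [hidx, hB1]; omega, fun hc => ?_, fun hc => ?_⟩
    · have hc : σ.arr tBeg i = 0 := by simpa [hidx] using hc
      refine (wp_replFree h hpr hin hc hB hcB hW₀).mono ?_
      rintro t τ ⟨ht, q, q', f₁', f₂', v', hiq, h1, h2⟩
      exact ⟨q, q', f₁', f₂', v', hiq.le, fun _ => hiq, by simp; omega, h1, h2⟩
    · have hc : σ.arr tBeg i ≠ 0 := by simpa [hidx] using hc
      exact ⟨i, i', f₁, f₂, v, le_rfl, fun h => absurd h hc, by simp, h, rfl⟩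
  have hidx := h.idx
  have hbd := h.suf.bounds i le_rfl (by omega)
  rw [replStep, wp_block_cons, wp_when]
  refine ⟨by simp [hidx]; omega, fun hc => ?_, fun hc => ?_⟩
  · have hc : σ.arr tBeg i ≠ 0 := by simpa [hidx] using hc
    refine (wp_replFactor h hpr hin hc hB (by omega)).mono ?_
    rintro t τ ⟨p, p', k, ht, rfl, hip, hτ, hcnt⟩
    rw [wp_block_cons]
    rcases Nat.lt_or_ge n p with hp | hp
    · have := hτ.idx
      have := hτ.reg_len
      have := hτ.word.le
      rw [wp_when]
      refine ⟨by simp [*]; omega, fun hc => ?_, fun hc => ?_⟩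
      · simp [*] at hc
      · rw [wp_block_nil]
        exact ⟨p, p', k₁ + 1, f₁, k, f₂, v, hip, by simp; omega, hτ, by omega, by omega⟩
    · refine (hfree hτ hp (by omega)).mono ?_
      rintro t₂ υ ⟨q, q', f₁', f₂', v', hpq, -, ht₂, hυ, hf⟩
      rw [wp_block_nil]
      exact ⟨q, q', k₁ + 1, f₁', k, f₂', v', by omega, by simp; omega, hυ, by omega, by omega⟩
  · have hc : σ.arr tBeg i = 0 := by simpa [hidx] using hc
    rw [wp_block_cons]
    refine (hfree h hin hcB).mono ?_
    rintro t₂ υ ⟨q, q', f₁', f₂', v', -, hpq, ht₂, hυ, hf⟩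
    have := hpq hc
    rw [wp_block_nil]
    exact ⟨q, q', k₁, f₁', k₂, f₂', v', this, by simp; omega, hυ, by omega, by omega⟩

/-- The last clause concerns the start symbol: a word of length one that arose from a longer one
consists of the nonterminal introduced last. -/
theorem wp_algReplace {k f : ℕ} (hlen : σ.reg rLen = n) (hn : 1 ≤ n)
    (h : Seg (fun x p j => CopyWord (σ.arr tWord) x p j ∧ CopyPair (σ.arr tPair) x p j)
      (σ.arr tBeg) (σ.arr tEnd) k f 1 (n + 1))
    (hpr : Paired (σ.arr tPair) (n + 1))
    (hlt : ∀ x, 1 ≤ x → x ≤ n → σ.arr tWord x < σ.reg rCnt)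
    (hg : Gram (σ.reg rCnt) val (σ.arr tKind) (σ.arr tLeft) (σ.arr tRight))
    (hB : 2 * n + 10 ≤ B) (hcB : σ.reg rCnt + f + 1 ≤ B) :
    Wp B algReplace σ fun t τ => t ≤ 150 * n + 30 ∧ ∃ n' f' v', τ.reg rLen = n' ∧
      1 ≤ n' ∧ 3 * n' ≤ 2 * n + 1 ∧
      Seg (CopyWord (τ.arr tWord)) (τ.arr tBeg) (τ.arr tEnd) k f' 1 (n' + 1) ∧
      f' + τ.reg rCnt = f + σ.reg rCnt ∧ (∀ x, 1 ≤ x → x ≤ n' → τ.arr tWord x < τ.reg rCnt) ∧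
      Gram (τ.reg rCnt) v' (τ.arr tKind) (τ.arr tLeft) (τ.arr tRight) ∧
      expand v' (τ.arr tWord) n' = expand val (σ.arr tWord) n ∧
      (n' = 1 → n = 1 ∨ τ.arr tWord 1 + 1 = τ.reg rCnt) := by
  have hB1 : 1 ≤ B := by omega
  change Wp B (block [.assign rI 1, .assign rI' 1, .loop (xI.isLe xLen) replStep,
    .assign rLen (xI' - 1)]) σ _
  rw [wp_block_cons, wp_assign]
  refine ⟨by simp; omega, ?_⟩
  rw [wp_block_cons, wp_assign]
  refine ⟨by simp; omega, ?_⟩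
  rw [wp_block_cons]
  simp only [Expr.one_eq, Expr.eval_const]
  obtain ⟨ω, hω⟩ : ∃ ω, ω = (σ.setReg rI 1).setReg rI' 1 := ⟨_, rfl⟩
  rw [← hω]
  have ωA : ω.arr = σ.arr := by simp [hω]
  have ωC : ω.reg rCnt = σ.reg rCnt := by simp [hω]
  have h0 : ReplState val (σ.arr tWord) (σ.arr tPair) n (σ.reg rCnt) 1 1 0 0 k f val ω := by
    refine ⟨⟨le_rfl, le_rfl, by omega, fun _ => hpr.one, by omega, .inl (by omega), ?_, ?_, rfl⟩,
      by simp [hω, hlen], by simp [hω], by simp [hω], by rw [ωA], .nil 1, by rw [ωA]; exact h, ?_,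
      ?_, by rw [ωC, ωA]; exact hg, fun _ _ => rfl, ωC.ge, by omega⟩
    · rw [ωA]
      exact fun _ _ _ => rfl
    all_goals
      intros
      omega
  refine (Wp.loop (m := 150 * n + 10) (fun m τ => ∃ i i' k₁ f₁ k₂ f₂ v',
      ReplState val (σ.arr tWord) (σ.arr tPair) n (σ.reg rCnt) i i' k₁ f₁ k₂ f₂ v' τ ∧
      k₁ + k₂ = k ∧ f₁ + f₂ + τ.reg rCnt = f + σ.reg rCnt ∧ 150 * (n + 1 - i) + 10 ≤ m)
    (fun _ τ => ∃ i' k₁ f₁ k₂ f₂ v',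
      ReplState val (σ.arr tWord) (σ.arr tPair) n (σ.reg rCnt) (n + 1) i' k₁ f₁ k₂ f₂ v' τ ∧
      k₁ + k₂ = k ∧ f₁ + f₂ + τ.reg rCnt = f + σ.reg rCnt) ?_
    ⟨1, 1, 0, 0, k, f, val, h0, by omega, by omega, by omega⟩).mono ?_
  · rintro m τ ⟨i, i', k₁, f₁, k₂, f₂, v', hR, hk, hf, hm⟩
    have hidx := hR.idx
    have hlen' := hR.reg_len
    have hle := hR.word.le
    refine ⟨by simp [hidx, hlen']; omega, fun hc => ?_, fun hc => ?_⟩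
    · have hin : i ≤ n := by
        simp [hidx, hlen'] at hc
        omega
      refine (wp_replStep hR hpr hin hB (by omega) hlt).mono ?_
      rintro t υ ⟨q, q', k₁', f₁', k₂', f₂', v'', hiq, ht, h1, hk', hf'⟩
      have := h1.word.le
      exact ⟨m - t - 5, by simp; omega, q, q', k₁', f₁', k₂', f₂', v'', h1, by omega, by omega,
        by omega⟩
    · have hin : i = n + 1 := by
        simp [hidx, hlen'] at hc
        omega
      subst hin
      exact ⟨0, by simp; omega, i', k₁, f₁, k₂, f₂, v', hR, hk, hf⟩
  · rintro t τ ⟨m, hm, i', k₁, f₁, k₂, f₂, v', hR, hk, hf⟩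
    have hz := hR.suf.add_le
    have hidx' := hR.idx'
    have hl := hR.word.len
    have h1' := hR.word.one_le'
    have hne : 1 < i' := by
      have := hR.word.pos 1 le_rfl (by omega) hpr.one
      omega
    rw [wp_block_cons, wp_assign]
    refine ⟨by simp [hidx']; omega, wp_block_nil.2 ⟨by simp; omega, i' - 1, f₁, v', by simp [hidx'],
      by omega, by omega, ?_, ?_, ?_, ?_, ?_, ?_⟩⟩
    · rw [show i' - 1 + 1 = i' by omega, State.arr_setReg, show k = k₁ by omega]
      exact hR.pre
    · simp
      omega
    · intro x h1 h2
      simpa using hR.lt x h1 (by omega)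
    · simpa using hR.gram
    · simpa using hR.word.word
    · intro h1
      have := hR.two (by omega)
      simp only [State.arr_setReg]
      simp
      omega

end RAM

/-! ### From lists of phrases to tables, and the initial nonterminals. -/

namespace IsLZ77

/-- The tables are described through `getElem?`, so the hypotheses restrict to prefixes and the
phrases can be added one at a time. -/
theorem seg {F : List (Phrase ℕ)} {w : List ℕ} (h : IsLZ77 F w) {W b e : ℕ → ℕ}
    (hW : ∀ k x, w[k]? = some x → W (k + 1) = x)
    (hb : ∀ k x, (F.flatMap RAM.begRow)[k]? = some x → b (k + 1) = x)
    (he : ∀ k x, (F.flatMap RAM.endRow)[k]? = some x → e (k + 1) = x) :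
    (F.flatMap RAM.begRow).length = w.length ∧ (F.flatMap RAM.endRow).length = w.length ∧
      ∃ k f, k + f = F.length ∧ Seg (CopyWord W) b e k f 1 (w.length + 1) := by
  induction h with
  | nil => exact ⟨rfl, rfl, 0, 0, rfl, .nil 1⟩
  | @free F u a _ ih =>
    obtain ⟨h1, h2, k, f, hkf, h⟩ := ih
      (fun k x h => hW k x (by rw [List.getElem?_append_left (List.getElem?_eq_some_iff.1 h).1, h]))
      (fun k x h => hb k x (by
        rw [List.flatMap_append, List.getElem?_append_left (List.getElem?_eq_some_iff.1 h).1, h]))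
      (fun k x h => he k x (by
        rw [List.flatMap_append, List.getElem?_append_left (List.getElem?_eq_some_iff.1 h).1, h]))
    refine ⟨by simp [h1, RAM.begRow], by simp [h2, RAM.endRow], k, f + 1, by simp; omega, ?_⟩
    rw [List.length_append]
    exact h.snoc_free (hb _ _ (by simp [h1, RAM.begRow])) (he _ _ (by simp [h2, RAM.endRow]))
  | @copy F u v j _ hv hj hju hdef ih =>
    obtain ⟨h1, h2, k, f, hkf, h⟩ := ih
      (fun k x h => hW k x (by rw [List.getElem?_append_left (List.getElem?_eq_some_iff.1 h).1, h]))
      (fun k x h => hb k x (by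
        rw [List.flatMap_append, List.getElem?_append_left (List.getElem?_eq_some_iff.1 h).1, h]))
      (fun k x h => he k x (by
        rw [List.flatMap_append, List.getElem?_append_left (List.getElem?_eq_some_iff.1 h).1, h]))
    have hvl : 1 ≤ v.length := List.length_pos_iff.2 hv
    refine ⟨by simp [h1, RAM.begRow]; omega, by simp [h2, RAM.endRow]; omega, k + 1, f + 0,
      by simp; omega, h.append (.fac (u.length + 1 + v.length) (by omega) ?_ ?_ ?_ ?_ ?_ ?_ ?_)⟩
    all_goals try have hbu : b (u.length + 1) = j := hb _ _ (by simp [h1, RAM.begRow])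
    · omega
    · omega
    · intro q hq hqp
      obtain ⟨d, rfl⟩ := Nat.exists_eq_add_of_le' (show 1 ≤ q by omega)
      refine hb _ _ ?_
      simp only [List.flatMap_append, List.flatMap_singleton, RAM.begRow]
      rw [List.getElem?_append_right (by omega), h1, List.getElem?_cons,
        if_neg (by omega), List.getElem?_replicate, if_pos (by omega)]
    · have := he (u.length + (v.length - 1)) 1 (by
        simp only [List.flatMap_append, List.flatMap_singleton, RAM.endRow]
        rw [List.getElem?_append_right (by omega), h2, List.getElem?_append_right (by simp)]
        simp)
      rwa [show u.length + (v.length - 1) + 1 = u.length + 1 + v.length - 1 by omega] at this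
    · intro q hq hqp
      obtain ⟨d, rfl⟩ := Nat.exists_eq_add_of_le' (show 1 ≤ q by omega)
      refine he _ _ ?_
      simp only [List.flatMap_append, List.flatMap_singleton, RAM.endRow]
      rw [List.getElem?_append_right (by omega), h2, List.getElem?_append_left (by simp; omega),
        List.getElem?_replicate, if_pos (by omega)]
    · rw [hbu]
      intro d hd
      have hd' : d < v.length := by omega
      have h3 := congrArg (fun l => l[d]?) hdef
      simp only [List.getElem?_take, if_pos hd', List.getElem?_drop] at h3
      rw [List.getElem?_eq_getElem hd'] at h3
      have h4 := hW _ _ h3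
      rw [show j - 1 + d + 1 = j + d by omega] at h4
      rw [h4, add_right_comm]
      refine hW _ _ ?_
      rw [List.getElem?_append_right (by omega), Nat.add_sub_cancel_left,
        List.getElem?_eq_getElem hd']
    · rw [List.length_append, add_right_comm]
      exact .nil _

end IsLZ77

namespace RAM

/-- The state while the letters are replaced by nonterminals: the positions before `i` are
processed. -/
structure InitState (W₀ : ℕ → ℕ) (n i k₁ f₁ k₂ f₂ : ℕ) (v : ℕ → List ℕ) (σ : State) : Prop where
  len : σ.reg rLen = n
  idx : σ.reg rI = i
  cnt : σ.reg rCnt = f₁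
  one_le : 1 ≤ i
  le : i ≤ n + 1
  old : ∀ x, i ≤ x → x ≤ n → σ.arr tWord x = W₀ x
  word : ∀ x, 1 ≤ x → x < i → σ.arr tWord x < f₁ ∧ v (σ.arr tWord x) = [W₀ x]
  pre : Seg (CopyWord (σ.arr tWord)) (σ.arr tBeg) (σ.arr tEnd) k₁ f₁ 1 i
  suf : Seg (CopyWord W₀) (σ.arr tBeg) (σ.arr tEnd) k₂ f₂ i (n + 1)
  gram : Gram f₁ v (σ.arr tKind) (σ.arr tLeft) (σ.arr tRight)

/-- Copy the nonterminals of the definition onto the factor that begins at `i`. -/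
def initFactor : Cmd := block [
  .assign rJ (.cell tBeg xI),
  repeatUntil (block [
      .store tWord xI (.cell tWord xJ),
      .assign rI (xI + 1),
      .assign rJ (xJ + 1)])
    (.cell tEnd (xI - 1))]

variable {W₀ : ℕ → ℕ} {v : ℕ → List ℕ} {n i k₁ f₁ k₂ f₂ B : ℕ} {σ : State}

theorem wp_initFactor (h : InitState W₀ n i k₁ f₁ k₂ f₂ v σ) (hin : i ≤ n)
    (hb : σ.arr tBeg i ≠ 0) (hB : 2 * n + 10 ≤ B) (hfB : f₁ ≤ B) :
    Wp B initFactor σ fun t τ => ∃ p k, i < p ∧ t ≤ 50 * (p - i) ∧ k₂ = k + 1 ∧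
      InitState W₀ n p (k₁ + 1) f₁ k f₂ v τ := by
  have hB1 : 1 ≤ B := by omega
  have hidx := h.idx
  obtain ⟨k, p, rfl, hip, hpn, hbi, hbq, he, heq, hW, hsuf⟩ := h.suf.fac_cases (by omega) hb
  obtain ⟨j, hj⟩ : ∃ j, j = σ.arr tBeg i := ⟨_, rfl⟩
  rw [← hj] at hb hbi hW
  rw [initFactor, wp_block_cons, wp_assign]
  refine ⟨by simp [hidx, ← hj]; omega, ?_⟩
  rw [wp_block_cons]
  simp only [Expr.eval_cell, Expr.eval_reg, hidx, ← hj]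
  obtain ⟨ω, hω⟩ : ∃ ω, ω = σ.setReg rJ j := ⟨_, rfl⟩
  rw [← hω]
  have ωA : ω.arr = σ.arr := by simp [hω]
  have ωR : ∀ r, r ≠ rJ → ω.reg r = σ.reg r := fun r hr => by simp [hω, hr]
  refine (Wp.repeatUntil (m := 40 * (p - i)) hB1 (fun m τ => ∃ q, i ≤ q ∧ q < p ∧ τ.reg rI = q ∧
      τ.reg rJ + i = j + q ∧ 40 * (p - q) ≤ m ∧ (∀ a, a ≠ tWord → τ.arr a = σ.arr a) ∧
      (∀ r, r ≠ rI → r ≠ rJ → τ.reg r = σ.reg r) ∧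
      (∀ x, x < i ∨ q ≤ x → τ.arr tWord x = σ.arr tWord x) ∧
      (∀ x, 1 ≤ x → x < q → τ.arr tWord x < f₁ ∧ v (τ.arr tWord x) = [W₀ x]) ∧
      CopyWord (τ.arr tWord) i q j)
    (fun _ τ => τ.reg rI = p ∧ (∀ a, a ≠ tWord → τ.arr a = σ.arr a) ∧
      (∀ r, r ≠ rI → r ≠ rJ → τ.reg r = σ.reg r) ∧
      (∀ x, x < i ∨ p ≤ x → τ.arr tWord x = σ.arr tWord x) ∧
      (∀ x, 1 ≤ x → x < p → τ.arr tWord x < f₁ ∧ v (τ.arr tWord x) = [W₀ x]) ∧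
      CopyWord (τ.arr tWord) i p j) ?_
    ⟨i, le_rfl, hip, (ωR _ (by decide)).trans hidx, by simp [hω], le_rfl,
      fun a _ => by rw [ωA], fun r _ hr => ωR r hr, fun x _ => by rw [ωA],
      fun x h1 h2 => by rw [ωA]; exact h.word x h1 h2, fun d hd => by omega⟩).mono ?_
  · rintro m τ ⟨q, hiq, hqp, hq, hqj, hm, hA, hR, hout, hw, hc⟩
    obtain ⟨d, rfl⟩ := Nat.exists_eq_add_of_le hiq
    have hJ : τ.reg rJ = j + d := by omega
    obtain ⟨hJ1, hJ2⟩ := hw (j + d) (by omega) (by omega)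
    rw [wp_block_cons, wp_store]
    refine ⟨by simp [hq]; omega, by simp [hJ]; omega, ?_⟩
    rw [wp_block_cons, wp_assign]
    refine ⟨by simp [hq]; omega, ?_⟩
    rw [wp_block_cons, wp_assign]
    refine ⟨by simp [hJ]; omega, wp_block_nil.2 ?_⟩
    obtain ⟨υ, hυ⟩ : ∃ υ, υ = ((τ.setCell tWord (i + d) (τ.arr tWord (j + d))).setReg rI
      (i + d + 1)).setReg rJ (j + d + 1) := ⟨_, rfl⟩
    have hυ' : ∀ x y z u, x = i + d → y = τ.arr tWord (j + d) → z = i + d + 1 → u = j + d + 1 →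
        ((τ.setCell tWord x y).setReg rI z).setReg rJ u = υ := by
      rintro _ _ _ _ rfl rfl rfl rfl
      exact hυ.symm
    rw [hυ' _ _ _ _ (by simp [hq]) (by simp [hJ]) (by simp [hq]) (by simp [hJ])]
    have υI : υ.reg rI = i + d + 1 := by simp [hυ]
    have υJ : υ.reg rJ = j + d + 1 := by simp [hυ]
    have υR : ∀ r, r ≠ rI → r ≠ rJ → υ.reg r = σ.reg r := fun r h1 h2 => by
      simp [hυ, h1, h2, hR r h1 h2]
    have υA : ∀ a, a ≠ tWord → υ.arr a = σ.arr a := fun a h1 => by simp [hυ, h1, hA a h1]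
    have υW : ∀ x, x ≠ i + d → υ.arr tWord x = τ.arr tWord x := fun x hx => by
      simp [hυ, Function.update_of_ne hx]
    have υWi : υ.arr tWord (i + d) = τ.arr tWord (j + d) := by simp [hυ]
    have hout' : ∀ x, x < i ∨ i + d + 1 ≤ x → υ.arr tWord x = σ.arr tWord x := fun x hx => by
      rw [υW x (by omega), hout x (by omega)]
    have hw' : ∀ x, 1 ≤ x → x < i + d + 1 →
        υ.arr tWord x < f₁ ∧ v (υ.arr tWord x) = [W₀ x] := fun x h1 h2 => by
      by_cases hx : x = i + d
      · rw [hx, υWi, hW d hqp]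
        exact ⟨hJ1, hJ2⟩
      · rw [υW x hx]
        exact hw x h1 (by omega)
    have hc' : CopyWord (υ.arr tWord) i (i + d + 1) j := fun y hy => by
      rw [υW (j + y) (by omega)]
      by_cases hx : y = d
      · rw [hx, υWi]
      · rw [υW _ (by omega)]
        exact hc y (by omega)
    have υE := υA tEnd (by decide)
    have heB : σ.arr tEnd (i + d) ≤ 1 := (h.suf.bounds _ (by omega) (by omega)).2
    refine ⟨by simp [υI, υE]; omega, m - 25, by simp; omega, fun h0 => ?_, fun h0 => ?_⟩
    · have h0 : σ.arr tEnd (i + d) = 0 := by simpa [υI, υE] using h0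
      have hqp' : i + d + 1 < p := by
        by_contra hn
        rw [show i + d = p - 1 by omega, he] at h0
        omega
      exact ⟨i + d + 1, by omega, hqp', υI, by omega, by omega, υA, υR, hout', hw', hc'⟩
    · have h0 : σ.arr tEnd (i + d) ≠ 0 := by simpa [υI, υE] using h0
      have hqp' : i + d + 1 = p := by
        by_contra hn
        exact h0 (heq _ hiq (by omega))
      subst hqp'
      exact ⟨υI, υA, υR, hout', hw', hc'⟩
  · rintro t τ ⟨m, hm, hp, hA, hR, hout, hw, hc⟩
    have hB := hA tBeg (by decide)
    have hE := hA tEnd (by decide)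
    rw [wp_block_nil]
    refine ⟨p, k, hip, by simp; omega, rfl, (hR _ (by decide) (by decide)).trans h.len, hp,
      (hR _ (by decide) (by decide)).trans h.cnt, by omega, by omega, fun x h1 h2 => ?_, hw, ?_, ?_,
      ?_⟩
    · rw [hout x (.inr h1), h.old x (by omega) h2]
    · rw [hB, hE]
      refine (h.pre.imp (fun _ _ _ => ⟨rfl, rfl⟩) ?_).append (k' := 1) (f' := 0)
        (.fac p hip (by omega) (by omega) hbq he heq (by rwa [← hj]) (.nil _))
      intro x y z h1 h2 h3 h4 h5 hc d hd
      rw [hout _ (.inl (by omega)), hout _ (.inl (by omega)), hc d hd]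
    · rw [hB, hE]
      exact hsuf
    · rw [hA tKind (by decide), hA tLeft (by decide), hA tRight (by decide)]
      exact h.gram

/-- Introduce a nonterminal for the free letter at `i`. -/
def initFree : Cmd := block [
  .store tKind xCnt 0,
  .store tLeft xCnt (.cell tWord xI),
  .store tWord xI xCnt,
  .assign rCnt (xCnt + 1),
  .assign rI (xI + 1)]

theorem wp_initFree (h : InitState W₀ n i k₁ f₁ k₂ f₂ v σ) (hin : i ≤ n)
    (hb : σ.arr tBeg i = 0) (hB : 2 * n + 10 ≤ B) (hfB : f₁ + f₂ ≤ B) (hWB : W₀ i ≤ B) :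
    Wp B initFree σ fun t τ => t ≤ 40 ∧ ∃ f v', f₂ = f + 1 ∧
      InitState W₀ n (i + 1) k₁ (f₁ + 1) k₂ f v' τ := by
  have hidx := h.idx
  have hcnt := h.cnt
  have hi1 := h.one_le
  have hWi := h.old i le_rfl hin
  obtain ⟨he, f, rfl, hsuf⟩ := h.suf.free_cases (by omega) hb
  rw [initFree, wp_block_cons, wp_store]
  refine ⟨by simp [hcnt]; omega, by simp, ?_⟩
  rw [wp_block_cons, wp_store]
  refine ⟨by simp [hcnt]; omega, by simp [hidx, hWi]; omega, ?_⟩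
  rw [wp_block_cons, wp_store]
  refine ⟨by simp [hidx]; omega, by simp [hcnt]; omega, ?_⟩
  rw [wp_block_cons, wp_assign]
  refine ⟨by simp [hcnt]; omega, ?_⟩
  rw [wp_block_cons, wp_assign]
  refine ⟨by simp [hidx]; omega, wp_block_nil.2 ?_⟩
  obtain ⟨υ, hυ⟩ : ∃ υ, υ = ((((σ.setCell tKind f₁ 0).setCell tLeft f₁ (W₀ i)).setCell tWord i
    f₁).setReg rCnt (f₁ + 1)).setReg rI (i + 1) := ⟨_, rfl⟩
  have hυ' : ∀ x₁ x₂ x₃ x₄ x₅ y z u, x₁ = f₁ → x₂ = f₁ → x₃ = W₀ i → x₄ = i → x₅ = f₁ → y = 0 →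
      z = f₁ + 1 → u = i + 1 →
      ((((σ.setCell tKind x₁ y).setCell tLeft x₂ x₃).setCell tWord x₄
        x₅).setReg rCnt z).setReg rI u = υ := by
    rintro _ _ _ _ _ _ _ _ rfl rfl rfl rfl rfl rfl rfl rfl
    exact hυ.symm
  rw [hυ' _ _ _ _ _ _ _ _ (by simp [hcnt]) (by simp [hcnt]) (by simp [hidx, hWi])
    (by simp [hidx]) (by simp [hcnt]) (by simp) (by simp [hcnt]) (by simp [hidx])]
  have υA : ∀ a, a ≠ tWord → a ≠ tKind → a ≠ tLeft → υ.arr a = σ.arr a := fun a h1 h2 h3 => by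
    simp [hυ, h1, h2, h3]
  have υW : ∀ x, x ≠ i → υ.arr tWord x = σ.arr tWord x := fun x hx => by
    simp [hυ, Function.update_of_ne hx]
  have υWi : υ.arr tWord i = f₁ := by simp [hυ]
  have υK : υ.arr tKind = Function.update (σ.arr tKind) f₁ 0 := by simp [hυ]
  have υL : υ.arr tLeft = Function.update (σ.arr tLeft) f₁ (W₀ i) := by simp [hυ]
  have υB := υA tBeg (by decide) (by decide) (by decide)
  have υE := υA tEnd (by decide) (by decide) (by decide)
  obtain ⟨v', hv'⟩ : ∃ v', v' = Function.update v f₁ [W₀ i] := ⟨_, rfl⟩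
  have hvc : v' f₁ = [W₀ i] := by simp [hv']
  have hvne : ∀ x, x ≠ f₁ → v' x = v x := fun x hx => by simp [hv', Function.update_of_ne hx]
  refine ⟨by simp, f, v', rfl, by simp [hυ, h.len], by simp [hυ], by simp [hυ], by omega, by omega,
    fun x h1 h2 => ?_, fun x h1 h2 => ?_, ?_, ?_, ?_⟩
  · rw [υW x (by omega), h.old x (by omega) h2]
  · by_cases hx : x = i
    · rw [hx, υWi, hvc]
      exact ⟨by omega, rfl⟩
    · obtain ⟨h3, h4⟩ := h.word x h1 (by omega)
      rw [υW x hx, hvne _ (by omega)]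
      exact ⟨by omega, h4⟩
  · rw [υB, υE]
    refine (h.pre.imp (fun _ _ _ => ⟨rfl, rfl⟩) ?_).snoc_free hb he
    intro x y z h1 h2 h3 h4 h5 hc d hd
    rw [υW _ (by omega), υW _ (by omega), hc d hd]
  · rw [υB, υE]
    exact hsuf
  · rw [υK, υL, υA tRight (by decide) (by decide) (by decide)]
    intro x hx
    rcases Nat.lt_succ_iff_lt_or_eq.1 hx with hx | rfl
    · simp only [Function.update_of_ne hx.ne, hvne x hx.ne]
      rcases h.gram x hx with hg | ⟨g1, g2, g3, g4⟩
      · exact .inl hg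
      · refine .inr ⟨g1, g2, g3, ?_⟩
        rw [hvne _ (by omega), hvne _ (by omega), g4]
    · simp only [Function.update_self]
      exact .inl ⟨trivial, hvc⟩

/-- Every free letter gets its own nonterminal, even if letters coincide, so the number of
nonterminals is exactly `f`. Copying them onto the factors keeps the equality of each factor with
its definition. -/
theorem wp_algInit {k f : ℕ} (hlen : σ.reg rLen = n)
    (h : Seg (CopyWord (σ.arr tWord)) (σ.arr tBeg) (σ.arr tEnd) k f 1 (n + 1))
    (hWB : ∀ x, 1 ≤ x → x ≤ n → σ.arr tWord x ≤ B) (hB : 2 * n + 10 ≤ B) :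
    Wp B algInit σ fun t τ => t ≤ 60 * n + 20 ∧ ∃ v, τ.reg rLen = n ∧ τ.reg rCnt = f ∧
      Seg (CopyWord (τ.arr tWord)) (τ.arr tBeg) (τ.arr tEnd) k f 1 (n + 1) ∧
      (∀ x, 1 ≤ x → x ≤ n → τ.arr tWord x < f) ∧
      Gram f v (τ.arr tKind) (τ.arr tLeft) (τ.arr tRight) ∧
      expand v (τ.arr tWord) n = expand (fun a => [a]) (σ.arr tWord) n := by
  have hB1 : 1 ≤ B := by omega
  have hf := h.add_le
  change Wp B (block [.assign rCnt 0, .assign rI 1,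
    .loop (xI.isLe xLen) (.ite (.cell tBeg xI) initFactor initFree)]) σ _
  rw [wp_block_cons, wp_assign]
  refine ⟨by simp, ?_⟩
  rw [wp_block_cons, wp_assign]
  refine ⟨by simp; omega, ?_⟩
  rw [wp_block_cons]
  simp only [Expr.one_eq, Expr.zero_eq, Expr.eval_const]
  obtain ⟨ω, hω⟩ : ∃ ω, ω = (σ.setReg rCnt 0).setReg rI 1 := ⟨_, rfl⟩
  rw [← hω]
  have ωA : ω.arr = σ.arr := by simp [hω]
  have h0 : InitState (σ.arr tWord) n 1 0 0 k f (fun _ => []) ω := by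
    refine ⟨by simp [hω, hlen], by simp [hω], by simp [hω], le_rfl, by omega, fun _ _ _ => by rw [ωA],
      fun x h1 h2 => by omega, .nil 1, by rw [ωA]; exact h, fun x hx => by omega⟩
  refine (Wp.loop (m := 60 * n + 10) (fun m τ => ∃ i k₁ f₁ k₂ f₂ v,
      InitState (σ.arr tWord) n i k₁ f₁ k₂ f₂ v τ ∧ k₁ + k₂ = k ∧ f₁ + f₂ = f ∧
      60 * (n + 1 - i) + 10 ≤ m)
    (fun _ τ => ∃ k₁ f₁ k₂ f₂ v, InitState (σ.arr tWord) n (n + 1) k₁ f₁ k₂ f₂ v τ ∧ k₁ + k₂ = k ∧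
      f₁ + f₂ = f) ?_ ⟨1, 0, 0, k, f, _, h0, by omega, by omega, by omega⟩).mono ?_
  · rintro m τ ⟨i, k₁, f₁, k₂, f₂, v, hI, hk, hf', hm⟩
    have hidx := hI.idx
    have hlen' := hI.len
    have hle := hI.le
    have hi1 := hI.one_le
    refine ⟨by simp [hidx, hlen']; omega, fun hc => ?_, fun hc => ?_⟩
    · have hin : i ≤ n := by
        simp [hidx, hlen'] at hc
        omega
      have hbd := hI.suf.bounds i le_rfl (by omega)
      rw [wp_ite]
      refine ⟨by simp [hidx]; omega, fun hb => ?_, fun hb => ?_⟩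
      · have hb : τ.arr tBeg i ≠ 0 := by simpa [hidx] using hb
        refine (wp_initFactor hI hin hb hB (by omega)).mono ?_
        rintro t υ ⟨p, k', hip, ht, rfl, hυ⟩
        have := hυ.le
        exact ⟨m - t - 10, by simp; omega, p, k₁ + 1, f₁, k', f₂, v, hυ, by omega, by omega,
          by omega⟩
      · have hb : τ.arr tBeg i = 0 := by simpa [hidx] using hb
        refine (wp_initFree hI hin hb hB (by omega) (hWB i hi1 hin)).mono ?_
        rintro t υ ⟨ht, f', v', rfl, hυ⟩
        exact ⟨m - t - 10, by simp; omega, i + 1, k₁, f₁ + 1, k₂, f', v', hυ, by omega, by omega,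
          by omega⟩
    · have hin : i = n + 1 := by
        simp [hidx, hlen'] at hc
        omega
      subst hin
      exact ⟨0, by simp; omega, k₁, f₁, k₂, f₂, v, hI, hk, hf'⟩
  · rintro t τ ⟨m, hm, k₁, f₁, k₂, f₂, v, hI, hk, hf'⟩
    have hz := hI.suf.add_le
    obtain rfl : f₁ = f := by omega
    obtain rfl : k₁ = k := by omega
    rw [wp_block_nil]
    exact ⟨by simp; omega, v, hI.len, hI.cnt, hI.pre, fun x h1 h2 => (hI.word x h1 (by omega)).1,
      hI.gram, expand_congr fun x h1 h2 => (hI.word x h1 (by omega)).2⟩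

end RAM

/-! ### The output tables as a straight-line program. -/

/-- The straight-line program described by tables. -/
def SLP.ofTables (cnt : ℕ) (kind left right : ℕ → ℕ) : SLP ℕ where
  size := cnt
  rule i := if h : kind i = 1 ∧ left i < i ∧ right i < i then
    .inr (⟨left i, h.2.1⟩, ⟨right i, h.2.2⟩) else .inl (left i)

theorem Gram.word_ofTables {cnt : ℕ} {v : ℕ → List ℕ} {kind left right : ℕ → ℕ}
    (h : Gram cnt v kind left right) (c : ℕ) (hc : c < cnt) :
    (SLP.ofTables cnt kind left right).word ⟨c, hc⟩ = v c := by
  induction c using Nat.strong_induction_on with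
  | _ c ih =>
    rw [SLP.word]
    rcases h c hc with ⟨h0, hv⟩ | ⟨h1, hl, hr, hv⟩
    · have : (SLP.ofTables cnt kind left right).rule ⟨c, hc⟩ = .inl (left c) :=
        dif_neg (by simp [h0])
      simp only [this]
      exact hv.symm
    · have : (SLP.ofTables cnt kind left right).rule ⟨c, hc⟩ = .inr (⟨left c, hl⟩, ⟨right c, hr⟩) :=
        dif_pos ⟨h1, hl, hr⟩
      simp only [this]
      exact (congrArg₂ (· ++ ·) (ih _ hl (hl.trans hc)) (ih _ hr (hr.trans hc))).trans hv.symm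

theorem Gram.outputs {v : ℕ → List ℕ} {σ : RAM.State}
    (h : Gram (σ.reg RAM.rCnt) v (σ.arr RAM.tKind) (σ.arr RAM.tLeft) (σ.arr RAM.tRight)) :
    σ.Outputs (SLP.ofTables (σ.reg RAM.rCnt) (σ.arr RAM.tKind) (σ.arr RAM.tLeft)
      (σ.arr RAM.tRight)) := by
  refine ⟨rfl, fun i => ?_⟩
  rcases h i i.2 with ⟨h0, hv⟩ | ⟨h1, hl, hr, hv⟩
  · have : (SLP.ofTables (σ.reg RAM.rCnt) (σ.arr RAM.tKind) (σ.arr RAM.tLeft)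
      (σ.arr RAM.tRight)).rule i = .inl (σ.arr RAM.tLeft i) := dif_neg (by simp [h0])
    simp only [this]
    exact ⟨h0, trivial⟩
  · have : (SLP.ofTables (σ.reg RAM.rCnt) (σ.arr RAM.tKind) (σ.arr RAM.tLeft)
      (σ.arr RAM.tRight)).rule i = .inr (⟨σ.arr RAM.tLeft i, hl⟩, ⟨σ.arr RAM.tRight i, hr⟩) :=
        dif_pos ⟨h1, hl, hr⟩
    simp only [this]
    exact ⟨h1, trivial, trivial⟩

/-! ### The potential that sums the costs of all rounds. -/

/-- The linear function up to `l`, continued by `l + l * log (x / l)`. -/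
noncomputable def linLog (l x : ℝ) : ℝ := if x ≤ l then x else l + l * Real.log (x / l)

theorem linLog_nonneg {l x : ℝ} (hl : 0 < l) (hx : 0 ≤ x) : 0 ≤ linLog l x := by
  rw [linLog]
  split_ifs with h
  · exact hx
  · have := Real.log_nonneg ((one_le_div hl).2 (not_le.1 h).le)
    positivity

theorem linLog_eq {l x : ℝ} (hl : 0 < l) (hx : l ≤ x) : linLog l x = l + l * Real.log (x / l) := by
  rw [linLog]
  split_ifs with h
  · rw [le_antisymm h hx, div_self hl.ne', Real.log_one, mul_zero, add_zero]
  · rfl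

theorem linLog_le {l x : ℝ} (hl : 0 < l) : linLog l x ≤ x := by
  rw [linLog]
  split_ifs with h
  · exact le_rfl
  · have hx : 0 < x := hl.trans (not_le.1 h)
    have h1 := mul_le_mul_of_nonneg_left (Real.log_le_sub_one_of_pos (div_pos hx hl)) hl.le
    rw [mul_sub, mul_div_cancel₀ _ hl.ne'] at h1
    linarith

/-- The function decreases by a constant fraction of `min l x` when `x` is multiplied by `5 / 6`. -/
theorem min_le_linLog_sub {l x y : ℝ} (hl : 0 < l) (hy : 0 < y) (hyx : 6 * y ≤ 5 * x) :
    min l x ≤ 6 * (linLog l x - linLog l y) := by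
  have hx : 0 < x := by linarith
  -- Below `l` the function is linear and loses `x - y ≥ x / 6`. Above `l` it loses `l * log (x / y)
  -- ≥ l / 6`, by `log t ≥ 1 - 1 / t`. In the mixed case `y < l < x` the same inequality is used for
  -- `t = x / l`.
  rcases le_or_gt x l with hxl | hxl
  · rw [linLog, linLog, if_pos hxl, if_pos (by linarith), min_eq_right hxl]
    linarith
  · rw [min_eq_left hxl.le, linLog_eq hl hxl.le]
    rcases le_or_gt l y with hly | hly
    · rw [linLog_eq hl hly]
      have h1 : Real.log (x / l) - Real.log (y / l) = Real.log (x / y) := by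
        rw [Real.log_div hx.ne' hl.ne', Real.log_div hy.ne' hl.ne', Real.log_div hx.ne' hy.ne']
        ring
      have h2 := Real.one_sub_inv_le_log_of_pos (div_pos hx hy)
      rw [inv_div] at h2
      have h3 : y / x ≤ 5 / 6 := by
        rw [div_le_div_iff₀ hx (by norm_num)]
        linarith
      have h4 : l * (1 / 6) ≤ l * Real.log (x / y) :=
        mul_le_mul_of_nonneg_left (by linarith) hl.le
      rw [← h1] at h4
      linarith
    · rw [linLog, if_pos hly.le]
      have h2 := Real.one_sub_inv_le_log_of_pos (div_pos hx hl)
      rw [inv_div] at h2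
      have h4 : l * (1 - l / x) ≤ l * Real.log (x / l) := mul_le_mul_of_nonneg_left h2 hl.le
      -- For `x ≤ 6 * l / 5`, `y` is bounded by `5 * x / 6`, and the resulting convex function of
      -- `x` takes the value `11 * l / 6` at both ends of `[l, 6 * l / 5]`. For larger `x`, the
      -- bounds `y ≤ l` and `l / x ≤ 5 / 6` suffice.
      have h5 : y + l * (l / x) ≤ 11 / 6 * l := by
        have h6 : l * (l / x) * x = l * l := by field_simp
        refine le_of_mul_le_mul_right ?_ hx
        rw [add_mul, h6]
        rcases le_or_gt (6 * l) (5 * x) with h7 | h7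
        · nlinarith
        · nlinarith [mul_nonneg (sub_nonneg.2 hxl.le) (sub_nonneg.2 h7.le)]
      linarith

/-! ### The rounds of the main algorithm. -/

namespace RAM

/-- The state between the rounds of the main algorithm. -/
structure MainState (w : List ℕ) (l n k f : ℕ) (v : ℕ → List ℕ) (σ : State) : Prop where
  len : σ.reg rLen = n
  one_le : 1 ≤ n
  seg : Seg (CopyWord (σ.arr tWord)) (σ.arr tBeg) (σ.arr tEnd) k f 1 (n + 1)
  lt : ∀ x, 1 ≤ x → x ≤ n → σ.arr tWord x < σ.reg rCnt
  gram : Gram (σ.reg rCnt) v (σ.arr tKind) (σ.arr tLeft) (σ.arr tRight)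
  word : expand v (σ.arr tWord) n = w
  last : n = 1 → σ.arr tWord 1 + 1 = σ.reg rCnt
  le : k ≤ l
  size : (σ.reg rCnt : ℝ) + f + 24 * linLog l n ≤ 2 * l + 24 * linLog l w.length

variable {w : List ℕ} {l n k f B : ℕ} {v : ℕ → List ℕ} {σ : State}

/-- The potential is at most the length, so all numbers of nonterminals are linear in the length of
the input and fit into machine words. -/
theorem MainState.cnt_le (h : MainState w l n k f v σ) (hl : 0 < l) (hlw : l ≤ w.length) :
    σ.reg rCnt + f ≤ 26 * w.length := by
  have hl' : (0 : ℝ) < l := by exact_mod_cast hl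
  have h1 := h.size
  have h2 := linLog_nonneg hl' n.cast_nonneg
  have h3 := linLog_le (x := w.length) hl'
  have h4 : (l : ℝ) ≤ w.length := by exact_mod_cast hlw
  have : (σ.reg rCnt : ℝ) + f ≤ 26 * w.length := by linarith
  exact_mod_cast this

/-- Pairing increases the sum of nonterminals and free letters by at most `4 * min l n`, replacement
not at all. The constant `24` in `MainState` is this `4` times the `6` from the decrease of the
potential. -/
theorem wp_round (h : MainState w l n k f v σ) (hl : 0 < l) (hlw : l ≤ w.length)
    (hn : 2 ≤ n) (hB : 2 * n + 10 ≤ B) (hwB : 26 * w.length + n + 1 ≤ B) :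
    Wp B (block [algPairing, algReplace]) σ fun t τ => t ≤ 350 * n + 50 ∧
      ∃ n' k' f' v', 6 * n' ≤ 5 * n ∧ MainState w l n' k' f' v' τ := by
  have hcf := h.cnt_le hl hlw
  have h1 := h.one_le
  rw [wp_block_cons]
  refine (wp_algPairing h.len h1 h.seg hB).mono ?_
  rintro t₁ τ ⟨ht₁, hF, k', f', hseg, hpr, hk, hf⟩
  have hfn := hseg.add_le
  have hC := hF.reg rCnt (by decide) (by decide)
  have hW := hF.arr tWord (by decide) (by decide) (by decide)
  rw [wp_block_cons]
  refine (wp_algReplace (val := v) (k := k') (f := f') (n := n)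
    ((hF.reg _ (by decide) (by decide)).trans h.len) h1 (by rwa [hW]) hpr
    (by rw [hW, hC]; exact h.lt) ?_ hB (by omega)).mono ?_
  · rw [hC, hF.arr tKind (by decide) (by decide) (by decide),
      hF.arr tLeft (by decide) (by decide) (by decide),
      hF.arr tRight (by decide) (by decide) (by decide)]
    exact h.gram
  · rintro t₂ υ ⟨ht₂, n', f'', v', hlen, hn', hnn', hseg', hcnt, hlt, hg, hw, hlast⟩
    -- From `3 * n' ≤ 2 * n + 1`; this needs `n ≥ 2`.
    have hnn : 6 * n' ≤ 5 * n := by omega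
    rw [wp_block_nil]
    refine ⟨by omega, n', k', f'', v', hnn, hlen, hn', hseg', hlt, hg, ?_, fun h2 => ?_,
      hk.trans h.le, ?_⟩
    · rw [hw, hW, h.word]
    · rcases hlast h2 with h3 | h3
      · omega
      · exact h3
    · have h2 := h.size
      have h3 := min_le_linLog_sub (l := l) (x := n) (y := n') (by exact_mod_cast hl)
        (by exact_mod_cast hn') (by exact_mod_cast hnn)
      -- The bound by `l` is that of the pairing; the bound by `n` holds because there are at most
      -- `n` free letters.
      have h4 : f' ≤ f + 4 * min l n := by
        have := h.le
        omega
      have h4' : (f' : ℝ) ≤ f + 4 * min (l : ℝ) n := by exact_mod_cast h4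
      have h5 : (f'' : ℝ) + υ.reg rCnt = f' + σ.reg rCnt := by
        rw [hC] at hcnt
        exact_mod_cast hcnt
      linarith

theorem wp_rounds (h : MainState w l n k f v σ) (hl : 0 < l) (hlw : l ≤ w.length)
    (hnw : n ≤ w.length) (hB : 40 * w.length ≤ B) :
    Wp B (.loop (Expr.isLt 1 xLen) (block [algPairing, algReplace])) σ fun t τ =>
      t ≤ 2500 * n ∧ ∃ k f v, MainState w l 1 k f v τ := by
  have hB1 : 1 ≤ B := by omega
  -- A round at length `n` shortens the word by at least `n / 6`, which releases `400 * n` units and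
  -- covers its `350 * n + 50`.
  refine (Wp.loop (m := 2400 * n + 10) (fun m τ => ∃ n k f v, n ≤ w.length ∧
      MainState w l n k f v τ ∧ 2400 * n + 10 ≤ m)
    (fun _ τ => ∃ k f v, MainState w l 1 k f v τ) ?_ ⟨n, k, f, v, hnw, h, le_rfl⟩).mono ?_
  · rintro m τ ⟨n, k, f, v, hnw, h, hm⟩
    have hlen := h.len
    have h1 := h.one_le
    refine ⟨by simp [hlen, hB1]; omega, fun hc => ?_, fun hc => ?_⟩
    · have hn : 2 ≤ n := by
        simp [hlen] at hc
        omega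
      refine (wp_round h hl hlw hn (by omega) (by omega)).mono ?_
      rintro t υ ⟨ht, n', k', f', v', hn', h'⟩
      exact ⟨m - t - 5, by simp; omega, n', k', f', v', by omega, h', by omega⟩
    · have hn : n = 1 := by
        simp [hlen] at hc
        omega
      subst hn
      exact ⟨0, by simp; omega, k, f, v, h⟩
  · rintro t τ ⟨m, hm, h'⟩
    have := h.one_le
    exact ⟨by omega, h'⟩

theorem expand_holds {W : ℕ → ℕ} (hW : ∀ k x, w[k]? = some x → W (k + 1) = x) :
    expand (fun a => [a]) W w.length = w := by
  induction w using List.reverseRecOn with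
  | nil => rfl
  | append_singleton u a ih =>
    rw [List.length_append, List.length_singleton, expand_succ, ih fun k x h => hW k x (by
      rw [List.getElem?_append_left (List.getElem?_eq_some_iff.1 h).1, h]),
      hW u.length a (by simp)]

theorem State.Holds.getElem? {a : ℕ} {u : List ℕ} (h : σ.Holds a u) (k x : ℕ)
    (hk : u[k]? = some x) : σ.arr a (k + 1) = x := by
  obtain ⟨h1, rfl⟩ := List.getElem?_eq_some_iff.1 hk
  exact h k h1

theorem wp_algMain_tail {F : List (Phrase ℕ)} (hw : w ≠ []) (hF : IsLZ77 F w)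
    (hs : σ.Stores w F) (hwB : ∀ a ∈ w, a ≤ B) (hB : 40 * w.length ≤ B) :
    Wp B (block [algInit, .loop (Expr.isLt 1 xLen) (block [algPairing, algReplace])]) σ fun t τ =>
      t ≤ 3000 * w.length ∧ ∃ S : SLP ℕ, τ.Outputs S ∧ S.Generates w ∧
        (S.size : ℝ) ≤ 26 * (F.length + F.length * Real.log ((w.length : ℝ) / F.length)) := by
  have hN : 1 ≤ w.length := List.length_pos_iff.2 hw
  obtain ⟨hlen, hW, hb, he⟩ := hs
  obtain ⟨-, -, k, f, hkf, hseg⟩ := hF.seg hW.getElem? hb.getElem? he.getElem?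
  have hl : 0 < F.length := hF.ne_nil hw
  have hlw := hF.length_le
  rw [wp_block_cons]
  refine (wp_algInit hlen hseg (fun x h1 h2 => ?_) (by omega)).mono ?_
  · obtain ⟨x, rfl⟩ := Nat.exists_eq_add_of_le' h1
    rw [hW x h2]
    exact hwB _ (List.getElem_mem _)
  · rintro t τ ⟨ht, v, hlen', hcnt, hseg', hlt, hg, hword⟩
    have hM : MainState w F.length w.length k f v τ := by
      refine ⟨hlen', hN, hseg', by rwa [hcnt], by rwa [hcnt], ?_, fun h1 => ?_, by omega, ?_⟩
      · rw [hword, expand_holds hW.getElem?]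
      -- A word of length one has a single free letter, whose nonterminal `0` is the last one
      -- introduced.
      · have := hseg'.add_le
        have := hlt 1 le_rfl hN
        omega
      · have : (f : ℝ) ≤ F.length := by exact_mod_cast (by omega : f ≤ F.length)
        rw [hcnt]
        linarith
    rw [wp_block_cons]
    refine (wp_rounds hM hl hlw le_rfl hB).mono ?_
    rintro t₂ υ ⟨ht₂, k', f', v', h⟩
    have hgr := h.gram
    have hlast := h.last rfl
    rw [wp_block_nil]
    refine ⟨by omega, _, hgr.outputs, ⟨?_, ?_⟩, ?_⟩
    · change 0 < υ.reg rCnt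
      omega
    · refine (hgr.word_ofTables _ _).trans ?_
      rw [← h.word]
      -- The only letter that is left is the last nonterminal, which is the start symbol.
      change v' (υ.reg rCnt - 1) = v' (υ.arr tWord 1) ++ []
      rw [List.append_nil, ← hlast, Nat.add_sub_cancel]
    · have h1 := h.size
      have hl' : (0 : ℝ) < F.length := by exact_mod_cast hl
      have hlw' : (F.length : ℝ) ≤ w.length := by exact_mod_cast hlw
      have h2 := linLog_nonneg hl' zero_le_one
      rw [linLog_eq hl' hlw', Nat.cast_one] at h1
      have h3 := mul_nonneg hl'.le (Real.log_nonneg ((one_le_div hl').2 hlw'))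
      have h4 : (0 : ℝ) ≤ f' := Nat.cast_nonneg _
      change (υ.reg rCnt : ℝ) ≤ _
      linarith

theorem exec_algMain {lz : Cmd} {F : List (Phrase ℕ)} {T : ℕ} {τ : State} (hw : w ≠ [])
    (hF : IsLZ77 F w) (hB : 3000 * w.length ≤ B) (hwB : ∀ a ∈ w, a ≤ B)
    (hlz : Exec B lz (inputState w) T τ) (hs : τ.Stores w F) :
    ∃ (t : ℕ) (σ : State) (S : SLP ℕ), Exec B (algMain lz) (inputState w) t σ ∧
      t ≤ T + 3000 * w.length ∧ σ.Outputs S ∧ S.Generates w ∧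
      (S.size : ℝ) ≤ 26 * (F.length + F.length * Real.log ((w.length : ℝ) / F.length)) := by
  obtain ⟨t, σ, h, ht, S, h1, h2, h3⟩ := wp_algMain_tail hw hF hs hwB (by omega)
  exact ⟨T + t, σ, S, hlz.seq h, by omega, h1, h2, h3⟩

end RAM

theorem mainTheorem1 :
    ∃ C : ℕ,
      -- some program computes smallest LZ77 factorisations in linear time
      (∃ lz : RAM.Cmd, RAM.ComputesLZ77 lz) ∧
      -- with every such program as a subroutine, the main algorithm runs in linear time, and its
      -- output has the claimed size and the claimed approximation ratio
      (∀ lz : RAM.Cmd, RAM.ComputesLZ77 lz →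
        RAM.AchievesInLinearTime (RAM.algMain lz) fun w σ =>
          ∃ S : SLP ℕ, σ.Outputs S ∧ S.Generates w ∧
            (S.size : ℝ) ≤
              C * (lzSize w + lzSize w * Real.log ((w.length : ℝ) / lzSize w)) ∧
            (S.size : ℝ) ≤
              C * (1 + Real.log ((w.length : ℝ) / slpSize w)) * slpSize w) ∧
      -- over every alphabet and for every LZ77 factorisation `F` produced by the subroutine, the
      -- rest of the algorithm takes linear time, and the size bound holds for the size of `F`
      (∀ (lz : RAM.Cmd) (w : List ℕ) (F : List (Phrase ℕ)) (B T : ℕ) (τ : RAM.State),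
        w ≠ [] → IsLZ77 F w → C * w.length ≤ B → (∀ a ∈ w, a ≤ B) →
        RAM.Exec B lz (RAM.inputState w) T τ → τ.Stores w F →
        ∃ (t : ℕ) (σ : RAM.State) (S : SLP ℕ),
          RAM.Exec B (RAM.algMain lz) (RAM.inputState w) t σ ∧ t ≤ T + C * w.length ∧
            σ.Outputs S ∧ S.Generates w ∧
            (S.size : ℝ) ≤
              C * (F.length + F.length * Real.log ((w.length : ℝ) / F.length))) ∧
      -- the smallest factorisation is not larger than the smallest straight-line program
      (∀ w : List ℕ, w ≠ [] → lzSize w ≤ slpSize w) := by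
  have hlog : ∀ l N : ℕ, l ≤ N → 0 ≤ (l : ℝ) + l * Real.log ((N : ℝ) / l) := fun l N h => by
    rcases l.eq_zero_or_pos with rfl | hl
    · simp
    · have := Real.log_nonneg ((one_le_div (show (0 : ℝ) < l by exact_mod_cast hl)).2
        (show (l : ℝ) ≤ N by exact_mod_cast h))
      positivity
  -- The running time requires `3000`. The sizes need only `26`, and `4 * 26` for the comparison
  -- with the smallest grammar.
  refine ⟨3000, ⟨_, RAM.computesLZ77_lzProgram⟩, fun lz hlz c => ?_,
    fun lz w F B T τ hw hF hB hwB hE hs => ?_, fun w hw => lzSize_le_slpSize hw⟩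
  · obtain ⟨K, hK⟩ := hlz c
    -- Machine words have to hold the numbers up to `K * N ^ K` of the subroutine, the letters up to
    -- `N ^ c`, and `3000 * N` for the rest.
    refine ⟨K + c + 3000, fun w hw hwc => ?_⟩
    have hN : 1 ≤ w.length := List.length_pos_iff.2 hw
    obtain ⟨T, τ, hE, hT, F, hF, hFl, hs⟩ := hK w hw hwc
    have hpow : ∀ a b : ℕ, a ≤ K + c + 3000 → b ≤ K + c + 3000 →
        a * w.length ^ b ≤ (K + c + 3000) * w.length ^ (K + c + 3000) := fun a b ha hb =>
      Nat.mul_le_mul ha (Nat.pow_le_pow_right hN hb)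
    obtain ⟨t, σ, S, h1, h2, h3, h4, h5⟩ := RAM.exec_algMain hw hF
      (by simpa using hpow 3000 1 (by omega) (by omega))
      (fun a ha => (hwc a ha).2.trans (by simpa using hpow 1 c (by omega) (by omega)))
      (hE.mono (hpow K K (by omega) (by omega))) hs
    rw [hFl] at h5
    have hl := lzSize_pos hw
    have hlN := lzSize_le_length w
    have hlg := lzSize_le_slpSize hw
    have hg := slpSize_lt hw
    have h6 := hlog _ _ hlN
    have h7 := Real.mul_one_add_log_div_le (x := lzSize w) (y := slpSize w) (N := w.length)
      (by exact_mod_cast hl) (by exact_mod_cast hlg) (by exact_mod_cast hlN)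
      (by exact_mod_cast hg.le)
    refine ⟨t, σ, h1, by nlinarith, S, h3, h4, ?_, ?_⟩
    · push_cast
      linarith
    · push_cast
      nlinarith
  · obtain ⟨t, σ, S, h1, h2, h3, h4, h5⟩ := RAM.exec_algMain hw hF hB hwB hE hs
    have h6 := hlog _ _ hF.length_le
    refine ⟨t, σ, S, h1, h2, h3, h4, ?_⟩
    push_cast
    linarith
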